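/- Let $n\ge 1$, $M=\{1,\dots,n\}$, $M'=\{1',\dots,n'\}$. The Brauer semigroup $\mathfrak B_n$ consists of all partitions of $M\cup M'$ into two-element blocks. To form $\alpha\beta$, identify the right pin $i'$ of $\alpha$ with the left pin $i$ of $\beta$ for every $i$; two of the remaining pins form a block of $\alpha\beta$ if and only if they are joined by a path, and closed circles are disregarded. Write $a\equiv_\alpha b$ if $\{a,b\}$ is a block of $\alpha$. The corank of $\alpha$ is $n$ minus the number of blocks $\{a,b'\}$ with $a,b\in M$. The symmetric group $S_n$ embeds by $\sigma\mapsto\{\{i,\sigma(i)'\}: i\in M\}$ and acts on subsets of $\mathfrak B_n$ by conjugation; $s_{i,j}$ is the transposition of $i$ and $j$. An $\mathcal R$-cross-section is a subsemigroup containing exactly one element of each class of Green's relation $\mathcal R$. It is canonical if for each of its elements $\alpha$ there is $k\in\{0,\dots,\lfloor n/2\rfloor\}$ such that $\alpha$ has corank $2k$ and $(n-2k+1)'\equiv_\alpha(n-2k+2)',\dots,(n-1)'\equiv_\alpha n'$. For a canonical $\mathcal R$-cross-section $\Lambda$ and $1\le i<j\le n$ let $\alpha_{i,j}$ be the unique element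 of $\Lambda$ of corank $2$ with $i\equiv j$. For $j\le n-2$ and $1\le l\le\lfloor (n-j)/2\rfloor$ put $\alpha_{i,j}^{(l)}=\mathrm{id}\in S_2$ if $(n-2l+2)\equiv_{\alpha_{i,j}}(n-2l)'$, and $\alpha_{i,j}^{(l)}=(1,2)\in S_2$ if $(n-2l+2)\equiv_{\alpha_{i,j}}(n-2l-1)'$. Let $A_n$ be the set of the pairs $(n-3,n-2),(n-5,n-4),\dots$ with positive entries. $\Lambda$ is regular if all $\alpha_{i,j}^{(l)}$ are $\mathrm{id}$; it is alternating if $\alpha_{i,j}^{(l)}=\mathrm{id}$ for $(i,j)\in A_n$ and $\alpha_{i,j}^{(l)}=(1,2)$ for $(i,j)\notin A_n$, for all possible $i,j,l$. Theorem. Let $n\ge 2$ and $w_n=s_{n-1,n}\prod_{(i,i+1)\in A_n}s_{i,i+1}$, so that $w_n\neq\mathrm{id}$. If $n\ne 5$, the stabilizer in $S_n$ of any canonical $\mathcal R$-cross-section is $\{\mathrm{id},w_n\}$. If $n=5$, the stabilizer of a canonical $\mathcal R$-cross-section is $\{\mathrm{id},w_5\}$ when $\alpha_{1,2}^{(1)}=\alpha_{1,3}^{(1)}$,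 and is trivial otherwise. Moreover: (i) For $n=1$ the only $\mathcal R$-cross-section is $\{\mathrm{id}\}$. (ii) For $n=2$ there is only one $\mathcal R$-cross-section; it is canonical and equals $\{\alpha_{1,2},\mathrm{id}\}$. (iii) For $n=3$ there are exactly $3$ $\mathcal R$-cross-sections, namely $\Lambda$, $s_{1,2}\Lambda s_{1,2}$ and $s_{1,3}\Lambda s_{1,3}$, where $\Lambda$ is the unique canonical one; it consists of $\mathrm{id}$ and of idempotents $\alpha_{1,2},\alpha_{2,3},\alpha_{1,3}$. (iv) For $n=4$ there are exactly $12$ $\mathcal R$-cross-sections, each $S_4$-conjugate to the unique regular canonical one. (v) For $n=5$ there are exactly $2\cdot 5!$ $\mathcal R$-cross-sections, each $S_5$-conjugate to a canonical one with $\alpha_{1,2}^{(1)}=\mathrm{id}$. (vi) For $n=6$ there are exactly $2\cdot 6!$ $\mathcal R$-cross-sections, each $S_6$-conjugate to a canonical one with $\alpha_{1,2}^{(1)}=\alpha_{1,2}^{(2)}=\mathrm{id}$. (vii) For $n\ge 7$ there are exactly $n!$ $\mathcal R$-cross-sections. There is exactly one regular and exactly one alternating canonical $\mathcal R$-cross-section,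 and the set of all $\mathcal R$-cross-sections is the disjoint union of the $S_n$-orbits of these two, each of which has $n!/2$ elements. -/

import Mathlib

/-- An element of the Brauer semigroup on `n` strands: a partition of `M ∪ M'` into two-element
subsets, where `M = {1, …, n}` (left pins, `Sum.inl`) and `M' = {1', …, n'}` (right pins,
`Sum.inr`).  The partition is recorded by the map sending a pin to the other element of its
block; the number `i ∈ {1, …, n}` is the element of `Fin n` of value `i - 1`. -/
@[ext]
structure Brauer (n : ℕ) where
  mate : Fin n ⊕ Fin n → Fin n ⊕ Fin n
  mate_mate : ∀ x, mate (mate x) = x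
  mate_ne : ∀ x, mate x ≠ x

namespace Brauer

section Composition

variable {n : ℕ}

/-- Two chips side by side: `Sum.inl` marks the pins of the first chip, `Sum.inr` those of the
second one.  `wire` jumps along the block of a pin inside its own chip. -/
def wire (α β : Brauer n) :
    (Fin n ⊕ Fin n) ⊕ (Fin n ⊕ Fin n) → (Fin n ⊕ Fin n) ⊕ (Fin n ⊕ Fin n) :=
  Sum.map α.mate β.mate

/-- Right pins of the first chip are identified with the left pins of the second one; the
remaining (outer) pins are left fixed. -/
def glue : (Fin n ⊕ Fin n) ⊕ (Fin n ⊕ Fin n) → (Fin n ⊕ Fin n) ⊕ (Fin n ⊕ Fin n)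
  | .inl (.inl a) => .inl (.inl a)
  | .inl (.inr m) => .inr (.inl m)
  | .inr (.inl m) => .inl (.inr m)
  | .inr (.inr b) => .inr (.inr b)

/-- The pins of the composed chip, as outer pins of the two chips side by side. -/
def outer : Fin n ⊕ Fin n → (Fin n ⊕ Fin n) ⊕ (Fin n ⊕ Fin n)
  | .inl a => .inl (.inl a)
  | .inr b => .inr (.inr b)

/-- The inverse of `outer` on outer pins (its values on inner pins are irrelevant). -/
def pin : (Fin n ⊕ Fin n) ⊕ (Fin n ⊕ Fin n) → Fin n ⊕ Fin n
  | .inl (.inl a) => .inl a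
  | .inl (.inr m) => .inl m
  | .inr (.inl m) => .inr m
  | .inr (.inr b) => .inr b

theorem wire_wire (α β : Brauer n) (x) : wire α β (wire α β x) = x := by
  rcases x with x | x <;> simp [wire, mate_mate]

theorem wire_ne (α β : Brauer n) (x) : wire α β x ≠ x := by
  rcases x with x | x <;> simp [wire, mate_ne]

theorem glue_glue (x : (Fin n ⊕ Fin n) ⊕ (Fin n ⊕ Fin n)) : glue (glue x) = x := by
  rcases x with (x | x) | (x | x) <;> rfl

theorem glue_outer (x : Fin n ⊕ Fin n) : glue (outer x) = outer x := by
  rcases x with x | x <;> rfl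

theorem pin_outer (x : Fin n ⊕ Fin n) : pin (outer x) = x := by
  rcases x with x | x <;> rfl

theorem outer_pin (x : (Fin n ⊕ Fin n) ⊕ (Fin n ⊕ Fin n)) (h : glue x = x) :
    outer (pin x) = x := by
  rcases x with (x | x) | (x | x) <;> simp_all [glue, outer, pin]

/-- One step along the composed chip: pass to the identified pin, then follow the wire. -/
def step (α β : Brauer n) (x : (Fin n ⊕ Fin n) ⊕ (Fin n ⊕ Fin n)) :
    (Fin n ⊕ Fin n) ⊕ (Fin n ⊕ Fin n) :=
  wire α β (glue x)

theorem exists_exit (α β : Brauer n) (x : Fin n ⊕ Fin n) :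
    ∃ k, glue ((step α β)^[k + 1] (outer x)) = (step α β)^[k + 1] (outer x) := by
  have hinj : Function.Injective (step α β) := by
    intro a b h
    have h1 : glue a = glue b := by
      rw [← wire_wire α β (glue a), ← wire_wire α β (glue b)]
      exact congrArg (wire α β) h
    rw [← glue_glue a, ← glue_glue b, h1]
  obtain ⟨N, hN, hp⟩ := hinj.mem_periodicPts (outer x)
  refine ⟨N - 1, ?_⟩
  rw [Nat.sub_add_cancel hN, hp.eq, glue_outer]

/-- The number of steps, minus one, after which the walk that starts at the outer pin `x`
reaches an outer pin for the first time. -/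
def exitTime (α β : Brauer n) (x : Fin n ⊕ Fin n) : ℕ := Nat.find (exists_exit α β x)

/-- The outer pin at which the walk that starts at the outer pin `x` leaves the composed chip. -/
def exit (α β : Brauer n) (x : Fin n ⊕ Fin n) : Fin n ⊕ Fin n :=
  pin ((step α β)^[exitTime α β x + 1] (outer x))

theorem outer_exit (α β : Brauer n) (x : Fin n ⊕ Fin n) :
    outer (exit α β x) = (step α β)^[exitTime α β x + 1] (outer x) :=
  outer_pin _ (Nat.find_spec (exists_exit α β x))

theorem inner_of_lt (α β : Brauer n) (x : Fin n ⊕ Fin n) {j : ℕ} (h0 : 0 < j)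
    (hj : j < exitTime α β x + 1) :
    glue ((step α β)^[j] (outer x)) ≠ (step α β)^[j] (outer x) := by
  have := Nat.find_min (exists_exit α β x) (m := j - 1) (by unfold exitTime at hj; omega)
  rwa [Nat.sub_add_cancel h0] at this

theorem reverse (α β : Brauer n) (x : Fin n ⊕ Fin n) (j i : ℕ)
    (h : j + i = exitTime α β x + 1) :
    (step α β)^[j] (outer (exit α β x)) = glue ((step α β)^[i] (outer x)) := by
  induction j generalizing i with
  | zero =>
    obtain rfl : i = exitTime α β x + 1 := by omega
    rw [← outer_exit, glue_outer]; rfl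
  | succ j ih =>
    rw [Function.iterate_succ_apply', ih (i + 1) (by omega), Function.iterate_succ_apply']
    simp only [step, glue_glue, wire_wire]

theorem exit_exit (α β : Brauer n) (x : Fin n ⊕ Fin n) : exit α β (exit α β x) = x := by
  have ht : exitTime α β (exit α β x) = exitTime α β x := by
    refine (Nat.find_eq_iff _).2 ⟨?_, fun k hk => ?_⟩
    · rw [reverse α β x _ 0 (by omega)]
      simp [glue_outer]
    · rw [reverse α β x (k + 1) (exitTime α β x - k) (by omega), glue_glue]
      exact (inner_of_lt α β x (by omega) (by omega)).symm
  have := outer_exit α β (exit α β x)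
  rw [ht, reverse α β x _ 0 (by omega)] at this
  rw [← pin_outer (exit α β (exit α β x)), this]
  simp [glue_outer, pin_outer]

theorem exit_ne (α β : Brauer n) (x : Fin n ⊕ Fin n) : exit α β x ≠ x := by
  intro h
  obtain ⟨j, hj | hj⟩ := Nat.even_or_odd' (exitTime α β x + 1)
  · have := reverse α β x j j (by omega)
    rw [h] at this
    exact inner_of_lt α β x (by omega) (by omega) this.symm
  · have := reverse α β x (j + 1) j (by omega)
    rw [h, Function.iterate_succ_apply'] at this
    exact wire_ne α β _ this

/-- Composition of chips: the right pins of `α` are connected with the left pins of `β`, and two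
outer pins form a block of `α * β` if and only if a path joins them.  Closed circles of inner
pins are disregarded. -/
instance : Mul (Brauer n) where
  mul α β := ⟨exit α β, exit_exit α β, exit_ne α β⟩

/-- The inclusion of the symmetric group: `σ` is sent to `{1, σ(1)'}, …, {n, σ(n)'}`. -/
def ofPerm (σ : Equiv.Perm (Fin n)) : Brauer n where
  mate
    | .inl a => .inr (σ a)
    | .inr b => .inl (σ.symm b)
  mate_mate x := by rcases x with x | x <;> simp
  mate_ne x := by rcases x with x | x <;> simp

instance : One (Brauer n) := ⟨ofPerm 1⟩

end Composition

section Relations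

variable {n : ℕ}

/-- Green's relation `R`: `α` and `β` generate the same principal right ideal. -/
def GreenR (α β : Brauer n) : Prop :=
  {α} ∪ {γ | ∃ δ, γ = α * δ} = ({β} ∪ {γ | ∃ δ, γ = β * δ} : Set (Brauer n))

/-- `i` and `j` are in the same block of `α`, for `i, j ∈ {1, …, n}`. -/
def LeftLeft (α : Brauer n) (i j : ℕ) : Prop :=
  ∃ a b : Fin n, a.val + 1 = i ∧ b.val + 1 = j ∧ α.mate (.inl a) = .inl b

/-- `i` and `j'` are in the same block of `α`, for `i, j ∈ {1, …, n}`. -/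
def LeftRight (α : Brauer n) (i j : ℕ) : Prop :=
  ∃ a b : Fin n, a.val + 1 = i ∧ b.val + 1 = j ∧ α.mate (.inl a) = .inr b

/-- `i'` and `j'` are in the same block of `α`, for `i, j ∈ {1, …, n}`. -/
def RightRight (α : Brauer n) (i j : ℕ) : Prop :=
  ∃ a b : Fin n, a.val + 1 = i ∧ b.val + 1 = j ∧ α.mate (.inr a) = .inr b

/-- The number of lines of `α`, that is, of blocks `{a, b'}` with `a, b ∈ {1, …, n}`. -/
def rank (α : Brauer n) : ℕ :=
  (Finset.univ.filter fun a : Fin n => (α.mate (.inl a)).isRight = true).card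

/-- The corank of `α`. -/
def corank (α : Brauer n) : ℕ := n - α.rank

end Relations

section CrossSections

variable {n : ℕ}

/-- `R`-cross-sections: subsemigroups with exactly one element in each `R`-class. -/
def IsRCrossSection (Λ : Set (Brauer n)) : Prop :=
  (∀ α ∈ Λ, ∀ β ∈ Λ, α * β ∈ Λ) ∧ ∀ α : Brauer n, ∃! β, β ∈ Λ ∧ GreenR α β

/-- Canonical `R`-cross-sections: every element has some corank `2k` and contains the blocks
`{(n-2k+1)', (n-2k+2)'}, …, {(n-1)', n'}`. -/
def IsCanonical (Λ : Set (Brauer n)) : Prop :=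
  IsRCrossSection Λ ∧ ∀ α ∈ Λ, ∃ k ≤ n / 2, α.corank = 2 * k ∧
    ∀ t < k, α.RightRight (n - 2 * t - 1) (n - 2 * t)

/-- The element `α_{i,j}` of `Λ` (the one of corank `2` containing the block `{i, j}`) joins
`n-2l+2` to `(n-2l)'`, that is, the parameter `α_{i,j}^{(l)}` is the identity of `S_2`. -/
def ParamId (Λ : Set (Brauer n)) (i j l : ℕ) : Prop :=
  ∃ α ∈ Λ, α.corank = 2 ∧ α.LeftLeft i j ∧ α.LeftRight (n - 2 * l + 2) (n - 2 * l)

/-- The element `α_{i,j}` of `Λ` (the one of corank `2` containing the block `{i, j}`) joins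
`n-2l+2` to `(n-2l-1)'`, that is, the parameter `α_{i,j}^{(l)}` is the transposition of `S_2`. -/
def ParamSwap (Λ : Set (Brauer n)) (i j l : ℕ) : Prop :=
  ∃ α ∈ Λ, α.corank = 2 ∧ α.LeftLeft i j ∧ α.LeftRight (n - 2 * l + 2) (n - 2 * l - 1)

/-- The pairs `(n-3, n-2), (n-5, n-4), …` with positive entries. -/
def pairs (n : ℕ) : List (ℕ × ℕ) :=
  (List.range (n / 2 - 1)).map fun t => (n - 2 * t - 3, n - 2 * t - 2)

/-- Regular canonical `R`-cross-sections: all parameters are the identity. -/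
def IsRegular (Λ : Set (Brauer n)) : Prop :=
  IsCanonical Λ ∧ ∀ i j l : ℕ, 1 ≤ i → i < j → j + 1 < n → 1 ≤ l → l ≤ (n - j) / 2 →
    ParamId Λ i j l

/-- Alternating canonical `R`-cross-sections: `α_{i,j}^{(l)}` is the identity if `(i, j)` belongs
to `pairs n`, and the transposition otherwise. -/
def IsAlternating (Λ : Set (Brauer n)) : Prop :=
  IsCanonical Λ ∧ ∀ i j l : ℕ, 1 ≤ i → i < j → j + 1 < n → 1 ≤ l → l ≤ (n - j) / 2 →
    ((i, j) ∈ pairs n → ParamId Λ i j l) ∧ ((i, j) ∉ pairs n → ParamSwap Λ i j l)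

/-- The conjugate `σ⁻¹ Λ σ`. -/
def conj (σ : Equiv.Perm (Fin n)) (Λ : Set (Brauer n)) : Set (Brauer n) :=
  (fun α => ofPerm σ⁻¹ * α * ofPerm σ) '' Λ

/-- The `S_n`-orbit of `Λ` under conjugation. -/
def orbit (Λ : Set (Brauer n)) : Set (Set (Brauer n)) :=
  {Θ | ∃ σ : Equiv.Perm (Fin n), Θ = conj σ Λ}

/-- The stabilizer of `Λ` in `S_n` under conjugation. -/
def stabilizer (Λ : Set (Brauer n)) : Set (Equiv.Perm (Fin n)) :=
  {σ | conj σ Λ = Λ}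

end CrossSections

/-- The transposition `(i, j) ∈ S_n`, for `i, j ∈ {1, …, n}`. -/
def transposition (n i j : ℕ) : Equiv.Perm (Fin n) :=
  if h : (1 ≤ i ∧ i ≤ n) ∧ (1 ≤ j ∧ j ≤ n) then
    Equiv.swap ⟨i - 1, by omega⟩ ⟨j - 1, by omega⟩
  else 1

/-- The product of the transposition `(n-1, n)` with the transpositions `(i, i+1)` for
`(i, i+1)` in `pairs n`. -/
def pairFlip (n : ℕ) : Equiv.Perm (Fin n) :=
  transposition n (n - 1) n * ((pairs n).map fun p => transposition n p.1 p.2).prod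

/-- The set of all `R`-cross-sections of the Brauer semigroup on `n` strands. -/
def crossSections (n : ℕ) : Set (Set (Brauer n)) := {Λ | IsRCrossSection Λ}

end Brauer

/-! Number the pins from right to left starting with 0 and cut them into the blocks {2t, 2t+1}; for
odd `n` the last pin stays alone. Two chips are R-related exactly when they have the same left-left
blocks (`greenR_iff`), so a cross-section is a multiplicatively closed choice of one chip for each
involution of the left pins.

The main tool is absorption (`ll_mul_eq_left`): if every left-left block of β that meets a line of α
has its other end in a right-right block of α whose opposite end is free in β, then αβ has the
left-left blocks of α. In a cross-section this forces αβ = α, so the right-right blocks of β occur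
in α. Absorption shows that, beyond k common right-right blocks, all elements of corank at least
2k+2 share one more (`exists_common_block`); hence each cross-section is conjugate to a canonical
one.

In a canonical cross-section the element of corank 2 with left-left block {a, b}, a < b, is rigid up
to bits (`RCan.eq_chip`): each block t below the block of a moves up by one, flipped or not
according to a bit ε(t); the partner of a goes to b'; all other lines are horizontal. Flipping
blocks changes ε by a coboundary (`relabel_chip`), which allows the normalization that the pair
{2t+2, 2t+3} has ε(t) = 0. An element of corank 4 factors in two ways through elements of corank 2,
and comparing the factorizations gives linear equations over F₂. Their solution
(`Normal.exists_bit`): the bit does not depend on t, vanishes when {a, b} is a block, and otherwise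
depends only on the parity of a + b, with values u and v. The equations that link the pairs (2, b)
and (3, d), b ≠ d, connect everything once the three values 4, 5, 6 are available for b and d; hence
u = v for n ≥ 7.

Conversely all these parameters occur (`rCan_normalSection`). The cross-section consists of the
products of cells, each tail avoiding the pins 0 and 1. That such a product depends only on its
left-left blocks is a diamond argument (`Gen.ext`), fed by identities between products of two cells
with disjoint pairs (`commutingCells`). So there is one normal cross-section for n ≤ 4, there are
four for n = 5, 6, and two for n ≥ 7 (the regular one, u = v = 0, and the alternating one, u = v =
1).

A permutation between normal cross-sections flips all blocks or none (`Normal.perm_eq`). This gives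
2 · #(cross-sections) = n! · #(normal ones), and bounds the stabilizers. The total flip preserves
the parity of a + b unless it fixes a last unpaired pin; this matters only for n = 5, where it
exchanges u and v. -/

namespace Brauer

/-! ### Colorings: composition of chips as composition of relations -/

variable {n : ℕ}

/-- The pair `(f, g)` of colorings of the left and of the right pins is constant on the blocks. -/
def Coloring (α : Brauer n) (f g : Fin n → Prop) : Prop :=
  ∀ x, Sum.elim f g (α.mate x) ↔ Sum.elim f g x

theorem mate_injective (α : Brauer n) : Function.Injective α.mate :=
  Function.LeftInverse.injective α.mate_mate

theorem mate_eq_iff (α : Brauer n) {x y} : α.mate x = y ↔ α.mate y = x :=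
  ⟨fun h => by rw [← h, mate_mate], fun h => by rw [← h, mate_mate]⟩

/-- The pins on the path that joins the outer pin `x` to its mate. -/
def track (α β : Brauer n) (x : Fin n ⊕ Fin n) : Set ((Fin n ⊕ Fin n) ⊕ (Fin n ⊕ Fin n)) :=
  {z | ∃ j ≤ exitTime α β x + 1,
    z = (step α β)^[j] (outer x) ∨ z = glue ((step α β)^[j] (outer x))}

theorem glue_mem_track {α β : Brauer n} {x z} (h : z ∈ track α β x) : glue z ∈ track α β x := by
  obtain ⟨j, hj, rfl | rfl⟩ := h
  · exact ⟨j, hj, .inr rfl⟩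
  · exact ⟨j, hj, .inl (glue_glue _)⟩

theorem wire_mem_track {α β : Brauer n} {x z} (h : z ∈ track α β x) : wire α β z ∈ track α β x := by
  have key : ∀ j ≤ exitTime α β x + 1,
      wire α β (glue ((step α β)^[j] (outer x))) ∈ track α β x ∧
      wire α β ((step α β)^[j] (outer x)) ∈ track α β x := by
    intro j hj
    have h2 : ∀ i, wire α β ((step α β)^[i + 1] (outer x)) =
        glue ((step α β)^[i] (outer x)) := by
      intro i
      rw [Function.iterate_succ_apply', step, wire_wire]
    have h1 : wire α β (glue ((step α β)^[j] (outer x))) = (step α β)^[j + 1] (outer x) := by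
      rw [Function.iterate_succ_apply', step]
    constructor
    · rcases Nat.lt_or_ge j (exitTime α β x + 1) with hlt | hge
      · exact ⟨j + 1, hlt, .inl h1⟩
      · obtain rfl : j = exitTime α β x + 1 := by omega
        rw [← outer_exit, glue_outer, outer_exit, h2]
        exact ⟨exitTime α β x, by omega, .inr rfl⟩
    · cases j with
      | zero =>
        refine ⟨1, by omega, .inl ?_⟩
        simp [step, glue_outer]
      | succ i => rw [h2]; exact ⟨i, by omega, .inr rfl⟩
  obtain ⟨j, hj, rfl | rfl⟩ := h
  · exact (key j hj).2
  · exact (key j hj).1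

theorem glue_mem_track_iff {α β : Brauer n} {x z} : glue z ∈ track α β x ↔ z ∈ track α β x :=
  ⟨fun h => by simpa [glue_glue] using glue_mem_track h, glue_mem_track⟩

theorem wire_mem_track_iff {α β : Brauer n} {x z} :
    wire α β z ∈ track α β x ↔ z ∈ track α β x :=
  ⟨fun h => by simpa [wire_wire] using wire_mem_track h, wire_mem_track⟩

theorem outer_mem_track_iff {α β : Brauer n} {x y} :
    outer y ∈ track α β x ↔ y = x ∨ y = exit α β x := by
  have hinj : Function.Injective (outer (n := n)) := Function.LeftInverse.injective pin_outer
  constructor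
  · rintro ⟨j, hj, h⟩
    have h' : outer y = (step α β)^[j] (outer x) := by
      rcases h with h | h
      · exact h
      · rw [← glue_glue ((step α β)^[j] (outer x)), ← h, glue_outer]
    rcases Nat.eq_zero_or_pos j with rfl | h0
    · exact .inl (hinj h')
    · rcases Nat.lt_or_ge j (exitTime α β x + 1) with hlt | hge
      · exact absurd (by rw [← h', glue_outer]) (inner_of_lt α β x h0 hlt)
      · obtain rfl : j = exitTime α β x + 1 := by omega
        exact .inr (hinj (h'.trans (outer_exit α β x).symm))
  · rintro (rfl | rfl)
    · exact ⟨0, by omega, .inl rfl⟩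
    · exact ⟨_, le_rfl, .inl (outer_exit α β x)⟩

theorem mul_mate_def (α β : Brauer n) (x) : (α * β).mate x = exit α β x := rfl

/-- A track is closed under `wire` and `glue`, so a coloring of the outer pins extends inwards along
the tracks of the colored pins; inner circles stay uncolored. Conversely, a coloring of both chips
is invariant under `step` and agrees at the two ends of a walk. Associativity becomes immediate,
without counting steps of walks through three chips. -/
theorem coloring_mul {α β : Brauer n} {f h : Fin n → Prop} :
    Coloring (α * β) f h ↔ ∃ g, Coloring α f g ∧ Coloring β g h := by
  constructor
  · intro H
    let c : (Fin n ⊕ Fin n) ⊕ (Fin n ⊕ Fin n) → Prop :=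
      fun z => ∃ x, Sum.elim f h x ∧ z ∈ track α β x
    have hg : ∀ z, c (glue z) ↔ c z := fun z => by simp only [c, glue_mem_track_iff]
    have hw : ∀ z, c (wire α β z) ↔ c z := fun z => by simp only [c, wire_mem_track_iff]
    have ho : ∀ y, c (outer y) ↔ Sum.elim f h y := by
      intro y
      simp only [c, outer_mem_track_iff]
      constructor
      · rintro ⟨x, hx, rfl | rfl⟩
        · exact hx
        · exact (H x).2 hx
      · exact fun hy => ⟨y, hy, .inl rfl⟩
    have h1 : ∀ x, Sum.elim f (fun m => c (.inl (.inr m))) x ↔ c (.inl x) := by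
      rintro (a | m)
      · exact (ho (.inl a)).symm
      · rfl
    have h2 : ∀ x, Sum.elim (fun m => c (.inl (.inr m))) h x ↔ c (.inr x) := by
      rintro (m | b)
      · exact (hg (.inl (.inr m))).symm
      · exact (ho (.inr b)).symm
    refine ⟨fun m => c (.inl (.inr m)), fun x => ?_, fun x => ?_⟩
    · rw [h1, h1]; exact hw (.inl x)
    · rw [h2, h2]; exact hw (.inr x)
  · rintro ⟨g, hα, hβ⟩ x
    let c : (Fin n ⊕ Fin n) ⊕ (Fin n ⊕ Fin n) → Prop := Sum.elim (Sum.elim f g) (Sum.elim g h)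
    have hs : ∀ z, c (step α β z) ↔ c z := by
      intro z
      have hg : c (glue z) ↔ c z := by rcases z with (z | z) | (z | z) <;> rfl
      have hw : ∀ z, c (wire α β z) ↔ c z := by
        rintro (z | z)
        · exact hα z
        · exact hβ z
      exact (hw _).trans hg
    have hit : ∀ j, c ((step α β)^[j] (outer x)) ↔ c (outer x) := by
      intro j
      induction j with
      | zero => rfl
      | succ j ih => rw [Function.iterate_succ_apply', hs, ih]
    have ho : ∀ y, Sum.elim f h y ↔ c (outer y) := by rintro (y | y) <;> rfl
    rw [mul_mate_def, ho, ho, outer_exit, hit]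

/-- Test with the coloring in which exactly `x` and its mate are colored. Thus a chip is determined
by its colorings. -/
theorem mate_eq_of_coloring {α : Brauer n} {x y} (hne : x ≠ y)
    (h : ∀ f g, Coloring α f g → (Sum.elim f g x ↔ Sum.elim f g y)) : α.mate x = y := by
  have he : ∀ z, Sum.elim (fun a => Sum.inl a = x ∨ Sum.inl a = α.mate x)
      (fun a => Sum.inr a = x ∨ Sum.inr a = α.mate x) z ↔ z = x ∨ z = α.mate x := by
    rintro (z | z) <;> rfl
  have hc : Coloring α (fun a => Sum.inl a = x ∨ Sum.inl a = α.mate x)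
      (fun a => Sum.inr a = x ∨ Sum.inr a = α.mate x) := by
    intro z
    rw [he, he, α.mate_eq_iff, α.mate_injective.eq_iff, eq_comm, or_comm]
  have := h _ _ hc
  rw [he, he] at this
  rcases this.1 (.inl rfl) with h | h
  · exact absurd h.symm hne
  · exact h.symm

theorem mul_mate_eq {α β : Brauer n} {x y} (hne : x ≠ y)
    (h : ∀ f g k, Coloring α f g → Coloring β g k → (Sum.elim f k x ↔ Sum.elim f k y)) :
    (α * β).mate x = y :=
  mate_eq_of_coloring hne fun f k hc => by
    obtain ⟨g, h1, h2⟩ := coloring_mul.1 hc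
    exact h f g k h1 h2

theorem eq_of_coloring {α β : Brauer n} (h : ∀ f g, Coloring α f g → Coloring β f g) :
    α = β := by
  ext1
  funext x
  exact mate_eq_of_coloring (β.mate_ne x).symm fun f g hc => (h f g hc x).symm

theorem coloring_ofPerm {σ : Equiv.Perm (Fin n)} {f g : Fin n → Prop} :
    Coloring (ofPerm σ) f g ↔ ∀ a, f a ↔ g (σ a) := by
  constructor
  · intro h a
    exact (h (.inl a)).symm
  · rintro h (a | b)
    · exact (h a).symm
    · have := h (σ.symm b)
      rwa [σ.apply_symm_apply] at this

theorem coloring_one {f g : Fin n → Prop} : Coloring (1 : Brauer n) f g ↔ f = g := by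
  refine coloring_ofPerm.trans ⟨fun h => funext fun a => propext (h a), fun h a => by rw [h]; rfl⟩

instance : Monoid (Brauer n) where
  mul_assoc α β γ := eq_of_coloring fun f k h => by
    obtain ⟨g, h1, h3⟩ := coloring_mul.1 h
    obtain ⟨m, h1, h2⟩ := coloring_mul.1 h1
    exact coloring_mul.2 ⟨m, h1, coloring_mul.2 ⟨g, h2, h3⟩⟩
  one_mul α := eq_of_coloring fun f k h => by
    obtain ⟨g, h1, h2⟩ := coloring_mul.1 h
    rwa [coloring_one.1 h1]
  mul_one α := eq_of_coloring fun f k h => by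
    obtain ⟨g, h1, h2⟩ := coloring_mul.1 h
    rwa [← coloring_one.1 h2]

/-! ### Short paths through a product -/

section Products

variable {α β : Brauer n} {a b c d k l m : Fin n}

theorem mul_left_left (h : α.mate (.inl a) = .inl b) : (α * β).mate (.inl a) = .inl b :=
  mul_mate_eq (h ▸ (α.mate_ne _).symm) fun f g k h1 _ => by simpa [h] using (h1 (.inl a)).symm

theorem mul_right_right (h : β.mate (.inr a) = .inr b) : (α * β).mate (.inr a) = .inr b :=
  mul_mate_eq (h ▸ (β.mate_ne _).symm) fun f g k _ h2 => by simpa [h] using (h2 (.inr a)).symm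

theorem mul_line (h1 : α.mate (.inl a) = .inr m) (h2 : β.mate (.inl m) = .inr b) :
    (α * β).mate (.inl a) = .inr b :=
  mul_mate_eq (by simp) fun f g k c1 c2 => by
    have e1 := c1 (.inl a)
    have e2 := c2 (.inl m)
    simp only [h1, h2, Sum.elim_inl, Sum.elim_inr] at *
    tauto

theorem mul_cap (h1 : α.mate (.inl a) = .inr m) (h2 : β.mate (.inl m) = .inl k)
    (h3 : α.mate (.inr k) = .inl c) : (α * β).mate (.inl a) = .inl c := by
  refine mul_mate_eq ?_ fun f g q c1 c2 => ?_
  · rintro ⟨rfl⟩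
    rw [α.mate_eq_iff, h1] at h3
    exact β.mate_ne _ (h2.trans (by simpa using h3.symm))
  · have e1 := c1 (.inl a)
    have e2 := c2 (.inl m)
    have e3 := c1 (.inr k)
    rw [h3] at e3
    simp only [h1, h2, Sum.elim_inl, Sum.elim_inr] at *
    tauto

theorem mul_cup (h1 : β.mate (.inr a) = .inl m) (h2 : α.mate (.inr m) = .inr k)
    (h3 : β.mate (.inl k) = .inr c) : (α * β).mate (.inr a) = .inr c := by
  refine mul_mate_eq ?_ fun f g q c1 c2 => ?_
  · rintro ⟨rfl⟩
    rw [β.mate_eq_iff, h1] at h3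
    exact α.mate_ne _ (h2.trans (by simpa using h3.symm))
  · have e1 := c2 (.inr a)
    have e2 := c1 (.inr m)
    have e3 := c2 (.inl k)
    rw [h3] at e3
    simp only [h1, h2, Sum.elim_inl, Sum.elim_inr] at *
    tauto

theorem mul_zigzag (h1 : α.mate (.inl a) = .inr m) (h2 : β.mate (.inl m) = .inl k)
    (h3 : α.mate (.inr k) = .inr l) (h4 : β.mate (.inl l) = .inr b) :
    (α * β).mate (.inl a) = .inr b :=
  mul_mate_eq (by simp) fun f g q c1 c2 => by
    have e1 := c1 (.inl a)
    have e2 := c2 (.inl m)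
    have e3 := c1 (.inr k)
    have e4 := c2 (.inl l)
    simp only [h1, h2, h3, h4, Sum.elim_inl, Sum.elim_inr] at *
    tauto

end Products

/-! ### Left and right involutions, Green's relation, absorption, corank -/

/-- The involution of the left pins given by the left-left blocks. -/
def ll (α : Brauer n) (a : Fin n) : Fin n :=
  match α.mate (.inl a) with
  | .inl b => b
  | .inr _ => a

/-- The involution of the right pins given by the right-right blocks. -/
def rr (α : Brauer n) (a : Fin n) : Fin n :=
  match α.mate (.inr a) with
  | .inl _ => a
  | .inr b => b

theorem ll_of_inl {α : Brauer n} {a b : Fin n} (h : α.mate (.inl a) = .inl b) : ll α a = b := by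
  simp [ll, h]

theorem ll_of_inr {α : Brauer n} {a b : Fin n} (h : α.mate (.inl a) = .inr b) : ll α a = a := by
  simp [ll, h]

theorem rr_of_inr {α : Brauer n} {a b : Fin n} (h : α.mate (.inr a) = .inr b) : rr α a = b := by
  simp [rr, h]

theorem rr_of_inl {α : Brauer n} {a b : Fin n} (h : α.mate (.inr a) = .inl b) : rr α a = a := by
  simp [rr, h]

theorem ll_eq_self_iff {α : Brauer n} {a : Fin n} :
    ll α a = a ↔ ∃ b, α.mate (.inl a) = .inr b := by
  rcases h : α.mate (.inl a) with b | b
  · simp only [ll_of_inl h, reduceCtorEq, exists_false, iff_false]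
    rintro rfl
    exact α.mate_ne _ h
  · simp [ll_of_inr h]

theorem rr_eq_self_iff {α : Brauer n} {a : Fin n} :
    rr α a = a ↔ ∃ b, α.mate (.inr a) = .inl b := by
  rcases h : α.mate (.inr a) with b | b
  · simp [rr_of_inl h]
  · simp only [rr_of_inr h, reduceCtorEq, exists_false, iff_false]
    rintro rfl
    exact α.mate_ne _ h

theorem mate_inl_of_ll_ne {α : Brauer n} {a : Fin n} (h : ll α a ≠ a) :
    α.mate (.inl a) = .inl (ll α a) := by
  rcases h' : α.mate (.inl a) with b | b
  · rw [ll_of_inl h']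
  · exact absurd (ll_of_inr h') h

theorem mate_inr_of_rr_ne {α : Brauer n} {a : Fin n} (h : rr α a ≠ a) :
    α.mate (.inr a) = .inr (rr α a) := by
  rcases h' : α.mate (.inr a) with b | b
  · exact absurd (rr_of_inl h') h
  · rw [rr_of_inr h']

theorem ll_involutive (α : Brauer n) : Function.Involutive (ll α) := by
  intro a
  by_cases h : ll α a = a
  · rw [h, h]
  · exact ll_of_inl (α.mate_eq_iff.1 (mate_inl_of_ll_ne h))

theorem rr_involutive (α : Brauer n) : Function.Involutive (rr α) := by
  intro a
  by_cases h : rr α a = a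
  · rw [h, h]
  · exact rr_of_inr (α.mate_eq_iff.1 (mate_inr_of_rr_ne h))

theorem ll_mul_of_ne {α β : Brauer n} {a : Fin n} (h : ll α a ≠ a) : ll (α * β) a = ll α a :=
  ll_of_inl (mul_left_left (mate_inl_of_ll_ne h))

theorem rr_mul_of_ne {α β : Brauer n} {a : Fin n} (h : rr β a ≠ a) : rr (α * β) a = rr β a :=
  rr_of_inr (mul_right_right (mate_inr_of_rr_ne h))

theorem ll_one : ll (1 : Brauer n) = id := rfl

theorem eq_of_mate_inl {α β : Brauer n} (h : ∀ a, α.mate (.inl a) = β.mate (.inl a))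
    (hr : rr α = rr β) : α = β := by
  ext1
  funext x
  rcases x with a | b
  · exact h a
  · rcases hb : α.mate (.inr b) with a | c
    · rw [α.mate_eq_iff, h, β.mate_eq_iff] at hb
      exact hb.symm
    · have h1 := rr_of_inr hb
      have : rr β b ≠ b := by
        rw [← hr, h1]; rintro rfl; exact α.mate_ne _ hb
      rw [mate_inr_of_rr_ne this, ← hr, h1]

/-- The chip with the same involution on both sides, all of whose lines are horizontal. -/
def ofInvolutive (f : Fin n → Fin n) (hf : Function.Involutive f) : Brauer n where
  mate
    | .inl a => if f a = a then .inr a else .inl (f a)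
    | .inr a => if f a = a then .inl a else .inr (f a)
  mate_mate x := by
    have : ∀ a, f a ≠ a → a ≠ f a := fun _ => Ne.symm
    rcases x with a | a <;> by_cases h : f a = a <;> simp [h, hf a, this a]
  mate_ne x := by
    rcases x with a | a <;> by_cases h : f a = a <;> simp [h]

theorem ll_ofInvolutive (f : Fin n → Fin n) (hf : Function.Involutive f) :
    ll (ofInvolutive f hf) = f := by
  funext a
  by_cases h : f a = a
  · exact (ll_of_inr (b := a) (by simp [ofInvolutive, h])).trans h.symm
  · exact ll_of_inl (by simp [ofInvolutive, h])

/-- The factor δ is γ with its left pins pushed along the lines of α. The right-right blocks of α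
are copied to the left side of δ, where they only close circles. -/
theorem exists_eq_mul {α γ : Brauer n} (h : ∀ a, ll α a ≠ a → ll γ a = ll α a) :
    ∃ δ, γ = α * δ := by
  have hLL : ∀ {a b}, α.mate (.inl a) = .inl b → γ.mate (.inl a) = .inl b := by
    intro a b hab
    have h0 : ll α a ≠ a := by
      rw [ll_of_inl hab]; rintro rfl; exact α.mate_ne _ hab
    have h1 := h a h0
    have h2 := mate_inl_of_ll_ne (h1 ▸ h0 : ll γ a ≠ a)
    rw [h2, h1, ll_of_inl hab]
  -- `T` moves a left pin of `γ` along a line of `α`.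
  let T : Fin n ⊕ Fin n → Fin n ⊕ Fin n
    | .inl a => match α.mate (.inl a) with
      | .inl b => .inl b
      | .inr b => .inl b
    | .inr b => .inr b
  let D : Fin n ⊕ Fin n → Fin n ⊕ Fin n
    | .inl m => match α.mate (.inr m) with
      | .inl a => T (γ.mate (.inl a))
      | .inr k => .inl k
    | .inr b => T (γ.mate (.inr b))
  have hT : ∀ {a m}, α.mate (.inl a) = .inr m → T (.inl a) = .inl m := fun h => by simp [T, h]
  have hD1 : ∀ {a m}, α.mate (.inr m) = .inl a → D (.inl m) = T (γ.mate (.inl a)) :=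
    fun h => by simp [D, h]
  have hD2 : ∀ {k m}, α.mate (.inr m) = .inr k → D (.inl m) = .inl k :=
    fun h => by simp [D, h]
  -- Since γ contains every left-left block of α, a left pin that γ joins to a pin outside these
  -- blocks starts a line of α; hence `T` really pushes it to the other side.
  have hline : ∀ x a, γ.mate x = .inl a → (∀ c d, x = .inl c → α.mate (.inl c) ≠ .inl d) →
      ∃ m, α.mate (.inl a) = .inr m := by
    intro x a hx hc
    rcases ha : α.mate (.inl a) with b | m
    · have := hLL ha
      rw [γ.mate_eq_iff] at hx
      rw [hx] at this
      exact absurd (α.mate_eq_iff.1 ha) (hc b a this)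
    · exact ⟨m, rfl⟩
  have hm : ∀ x, D (D x) = x := by
    rintro (m | b)
    · rcases hα : α.mate (.inr m) with a | k
      · have hα' := α.mate_eq_iff.1 hα
        rw [hD1 hα]
        rcases hγ : γ.mate (.inl a) with c | c
        · obtain ⟨m', hm'⟩ := hline _ c hγ (by rintro _ d ⟨rfl⟩; simp [hα'])
          rw [hT hm', hD1 (α.mate_eq_iff.1 hm'), γ.mate_eq_iff.1 hγ, hT hα']
        · change D (.inr c) = _
          change T (γ.mate (.inr c)) = _
          rw [γ.mate_eq_iff.1 hγ, hT hα']
      · rw [hD2 hα, hD2 (α.mate_eq_iff.1 hα)]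
    · change D (T (γ.mate (.inr b))) = _
      rcases hγ : γ.mate (.inr b) with c | c
      · obtain ⟨m', hm'⟩ := hline _ c hγ (by rintro _ d ⟨⟩)
        rw [hT hm', hD1 (α.mate_eq_iff.1 hm'), γ.mate_eq_iff.1 hγ]
      · change T (γ.mate (.inr c)) = _
        rw [γ.mate_eq_iff.1 hγ]
  have hne : ∀ x, D x ≠ x := by
    rintro (m | b)
    · rcases hα : α.mate (.inr m) with a | k
      · have hα' := α.mate_eq_iff.1 hα
        rw [hD1 hα]
        rcases hγ : γ.mate (.inl a) with c | c
        · obtain ⟨m', hm'⟩ := hline _ c hγ (by rintro _ d ⟨rfl⟩; simp [hα'])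
          rw [hT hm']
          rintro ⟨rfl⟩
          rw [α.mate_eq_iff, hα] at hm'
          exact γ.mate_ne _ (hγ.trans hm'.symm)
        · simp [T]
      · rw [hD2 hα]; rintro ⟨rfl⟩; exact α.mate_ne _ hα
    · change T (γ.mate (.inr b)) ≠ _
      rcases hγ : γ.mate (.inr b) with c | c
      · obtain ⟨m', hm'⟩ := hline _ c hγ (by rintro _ d ⟨⟩)
        simp [hT hm']
      · change Sum.inr c ≠ _
        rintro h
        exact γ.mate_ne _ (hγ.trans h)
  refine ⟨⟨D, hm, hne⟩, ?_⟩
  ext1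
  funext x
  symm
  rcases x with a | b
  · rcases hα : α.mate (.inl a) with c | m
    · rw [mul_left_left hα, hLL hα]
    · rcases hγ : γ.mate (.inl a) with c | c
      · obtain ⟨m', hm'⟩ := hline _ c hγ (by rintro _ d ⟨rfl⟩; simp [hα])
        exact mul_cap hα (k := m') ((hD1 (α.mate_eq_iff.1 hα)).trans (by rw [hγ, hT hm']))
          (α.mate_eq_iff.1 hm')
      · exact mul_line hα ((hD1 (α.mate_eq_iff.1 hα)).trans (by rw [hγ]))
  · rcases hγ : γ.mate (.inr b) with c | c
    · obtain ⟨m', hm'⟩ := hline _ c hγ (by rintro _ d ⟨⟩)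
      rw [mate_eq_iff]
      exact mul_line hm' ((hD1 (α.mate_eq_iff.1 hm')).trans (by rw [γ.mate_eq_iff.1 hγ]))
    · exact mul_right_right (show T (γ.mate (.inr b)) = _ by rw [hγ])

/-- The principal right ideal of α consists of the chips that contain all left-left blocks of α. -/
theorem greenR_iff {α β : Brauer n} : GreenR α β ↔ ll α = ll β := by
  have hprin : ∀ α γ : Brauer n, γ ∈ ({α} ∪ {γ | ∃ δ, γ = α * δ} : Set (Brauer n)) ↔
      ∀ a, ll α a ≠ a → ll γ a = ll α a := by
    intro α γ
    refine ⟨?_, fun h => .inr (exists_eq_mul h)⟩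
    rintro (rfl | ⟨δ, rfl⟩)
    · exact fun _ _ => rfl
    · exact fun a => ll_mul_of_ne
  constructor
  · intro h
    have h1 := (hprin β α).1 (by rw [← h]; exact .inl rfl)
    have h2 := (hprin α β).1 (by rw [h]; exact .inl rfl)
    funext a
    by_cases hb : ll β a = a
    · by_cases ha : ll α a = a
      · rw [ha, hb]
      · exact (h2 a ha).symm
    · exact h1 a hb
  · intro h
    ext γ
    rw [hprin, hprin, h]

/-- `α * β` has the same left-left blocks as `α` as soon as no two lines of `α` are joined by `β`
and each left-left block of `β` that meets a line of `α` meets a right-right block of `α` with a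
free end. -/
theorem ll_mul_eq_left {α β : Brauer n}
    (h : ∀ m, rr α m = m → ll β m ≠ m → rr α (ll β m) ≠ ll β m ∧
      ll β (rr α (ll β m)) = rr α (ll β m)) : ll (α * β) = ll α := by
  funext a
  by_cases ha : ll α a = a
  · obtain ⟨m, hm⟩ := ll_eq_self_iff.1 ha
    by_cases hb : ll β m = m
    · obtain ⟨b, hb⟩ := ll_eq_self_iff.1 hb
      rw [ha, ll_of_inr (mul_line hm hb)]
    · obtain ⟨h1, h2⟩ := h m (rr_eq_self_iff.2 ⟨a, α.mate_eq_iff.1 hm⟩) hb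
      obtain ⟨b, h2⟩ := ll_eq_self_iff.1 h2
      rw [ha, ll_of_inr (mul_zigzag hm (mate_inl_of_ll_ne hb) (mate_inr_of_rr_ne h1) h2)]
  · exact ll_mul_of_ne ha

/-- The points moved by a self-map of the pins. -/
def moved (f : Fin n → Fin n) : Finset (Fin n) := Finset.univ.filter fun a => f a ≠ a

theorem mem_moved {f : Fin n → Fin n} {a : Fin n} : a ∈ moved f ↔ f a ≠ a := by simp [moved]

theorem even_card_moved {f : Fin n → Fin n} (hf : Function.Involutive f) :
    2 ∣ (moved f).card := by
  have : (Function.Involutive.toPerm f hf) ^ 2 = 1 := by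
    ext a
    simp [pow_two, hf a]
  have h := Equiv.Perm.two_dvd_card_support this
  convert h using 2
  ext a
  simp [mem_moved]

theorem corank_eq_ll (α : Brauer n) : α.corank = (moved (ll α)).card := by
  have h1 : (moved (ll α)).card + α.rank = n := by
    have := Finset.card_filter_add_card_filter_not (s := (Finset.univ : Finset (Fin n)))
      (fun a => ll α a ≠ a)
    rw [Finset.card_univ, Fintype.card_fin] at this
    have hr : α.rank = (Finset.univ.filter fun a => ¬ (ll α a ≠ a)).card := by
      unfold rank
      congr 1
      ext a
      simp only [Finset.mem_filter, Finset.mem_univ, true_and, not_not, ll_eq_self_iff]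
      cases α.mate (.inl a) <;> simp
    rw [hr]
    exact this
  unfold corank
  omega

theorem card_moved_rr (α : Brauer n) : (moved (rr α)).card = α.corank := by
  rw [corank_eq_ll]
  have h : ∀ f : Fin n → Fin n,
      (moved f).card + (Finset.univ.filter fun a => ¬ (f a ≠ a)).card = n := by
    intro f
    have := Finset.card_filter_add_card_filter_not (s := (Finset.univ : Finset (Fin n)))
      (fun a => f a ≠ a)
    rwa [Finset.card_univ, Fintype.card_fin] at this
  have h1 := h (ll α)
  have h2 := h (rr α)
  have h3 : (Finset.univ.filter fun a => ¬ (ll α a ≠ a)).card =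
      (Finset.univ.filter fun a => ¬ (rr α a ≠ a)).card := by
    refine Finset.card_bij' (fun a _ => (α.mate (.inl a)).elim id id)
      (fun a _ => (α.mate (.inr a)).elim id id) ?_ ?_ ?_ ?_
    · intro a ha
      simp only [Finset.mem_filter, Finset.mem_univ, true_and, not_not] at ha ⊢
      obtain ⟨b, hb⟩ := ll_eq_self_iff.1 ha
      rw [hb]
      exact rr_eq_self_iff.2 ⟨a, α.mate_eq_iff.1 hb⟩
    · intro a ha
      simp only [Finset.mem_filter, Finset.mem_univ, true_and, not_not] at ha ⊢
      obtain ⟨b, hb⟩ := rr_eq_self_iff.1 ha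
      rw [hb]
      exact ll_eq_self_iff.2 ⟨a, α.mate_eq_iff.1 hb⟩
    · intro a ha
      simp only [Finset.mem_filter, Finset.mem_univ, true_and, not_not] at ha
      obtain ⟨b, hb⟩ := ll_eq_self_iff.1 ha
      simp [hb, α.mate_eq_iff.1 hb]
    · intro a ha
      simp only [Finset.mem_filter, Finset.mem_univ, true_and, not_not] at ha
      obtain ⟨b, hb⟩ := rr_eq_self_iff.1 ha
      simp [hb, α.mate_eq_iff.1 hb]
  omega

theorem two_dvd_corank (α : Brauer n) : 2 ∣ α.corank := by
  rw [corank_eq_ll]; exact even_card_moved (ll_involutive α)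

theorem corank_le (α : Brauer n) : α.corank ≤ n := Nat.sub_le _ _

/-! ### Conjugation as renumbering of the pins -/

section Relabel

/-- Renumbering of the pins. -/
def relabel (σ : Equiv.Perm (Fin n)) (α : Brauer n) : Brauer n where
  mate x := Sum.map σ σ (α.mate (Sum.map σ.symm σ.symm x))
  mate_mate x := by
    have h : ∀ y : Fin n ⊕ Fin n, Sum.map σ.symm σ.symm (Sum.map σ σ y) = y := by
      rintro (y | y) <;> simp
    have h' : ∀ y : Fin n ⊕ Fin n, Sum.map σ σ (Sum.map σ.symm σ.symm y) = y := by
      rintro (y | y) <;> simp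
    rw [h, mate_mate, h']
  mate_ne x := by
    have h : ∀ y : Fin n ⊕ Fin n, Sum.map σ.symm σ.symm (Sum.map σ σ y) = y := by
      rintro (y | y) <;> simp
    intro e
    have := congrArg (Sum.map σ.symm σ.symm) e
    rw [h] at this
    exact α.mate_ne _ this

variable {σ τ : Equiv.Perm (Fin n)} {α β : Brauer n}

theorem relabel_inl (a : Fin n) :
    (relabel σ α).mate (.inl (σ a)) = Sum.map σ σ (α.mate (.inl a)) := by simp [relabel]

theorem relabel_inr (a : Fin n) :
    (relabel σ α).mate (.inr (σ a)) = Sum.map σ σ (α.mate (.inr a)) := by simp [relabel]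

theorem coloring_relabel {f g : Fin n → Prop} :
    Coloring (relabel σ α) f g ↔ Coloring α (f ∘ σ) (g ∘ σ) := by
  have h : ∀ x, Sum.elim (f ∘ σ) (g ∘ σ) x = Sum.elim f g (Sum.map σ σ x) := by
    rintro (x | x) <;> rfl
  constructor
  · rintro H (a | a)
    · have := H (.inl (σ a))
      rwa [relabel_inl, ← h] at this
    · have := H (.inr (σ a))
      rwa [relabel_inr, ← h] at this
  · rintro H (a | a)
    · have := H (.inl (σ.symm a))
      rw [h, ← relabel_inl] at this
      simpa using this
    · have := H (.inr (σ.symm a))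
      rw [h, ← relabel_inr] at this
      simpa using this

theorem relabel_mul : relabel σ (α * β) = relabel σ α * relabel σ β := by
  refine eq_of_coloring fun f k h => ?_
  obtain ⟨g, h1, h2⟩ := coloring_mul.1 (coloring_relabel.1 h)
  have hg : (g ∘ σ.symm) ∘ σ = g := by funext a; simp
  exact coloring_mul.2 ⟨g ∘ σ.symm, coloring_relabel.2 (hg.symm ▸ h1),
    coloring_relabel.2 (hg.symm ▸ h2)⟩

theorem relabel_relabel : relabel σ (relabel τ α) = relabel (σ * τ) α := by
  refine eq_of_coloring fun f k h => ?_
  have h1 := coloring_relabel.1 (coloring_relabel.1 h)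
  exact coloring_relabel.2 h1

theorem relabel_one_perm : relabel (1 : Equiv.Perm (Fin n)) α = α :=
  eq_of_coloring fun _ _ h => coloring_relabel.1 h

theorem relabel_injective (σ : Equiv.Perm (Fin n)) : Function.Injective (relabel σ) := by
  refine Function.LeftInverse.injective (g := relabel σ⁻¹) fun α => ?_
  rw [relabel_relabel, inv_mul_cancel, relabel_one_perm]

theorem relabel_eq_mul : ofPerm σ⁻¹ * α * ofPerm σ = relabel σ α := by
  refine eq_of_coloring fun f k h => ?_
  obtain ⟨g, h1, h2⟩ := coloring_mul.1 h
  obtain ⟨m, h1, h3⟩ := coloring_mul.1 h1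
  rw [coloring_ofPerm] at h1 h2
  refine coloring_relabel.2 ?_
  have e1 : f ∘ σ = m := by funext a; simpa using h1 (σ a)
  have e2 : k ∘ σ = g := by funext a; exact propext (h2 a).symm
  rwa [e1, e2]

theorem ll_relabel (a : Fin n) : ll (relabel σ α) (σ a) = σ (ll α a) := by
  rcases h : α.mate (.inl a) with b | b
  · rw [ll_of_inl h]; exact ll_of_inl (by rw [relabel_inl, h]; rfl)
  · rw [ll_of_inr h]; exact ll_of_inr (b := σ b) (by rw [relabel_inl, h]; rfl)

theorem rr_relabel (a : Fin n) : rr (relabel σ α) (σ a) = σ (rr α a) := by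
  rcases h : α.mate (.inr a) with b | b
  · rw [rr_of_inl h]; exact rr_of_inl (b := σ b) (by rw [relabel_inr, h]; rfl)
  · rw [rr_of_inr h]; exact rr_of_inr (by rw [relabel_inr, h]; rfl)

theorem corank_relabel : (relabel σ α).corank = α.corank := by
  rw [corank_eq_ll, corank_eq_ll]
  symm
  refine Finset.card_bij (fun a _ => σ a) ?_ (fun a _ b _ h => σ.injective h) ?_
  · intro a ha
    rw [mem_moved] at ha ⊢
    rw [ll_relabel]
    exact fun h => ha (σ.injective h)
  · intro b hb
    refine ⟨σ.symm b, ?_, by simp⟩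
    rw [mem_moved] at hb ⊢
    intro h
    apply hb
    conv_lhs => rw [← σ.apply_symm_apply b]
    rw [ll_relabel, h, σ.apply_symm_apply]

theorem conj_eq_image (Λ : Set (Brauer n)) : conj σ Λ = relabel σ '' Λ := by
  unfold conj
  congr 1
  funext α
  exact relabel_eq_mul

theorem conj_conj (Λ : Set (Brauer n)) : conj σ (conj τ Λ) = conj (σ * τ) Λ := by
  simp only [conj_eq_image, Set.image_image, relabel_relabel]

theorem conj_one (Λ : Set (Brauer n)) : conj 1 Λ = Λ := by
  simp [conj_eq_image, relabel_one_perm]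

theorem conj_inv_conj (Λ : Set (Brauer n)) : conj σ⁻¹ (conj σ Λ) = Λ := by
  rw [conj_conj, inv_mul_cancel, conj_one]

theorem conj_conj_inv (Λ : Set (Brauer n)) : conj σ (conj σ⁻¹ Λ) = Λ := by
  rw [conj_conj, mul_inv_cancel, conj_one]

theorem relabel_mem_conj {Λ : Set (Brauer n)} : relabel σ α ∈ conj σ Λ ↔ α ∈ Λ := by
  rw [conj_eq_image, (relabel_injective σ).mem_set_image]

theorem forall_mem_conj {Λ : Set (Brauer n)} {P : Brauer n → Prop} :
    (∀ α ∈ conj σ Λ, P α) ↔ ∀ α ∈ Λ, P (relabel σ α) := by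
  rw [conj_eq_image, Set.forall_mem_image]

end Relabel

/-! ### Cross-sections as choices of one chip per involution -/

theorem isRCrossSection_iff {Λ : Set (Brauer n)} : IsRCrossSection Λ ↔
    (∀ α ∈ Λ, ∀ β ∈ Λ, α * β ∈ Λ) ∧
    (∀ f : Fin n → Fin n, Function.Involutive f → ∃ α ∈ Λ, ll α = f) ∧
    ∀ α ∈ Λ, ∀ β ∈ Λ, ll α = ll β → α = β := by
  simp only [IsRCrossSection, greenR_iff]
  refine and_congr_right fun _ => ⟨fun h => ⟨fun f hf => ?_, fun α hα β hβ e => ?_⟩,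
    fun h α => ?_⟩
  · obtain ⟨β, ⟨h1, h2⟩, -⟩ := h (ofInvolutive f hf)
    exact ⟨β, h1, by rw [← h2, ll_ofInvolutive]⟩
  · exact (h α).unique ⟨hα, rfl⟩ ⟨hβ, e⟩
  · obtain ⟨β, hβ, e⟩ := h.1 (ll α) (ll_involutive α)
    exact ⟨β, ⟨hβ, e.symm⟩, fun γ hγ => h.2 γ hγ.1 β hβ (hγ.2.symm.trans e.symm)⟩

namespace IsRCrossSection

variable {Λ Θ : Set (Brauer n)} {α β : Brauer n}

theorem mul_mem (h : IsRCrossSection Λ) (hα : α ∈ Λ) (hβ : β ∈ Λ) : α * β ∈ Λ := h.1 α hα β hβ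

theorem exists_ll (h : IsRCrossSection Λ) {f : Fin n → Fin n} (hf : Function.Involutive f) :
    ∃ α ∈ Λ, ll α = f := (isRCrossSection_iff.1 h).2.1 f hf

theorem eq_of_ll (h : IsRCrossSection Λ) (hα : α ∈ Λ) (hβ : β ∈ Λ) (e : ll α = ll β) : α = β :=
  (isRCrossSection_iff.1 h).2.2 α hα β hβ e

theorem mul_eq_left (h : IsRCrossSection Λ) (hα : α ∈ Λ) (hβ : β ∈ Λ) (e : ll (α * β) = ll α) :
    α * β = α := h.eq_of_ll (h.mul_mem hα hβ) hα e

theorem eq_of_subset (h : IsRCrossSection Λ) (h' : IsRCrossSection Θ) (hs : Λ ⊆ Θ) : Λ = Θ := by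
  refine hs.antisymm fun α hα => ?_
  obtain ⟨β, hβ, e⟩ := h.exists_ll (ll_involutive α)
  rwa [h'.eq_of_ll hα (hs hβ) e.symm]

theorem conj (h : IsRCrossSection Λ) (σ : Equiv.Perm (Fin n)) :
    IsRCrossSection (Brauer.conj σ Λ) := by
  rw [isRCrossSection_iff] at h ⊢
  obtain ⟨h1, h2, h3⟩ := h
  simp only [forall_mem_conj]
  refine ⟨fun α hα β hβ => ?_, fun f hf => ?_, fun α hα β hβ e => ?_⟩
  · rw [← relabel_mul, relabel_mem_conj]
    exact h1 α hα β hβ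
  · obtain ⟨α, hα, e⟩ := h2 (fun a => σ.symm (f (σ a))) fun a => by simp [hf _]
    refine ⟨relabel σ α, relabel_mem_conj.2 hα, ?_⟩
    funext a
    obtain ⟨a, rfl⟩ := σ.surjective a
    rw [ll_relabel, e]
    simp
  · rw [h3 α hα β hβ]
    funext a
    apply σ.injective
    rw [← ll_relabel, e, ll_relabel]

/-- An element of a cross-section with the same pairs on both sides has horizontal lines. -/
theorem mate_inl_of_ll_eq_rr (h : IsRCrossSection Λ) (hα : α ∈ Λ) (e : rr α = ll α) {a : Fin n}
    (ha : ll α a = a) : α.mate (.inl a) = .inr a := by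
  -- No line of α ends at a pin moved by `ll α`, so α absorbs itself. The lines from a to m' and
  -- from m to k' then compose to the line of α at a; hence k = m, and as both lines end at m', also
  -- a = m.
  have h1 : α * α = α := h.mul_eq_left hα hα (ll_mul_eq_left fun m h1 h2 => absurd (e ▸ h1) h2)
  obtain ⟨m, hm⟩ := ll_eq_self_iff.1 ha
  have hm' : ll α m = m := by rw [← e]; exact rr_eq_self_iff.2 ⟨a, α.mate_eq_iff.1 hm⟩
  obtain ⟨k, hk⟩ := ll_eq_self_iff.1 hm'
  have := mul_line hm hk
  rw [h1, hm] at this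
  obtain rfl := Sum.inr_injective this
  have := α.mate_injective (hm.trans hk.symm)
  obtain rfl := Sum.inl_injective this
  exact hm

theorem one_mem (h : IsRCrossSection Λ) : 1 ∈ Λ := by
  obtain ⟨α, hα, e⟩ := h.exists_ll (f := id) (fun _ => rfl)
  have hrr : rr α = ll α := by
    have h1 := card_moved_rr α
    have h2 : moved (id : Fin n → Fin n) = ∅ := by ext; simp [mem_moved]
    rw [corank_eq_ll, e, h2, Finset.card_empty, Finset.card_eq_zero] at h1
    funext a
    have : a ∉ moved (rr α) := by simp [h1]
    rw [mem_moved, not_not] at this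
    rw [this, e]; rfl
  have : α = 1 := eq_of_mate_inl
    (fun a => h.mate_inl_of_ll_eq_rr hα hrr (by rw [e]; rfl)) (hrr.trans e)
  rwa [← this]

end IsRCrossSection

/-! ### Blocks of pins and passage to canonical cross-sections -/

/-- The other element of the block `{2t, 2t + 1}` of `x`. -/
def partner (x : ℕ) : ℕ := x + 1 - 2 * (x % 2)

/-- The involution that exchanges the elements of each of the blocks `{2t, 2t + 1}`, `t < k`. -/
def blk (n k : ℕ) (x : Fin n) : Fin n :=
  if h : x.val < 2 * k ∧ partner x.val < n then ⟨partner x.val, h.2⟩ else x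

theorem blk_val (k : ℕ) (x : Fin n) :
    (blk n k x).val = if x.val < 2 * k ∧ partner x.val < n then partner x.val else x.val := by
  unfold blk
  split_ifs <;> rfl

theorem blk_val_of_lt {k : ℕ} (hk : 2 * k ≤ n) {x : Fin n} (hx : x.val < 2 * k) :
    (blk n k x).val = partner x.val := by
  rw [blk_val, if_pos]
  unfold partner
  omega

theorem blk_of_le {k : ℕ} {x : Fin n} (hx : 2 * k ≤ x.val) : blk n k x = x := by
  apply Fin.ext
  rw [blk_val, if_neg]
  omega

theorem blk_involutive (n k : ℕ) : Function.Involutive (blk n k) := by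
  intro x
  by_cases h : x.val < 2 * k ∧ partner x.val < n
  · have h1 : (blk n k x).val = partner x.val := by rw [blk_val, if_pos h]
    apply Fin.ext
    have := x.isLt
    rw [blk_val, h1, if_pos] <;> unfold partner at * <;> omega
  · have : blk n k x = x := Fin.ext (by rw [blk_val, if_neg h])
    rw [this, this]

theorem blk_ne_iff {k : ℕ} (hk : 2 * k ≤ n) {x : Fin n} : blk n k x ≠ x ↔ x.val < 2 * k := by
  constructor
  · intro h
    by_contra h'
    exact h (blk_of_le (by omega))
  · intro h e
    have := blk_val_of_lt hk h
    rw [e] at this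
    unfold partner at this
    omega

theorem card_filter_val {m : ℕ} (hm : m ≤ n) :
    (Finset.univ.filter fun x : Fin n => x.val < m).card = m := by
  rw [Fin.card_filter_val_lt]
  omega

theorem card_moved_blk {k : ℕ} (hk : 2 * k ≤ n) : (moved (blk n k)).card = 2 * k := by
  rw [← card_filter_val hk]
  congr 1
  ext x
  rw [mem_moved, blk_ne_iff hk]
  simp

theorem card_insert_filter {m : ℕ} (hm : m ≤ n) {x y : Fin n} (hx : m ≤ x.val) (hy : m ≤ y.val)
    (hxy : x ≠ y) :
    (insert x (insert y (Finset.univ.filter fun x : Fin n => x.val < m))).card = m + 2 := by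
  rw [Finset.card_insert_of_notMem, Finset.card_insert_of_notMem, card_filter_val hm]
  · simp; omega
  · simp [hxy]; omega

theorem le_card_moved {f : Fin n → Fin n} {m : ℕ} (hm : m ≤ n) {x y : Fin n} (hx : m ≤ x.val)
    (hy : m ≤ y.val) (hxy : x ≠ y) (fx : f x ≠ x) (fy : f y ≠ y)
    (hf : ∀ z : Fin n, z.val < m → f z ≠ z) : m + 2 ≤ (moved f).card := by
  rw [← card_insert_filter hm hx hy hxy]
  refine Finset.card_le_card fun z hz => ?_
  simp only [Finset.mem_insert, Finset.mem_filter, Finset.mem_univ, true_and] at hz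
  rw [mem_moved]
  rcases hz with rfl | rfl | hz
  · exact fx
  · exact fy
  · exact hf z hz

/-- The elements of `Λ` contain the right-right blocks `{2t, 2t + 1}`, `t < k`, as long as their
corank allows it. -/
def CanonicalUpTo (k : ℕ) (Λ : Set (Brauer n)) : Prop :=
  ∀ α ∈ Λ, ∀ t < k, 2 * t + 2 ≤ α.corank →
    ∀ x y : Fin n, x.val = 2 * t → y.val = 2 * t + 1 → rr α x = y

/-- Canonical cross-sections, with the pins numbered from right to left, starting with `0`. -/
def RCan (Λ : Set (Brauer n)) : Prop :=
  IsRCrossSection Λ ∧ ∀ k, CanonicalUpTo k Λ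

theorem CanonicalUpTo.rr_eq {k : ℕ} {Λ : Set (Brauer n)} (h : CanonicalUpTo k Λ) {α : Brauer n}
    (hα : α ∈ Λ) {j : ℕ} (hjk : j ≤ k) (hj : 2 * j ≤ α.corank) {x : Fin n}
    (hx : x.val < 2 * j) : rr α x = blk n j x := by
  have hn := α.corank_le
  have e := h α hα (x.val / 2) (by omega) (by omega) ⟨2 * (x.val / 2), by omega⟩
    ⟨2 * (x.val / 2) + 1, by omega⟩ rfl rfl
  rcases Nat.mod_two_eq_zero_or_one x.val with h0 | h1
  · have hx' : x = ⟨2 * (x.val / 2), by omega⟩ := Fin.ext (by simp; omega)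
    rw [← hx'] at e
    rw [e]
    apply Fin.ext
    rw [blk_val_of_lt (by omega) hx]
    simp [partner]; omega
  · have hx' : x = ⟨2 * (x.val / 2) + 1, by omega⟩ := Fin.ext (by simp; omega)
    rw [← hx'] at e
    have e' := congrArg (rr α) e
    rw [rr_involutive α] at e'
    rw [← e']
    apply Fin.ext
    rw [blk_val_of_lt (by omega) hx]
    simp [partner]; omega

theorem exists_moved_of_corank {α : Brauer n} {m : ℕ} (h : m < α.corank) :
    ∃ x : Fin n, m ≤ x.val ∧ rr α x ≠ x := by
  by_contra hc
  push Not at hc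
  have h1 : moved (rr α) ⊆ Finset.univ.filter fun x : Fin n => x.val < m := by
    intro x hx
    rw [mem_moved] at hx
    by_contra hx'
    exact hx (hc x (by simpa using hx'))
  have h2 := Finset.card_le_card h1
  rw [card_moved_rr, card_filter_val (by have := α.corank_le; omega)] at h2
  omega

/-- A reference element α₀ of corank exactly 2k+2 has a single right-right block {x₀, y₀} outside
the common ones. For any other α of corank at least 2k+2, some β of corank at least 2k+2 is absorbed
by both α and α₀. The extra right-right block of β lies in both, so it is {x₀, y₀}. -/
theorem CanonicalUpTo.exists_common_block {k : ℕ} {Λ : Set (Brauer n)} (hΛ : IsRCrossSection Λ)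
    (h : CanonicalUpTo k Λ) (hk : 2 * k + 2 ≤ n) :
    ∃ x y : Fin n, 2 * k ≤ x.val ∧ 2 * k ≤ y.val ∧ x ≠ y ∧
      ∀ α ∈ Λ, 2 * k + 2 ≤ α.corank → rr α x = y := by
  have hge : ∀ α ∈ Λ, 2 * k + 2 ≤ α.corank → ∀ x : Fin n, 2 * k ≤ x.val → 2 * k ≤ (rr α x).val := by
    intro α hα hc x hx
    by_contra hlt
    have := h.rr_eq hα le_rfl (by omega) (x := rr α x) (by omega)
    rw [rr_involutive α] at this
    have h2 := blk_val_of_lt (by omega) (x := rr α x) (k := k) (by omega)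
    rw [← this] at h2
    unfold partner at h2
    omega
  obtain ⟨α₀, hα₀, e₀⟩ := hΛ.exists_ll (blk_involutive n (k + 1))
  have c₀ : α₀.corank = 2 * k + 2 := by
    rw [corank_eq_ll, e₀, card_moved_blk (by omega)]; omega
  obtain ⟨x₀, hx₀, hm₀⟩ := exists_moved_of_corank (α := α₀) (m := 2 * k) (by omega)
  have hy₀ := hge α₀ hα₀ (by omega) x₀ hx₀
  refine ⟨x₀, rr α₀ x₀, hx₀, hy₀, hm₀.symm, fun α hα hc => ?_⟩
  have hmoved : ∀ z : Fin n, 2 * k ≤ z.val → rr α₀ z ≠ z → z = x₀ ∨ z = rr α₀ x₀ := by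
    intro z hz hzm
    have hsub : insert x₀ (insert (rr α₀ x₀)
        (Finset.univ.filter fun x : Fin n => x.val < 2 * k)) ⊆ moved (rr α₀) := by
      intro w hw
      simp only [Finset.mem_insert, Finset.mem_filter, Finset.mem_univ, true_and] at hw
      rw [mem_moved]
      rcases hw with rfl | rfl | hw
      · exact hm₀
      · rw [rr_involutive α₀]; exact hm₀.symm
      · rw [h.rr_eq hα₀ le_rfl (by omega) hw, blk_ne_iff (by omega)]; exact hw
    have heq := Finset.eq_of_subset_of_card_le hsub (by
      rw [card_moved_rr, c₀, card_insert_filter (by omega) hx₀ hy₀ hm₀.symm])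
    have : z ∈ moved (rr α₀) := mem_moved.2 hzm
    rw [← heq] at this
    simp only [Finset.mem_insert, Finset.mem_filter, Finset.mem_univ, true_and] at this
    rcases this with h | h | h
    · exact .inl h
    · exact .inr h
    · omega
  -- absorption by an element with the left-left blocks `{2t, 2t + 1}`, `t < k`, and `{x, y}`
  have habs : ∀ x y : Fin n, 2 * k ≤ x.val → 2 * k ≤ y.val → x ≠ y → ∃ β ∈ Λ,
      2 * k + 2 ≤ β.corank ∧ ∀ γ ∈ Λ, 2 * k + 2 ≤ γ.corank → (rr γ x ≠ x ∨ rr γ y ≠ y) →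
        γ * β = γ := by
    intro x y hx hy hxy
    let f : Fin n → Fin n := fun z => if z.val < 2 * k then blk n k z else Equiv.swap x y z
    have hf1 : ∀ z : Fin n, z.val < 2 * k → f z = blk n k z := fun z hz => if_pos hz
    have hf2 : ∀ z : Fin n, 2 * k ≤ z.val → f z = Equiv.swap x y z := fun z hz =>
      if_neg (by omega)
    have hsw : ∀ z : Fin n, 2 * k ≤ z.val → 2 * k ≤ (Equiv.swap x y z).val := by
      intro z hz
      rw [Equiv.swap_apply_def]
      split_ifs <;> assumption
    have hf : Function.Involutive f := by
      intro z
      rcases Nat.lt_or_ge z.val (2 * k) with hz | hz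
      · rw [hf1 z hz, hf1, blk_involutive n k]
        rw [blk_val_of_lt (by omega) hz]
        unfold partner
        omega
      · rw [hf2 z hz, hf2 _ (hsw z hz), Equiv.swap_apply_self]
    obtain ⟨β, hβ, eβ⟩ := hΛ.exists_ll hf
    refine ⟨β, hβ, ?_, fun γ hγ hc hor => ?_⟩
    · rw [corank_eq_ll, eβ]
      refine le_card_moved (by omega) hx hy hxy ?_ ?_ fun z hz => ?_
      · rw [hf2 x hx, Equiv.swap_apply_left]; exact hxy.symm
      · rw [hf2 y hy, Equiv.swap_apply_right]; exact hxy
      · rw [hf1 z hz, blk_ne_iff (by omega)]; exact hz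
    · refine hΛ.mul_eq_left hγ hβ (ll_mul_eq_left fun m hm1 hm2 => ?_)
      have hm : 2 * k ≤ m.val := by
        by_contra hlt
        rw [h.rr_eq hγ le_rfl (by omega) (by omega)] at hm1
        exact (blk_ne_iff (by omega)).2 (by omega) hm1
      rw [eβ, hf2 m hm] at hm2 ⊢
      have hfin : ∀ u v : Fin n, Equiv.swap x y = Equiv.swap u v → 2 * k ≤ v.val → rr γ u = u →
          rr γ v ≠ v → rr γ v ≠ v ∧ f (rr γ v) = rr γ v := by
        intro u v huv hv h1 h2
        refine ⟨h2, ?_⟩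
        rw [hf2 _ (hge γ hγ hc v hv), huv, Equiv.swap_apply_of_ne_of_ne _ h2]
        intro h3
        rw [← h3, rr_involutive γ] at h1
        exact h2 h1.symm
      rcases Equiv.eq_or_eq_of_swap_apply_ne_self hm2 with rfl | rfl
      · rw [Equiv.swap_apply_left]
        exact hfin _ _ rfl hy hm1 (hor.resolve_left (not_not.2 hm1))
      · rw [Equiv.swap_apply_right]
        exact hfin _ _ (Equiv.swap_comm _ _) hx hm1 (hor.resolve_right (not_not.2 hm1))
  -- The pair {x₀, c} must meet a right-right block of α₀, which x₀ ensures, and one of α. If the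
  -- pin found for α is x₀ itself, any other pin serves as c.
  obtain ⟨c, hcx, hc2, hmc⟩ : ∃ c : Fin n, x₀ ≠ c ∧ 2 * k ≤ c.val ∧
      (rr α x₀ ≠ x₀ ∨ rr α c ≠ c) := by
    obtain ⟨c, hc1, hc2⟩ := exists_moved_of_corank (α := α) (m := 2 * k) (by omega)
    by_cases hcx : x₀ = c
    · exact ⟨rr α₀ x₀, hm₀.symm, hy₀, .inl (by rw [hcx]; exact hc2)⟩
    · exact ⟨c, hcx, hc1, .inr hc2⟩
  obtain ⟨β, hβ, cβ, hβ'⟩ := habs x₀ c hx₀ hc2 hcx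
  have e1 := hβ' α hα hc hmc
  have e2 := hβ' α₀ hα₀ (by omega) (.inl hm₀)
  obtain ⟨d, hd1, hd2⟩ := exists_moved_of_corank (α := β) (m := 2 * k) (by omega)
  have e3 := rr_mul_of_ne (α := α) hd2
  have e4 := rr_mul_of_ne (α := α₀) hd2
  rw [e1] at e3
  rw [e2] at e4
  rcases hmoved d hd1 (by rw [e4]; exact hd2) with rfl | rfl
  · rw [e3, e4]
  · rw [rr_involutive α₀] at e4
    rw [← e4] at e3
    have := rr_involutive α (rr α₀ x₀)
    rwa [e3] at this

theorem IsRCrossSection.exists_canonicalUpTo {Λ : Set (Brauer n)} (hΛ : IsRCrossSection Λ)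
    (k : ℕ) : ∃ σ : Equiv.Perm (Fin n), CanonicalUpTo k (Brauer.conj σ Λ) := by
  induction k with
  | zero => exact ⟨1, fun _ _ t ht => absurd ht (by omega)⟩
  | succ k ih =>
    obtain ⟨σ, hσ⟩ := ih
    by_cases hk : 2 * k + 2 ≤ n
    · obtain ⟨x, y, hx, hy, hxy, H⟩ := hσ.exists_common_block (hΛ.conj σ) hk
      let p : Fin n := ⟨2 * k, by omega⟩
      let q : Fin n := ⟨2 * k + 1, by omega⟩
      let τ₁ := Equiv.swap x p
      let τ := Equiv.swap (τ₁ y) q * τ₁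
      have hτ₁ : τ₁ x = p := Equiv.swap_apply_left _ _
      have hne : p ≠ τ₁ y := by rw [← hτ₁]; exact fun h => hxy (τ₁.injective h)
      have hpq : p ≠ q := by simp [p, q]
      have hτx : τ x = p := by
        simp only [τ, Equiv.Perm.mul_apply, hτ₁]
        exact Equiv.swap_apply_of_ne_of_ne hne hpq
      have hτy : τ y = q := by
        simp only [τ, Equiv.Perm.mul_apply]
        exact Equiv.swap_apply_left _ _
      have hτ₁y : 2 * k ≤ (τ₁ y).val := by
        simp only [τ₁, Equiv.swap_apply_def]
        split_ifs <;> simp_all [p]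
      have hτz : ∀ z : Fin n, z.val < 2 * k → τ z = z := by
        intro z hz
        have : τ₁ z = z := Equiv.swap_apply_of_ne_of_ne (by rintro rfl; omega)
          (by rintro rfl; simp [p] at hz)
        simp only [τ, Equiv.Perm.mul_apply, this]
        exact Equiv.swap_apply_of_ne_of_ne (by rintro rfl; omega)
          (by rintro rfl; simp [q] at hz)
      -- The permutation τ carries the common block {x, y} to {2k, 2k+1} and fixes all smaller pins,
      -- so the blocks already in place survive.
      refine ⟨τ * σ, ?_⟩
      rw [← conj_conj]
      refine forall_mem_conj.2 fun α hα t ht hc u v hu hv => ?_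
      rw [corank_relabel] at hc
      rcases Nat.lt_or_ge t k with htk | htk
      · have := hσ α hα t htk hc u v hu hv
        rw [← hτz u (by omega), rr_relabel, this, hτz v (by omega)]
      · obtain rfl : t = k := by omega
        obtain rfl : u = p := Fin.ext hu
        obtain rfl : v = q := Fin.ext hv
        rw [← hτx, rr_relabel, H α hα hc, hτy]
    · refine ⟨σ, fun α hα t ht hc => hσ α hα t ?_ hc⟩
      have := α.corank_le
      omega

theorem IsRCrossSection.exists_rCan {Λ : Set (Brauer n)} (hΛ : IsRCrossSection Λ) :
    ∃ σ : Equiv.Perm (Fin n), RCan (Brauer.conj σ Λ) := by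
  obtain ⟨σ, hσ⟩ := hΛ.exists_canonicalUpTo n
  refine ⟨σ, hΛ.conj σ, fun k α hα t _ hc => hσ α hα t ?_ hc⟩
  have := α.corank_le
  omega

/-! ### Model chips of corank 2 and their bits -/

/-- The number `y`, or its partner. -/
def twist : Bool → ℕ → ℕ
  | false, y => y
  | true, y => partner y

/-- The lines of the chips of corank `2`, from left to right: the blocks below the one of `a` move
up by one, with a flip of the block number `t` if `ε t` is true; the partner of `a` goes to `b`. -/
def fwd (ε : ℕ → Bool) (a b x : ℕ) : ℕ :=
  if x < 2 * (a / 2) then twist (ε (x / 2)) (x + 2) else if x = partner a then b else x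

/-- The lines of the chips of corank `2`, from right to left. -/
def bwd (ε : ℕ → Bool) (a b y : ℕ) : ℕ :=
  if y < 2 * (a / 2) + 2 then twist (ε (y / 2 - 1)) (y - 2) else if y = b then partner a else y

theorem twist_cases (e : Bool) (y : ℕ) :
    (e = false ∧ twist e y = y) ∨ (e = true ∧ twist e y = y + 1 - 2 * (y % 2)) := by
  cases e
  · exact .inl ⟨rfl, rfl⟩
  · exact .inr ⟨rfl, rfl⟩

theorem twist_inj {e e' : Bool} {y : ℕ} (h : twist e y = twist e' y) : e = e' := by
  rcases twist_cases e y with ⟨h1, h2⟩ | ⟨h1, h2⟩ <;>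
    rcases twist_cases e' y with ⟨h3, h4⟩ | ⟨h3, h4⟩ <;> first | omega | rw [h1, h3]

theorem twist_twist (e e' : Bool) (y : ℕ) : twist e (twist e' y) = twist (e ^^ e') y := by
  cases e <;> cases e' <;> simp only [twist, Bool.xor_false, Bool.xor_true, Bool.not_true,
    Bool.not_false, partner]
  omega

theorem twist_add_two (e : Bool) (y : ℕ) : twist e (y + 2) = twist e y + 2 := by
  cases e <;> simp only [twist, partner]
  omega

theorem twist_div_two (e : Bool) (y : ℕ) : twist e y / 2 = y / 2 := by
  cases e <;> simp only [twist, partner]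
  omega

section Lines

variable {ε : ℕ → Bool} {a b x y : ℕ}

theorem fwd_low (h : x < 2 * (a / 2)) : fwd ε a b x = twist (ε (x / 2)) (x + 2) := if_pos h

theorem fwd_partner : fwd ε a b (partner a) = b := by
  unfold fwd
  rw [if_neg, if_pos rfl]
  unfold partner
  omega

theorem fwd_high (h : 2 * (a / 2) + 2 ≤ x) : fwd ε a b x = x := by
  unfold fwd
  rw [if_neg (by omega), if_neg]
  unfold partner
  omega

theorem fwd_ge (hab : a < b) (ha : x ≠ a) (hb : x ≠ b) : 2 ≤ fwd ε a b x := by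
  unfold fwd partner
  rcases twist_cases (ε (x / 2)) (x + 2) with ⟨-, h⟩ | ⟨-, h⟩ <;> rw [h] <;> split_ifs <;> omega

theorem fwd_lt {n : ℕ} (hab : a < b) (hb : b < n) (hx : x < n) : fwd ε a b x < n := by
  unfold fwd
  rcases twist_cases (ε (x / 2)) (x + 2) with ⟨-, h⟩ | ⟨-, h⟩ <;> rw [h] <;> split_ifs <;> omega

theorem bwd_lt {n : ℕ} (hab : a < b) (hb : b < n) (hy : y < n) : bwd ε a b y < n := by
  unfold bwd partner
  rcases twist_cases (ε (y / 2 - 1)) (y - 2) with ⟨-, h⟩ | ⟨-, h⟩ <;> rw [h] <;> split_ifs <;> omega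

theorem bwd_fwd (hab : a < b) (ha : x ≠ a) (hb : x ≠ b) : bwd ε a b (fwd ε a b x) = x := by
  rcases Nat.lt_or_ge x (2 * (a / 2)) with h | h
  · rw [fwd_low h]
    have h1 := twist_div_two (ε (x / 2)) (x + 2)
    unfold bwd
    rw [if_pos (by omega), show twist (ε (x / 2)) (x + 2) / 2 - 1 = x / 2 by omega, twist_add_two,
      Nat.add_sub_cancel, twist_twist, Bool.xor_self]
    rfl
  · by_cases h' : x = partner a
    · subst h'
      rw [fwd_partner]
      unfold bwd partner at *
      rw [if_neg (by omega), if_pos rfl]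
    · rw [fwd_high (by unfold partner at h'; omega)]
      unfold bwd partner at *
      rw [if_neg (by omega), if_neg hb]

theorem bwd_spec (hab : a < b) (hy : 2 ≤ y) :
    fwd ε a b (bwd ε a b y) = y ∧ bwd ε a b y ≠ a ∧ bwd ε a b y ≠ b := by
  rcases Nat.lt_or_ge y (2 * (a / 2) + 2) with h | h
  · obtain ⟨y, rfl⟩ := Nat.exists_eq_add_of_le' hy
    have h0 : bwd ε a b (y + 2) = twist (ε (y / 2)) y := by
      unfold bwd
      rw [if_pos h, Nat.add_sub_cancel, show (y + 2) / 2 - 1 = y / 2 by omega]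
    have h1 := twist_div_two (ε (y / 2)) y
    rw [h0]
    refine ⟨?_, by omega, by omega⟩
    rw [fwd_low (by omega), h1, twist_add_two, twist_twist, Bool.xor_self]
    rfl
  · by_cases h' : y = b
    · subst h'
      have h0 : bwd ε a y y = partner a := by
        unfold bwd
        rw [if_neg (by omega), if_pos rfl]
      rw [h0]
      refine ⟨fwd_partner, ?_⟩
      unfold partner
      omega
    · have h0 : bwd ε a b y = y := by
        unfold bwd
        rw [if_neg (by omega), if_neg h']
      rw [h0]
      exact ⟨fwd_high h, by omega, h'⟩

theorem fwd_congr {ε' : ℕ → Bool} (h : ∀ t < a / 2, ε t = ε' t) : fwd ε a b x = fwd ε' a b x := by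
  unfold fwd
  split_ifs with h1
  · rw [h _ (by omega)]
  · rfl
  · rfl

end Lines

/-- The chip of corank `2` with the blocks `{a, b}` and `{0', 1'}` and the lines given by `fwd`. -/
def chip (ε : ℕ → Bool) (a b : Fin n) (h : a < b) : Brauer n where
  mate
    | .inl x => if x = a then .inl b else if x = b then .inl a else
        .inr ⟨fwd ε a b x, fwd_lt h b.isLt x.isLt⟩
    | .inr y => if y.val < 2 then .inr (blk n 1 y) else
        .inl ⟨bwd ε a b y, bwd_lt h b.isLt y.isLt⟩
  mate_mate x := by
    rcases x with x | y
    · by_cases ha : x = a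
      · simp [ha, h.ne']
      · by_cases hb : x = b
        · simp [hb, h.ne']
        · have := fwd_ge (ε := ε) (x := x) h (fun e => ha (Fin.ext e)) (fun e => hb (Fin.ext e))
          have h2 := bwd_fwd (ε := ε) (x := x) h (fun e => ha (Fin.ext e))
            (fun e => hb (Fin.ext e))
          simp only [ha, hb, if_false]
          rw [if_neg (by simp; omega)]
          exact congrArg _ (Fin.ext h2)
    · by_cases hy : y.val < 2
      · have hn : 2 * 1 ≤ n := by have := b.isLt; have : a.val < b.val := h; omega
        have : (blk n 1 y).val < 2 := by
          rw [blk_val_of_lt hn (by omega)]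
          unfold partner
          omega
        simp only [hy, this, if_true, blk_involutive n 1 y]
      · obtain ⟨h1, h2, h3⟩ := bwd_spec (ε := ε) h (Nat.le_of_not_lt hy)
        simp only [hy, if_false]
        rw [if_neg (fun e => h2 (congrArg Fin.val e)), if_neg (fun e => h3 (congrArg Fin.val e))]
        exact congrArg _ (Fin.ext h1)
  mate_ne x := by
    rcases x with x | y
    · by_cases ha : x = a
      · simp [ha, h.ne']
      · by_cases hb : x = b
        · simp [hb, h.ne', h.ne]
        · simp [ha, hb]
    · by_cases hy : y.val < 2
      · have hn : 2 * 1 ≤ n := by have := b.isLt; have : a.val < b.val := h; omega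
        simp only [hy, if_true]
        intro e
        exact (blk_ne_iff hn).2 (by omega) (Sum.inr_injective e)
      · simp [hy]

section Chip

variable {ε ε' : ℕ → Bool} {a b : Fin n} {h : a < b}

theorem chip_line {x y : Fin n} (ha : x ≠ a) (hb : x ≠ b) (hy : y.val = fwd ε a b x) :
    (chip ε a b h).mate (.inl x) = .inr y := by
  simp only [chip, ha, hb, if_false]
  exact congrArg _ (Fin.ext hy.symm)

theorem ll_chip : ll (chip ε a b h) = Equiv.swap a b := by
  funext x
  by_cases ha : x = a
  · subst ha
    rw [Equiv.swap_apply_left]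
    exact ll_of_inl (by simp [chip])
  · by_cases hb : x = b
    · subst hb
      rw [Equiv.swap_apply_right]
      exact ll_of_inl (by simp [chip, ha])
    · rw [Equiv.swap_apply_of_ne_of_ne ha hb]
      exact ll_of_inr (chip_line ha hb (y := ⟨_, fwd_lt h b.isLt x.isLt⟩) rfl)

theorem two_le_of_lt {a b : Fin n} (h : a < b) : 2 * 1 ≤ n := by
  have := b.isLt
  have : a.val < b.val := h
  omega

theorem rr_chip : rr (chip ε a b h) = blk n 1 := by
  funext y
  by_cases hy : y.val < 2
  · exact rr_of_inr (by simp only [chip, hy, if_true])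
  · rw [blk_of_le (by omega)]
    exact rr_of_inl (b := ⟨_, bwd_lt (ε := ε) h b.isLt y.isLt⟩) (by simp only [chip, hy, if_false])

theorem chip_congr (he : ∀ t < a.val / 2, ε t = ε' t) : chip ε a b h = chip ε' a b h := by
  refine eq_of_mate_inl (fun x => ?_) (rr_chip.trans rr_chip.symm)
  simp only [chip]
  congr 4
  exact fwd_congr he

theorem chip_inj (he : chip ε a b h = chip ε' a b h) {t : ℕ} (ht : t < a.val / 2) :
    ε t = ε' t := by
  have ha := a.isLt
  have hab : a.val < b.val := h
  have hne : ∀ ε : ℕ → Bool, (chip ε a b h).mate (.inl ⟨2 * t, by omega⟩) =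
      .inr ⟨fwd ε a b (2 * t), fwd_lt h b.isLt (by omega)⟩ := fun ε =>
    chip_line (fun e => by have := congrArg Fin.val e; simp at this; omega)
      (fun e => by have := congrArg Fin.val e; simp at this; omega) rfl
  have := (hne ε).symm.trans (he ▸ hne ε')
  have := congrArg Fin.val (Sum.inr_injective this)
  simp only [fwd_low (show 2 * t < 2 * (a.val / 2) by omega)] at this
  rw [show 2 * t / 2 = t by omega] at this
  exact twist_inj this

theorem card_moved_swap {a b : Fin n} (h : a ≠ b) : (moved (Equiv.swap a b)).card = 2 := by
  rw [← Equiv.Perm.card_support_swap h]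
  congr 1

end Chip

section Products

variable {α β : Brauer n} {a b c d c' d' : Fin n}

theorem ll_mul_swap (hα : ll α = Equiv.swap a b) (hc : α.mate (.inl c) = .inr c')
    (hd : α.mate (.inl d) = .inr d') (hβ : ll β = Equiv.swap c' d') (hcd : c ≠ d) (x : Fin n) :
    ll (α * β) x = Equiv.swap a b (Equiv.swap c d x) := by
  have hαc : Equiv.swap a b c = c := by rw [← hα]; exact ll_of_inr hc
  have hαd : Equiv.swap a b d = d := by rw [← hα]; exact ll_of_inr hd
  have hcd' : c' ≠ d' := by
    rintro rfl
    exact hcd (Sum.inl_injective (α.mate_injective (hc.trans hd.symm)))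
  by_cases hxc : x = c
  · subst hxc
    rw [Equiv.swap_apply_left, hαd]
    refine ll_of_inl (mul_cap hc (k := d') ?_ (α.mate_eq_iff.1 hd))
    have : ll β c' = d' := by rw [hβ, Equiv.swap_apply_left]
    rw [← this]
    exact mate_inl_of_ll_ne (by rw [this]; exact hcd'.symm)
  by_cases hxd : x = d
  · subst hxd
    rw [Equiv.swap_apply_right, hαc]
    refine ll_of_inl (mul_cap hd (k := c') ?_ (α.mate_eq_iff.1 hc))
    have : ll β d' = c' := by rw [hβ, Equiv.swap_apply_right]
    rw [← this]
    exact mate_inl_of_ll_ne (by rw [this]; exact hcd')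
  rw [Equiv.swap_apply_of_ne_of_ne hxc hxd, ← hα]
  by_cases hx : ll α x = x
  · obtain ⟨m, hm⟩ := ll_eq_self_iff.1 hx
    have h1 : m ≠ c' := by
      rintro rfl
      exact hxc (Sum.inl_injective (α.mate_injective (hm.trans hc.symm)))
    have h2 : m ≠ d' := by
      rintro rfl
      exact hxd (Sum.inl_injective (α.mate_injective (hm.trans hd.symm)))
    obtain ⟨k, hk⟩ := ll_eq_self_iff.1
      (show ll β m = m by rw [hβ, Equiv.swap_apply_of_ne_of_ne h1 h2])
    rw [hx]
    exact ll_of_inr (mul_line hm hk)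
  · exact ll_mul_of_ne hx

end Products

/-! ### Rigidity of the elements of corank 2 -/

namespace RCan

variable {Λ : Set (Brauer n)} {α β γ : Brauer n}

theorem rr_eq_blk (h : RCan Λ) (hα : α ∈ Λ) {j : ℕ} (hc : α.corank = 2 * j) :
    rr α = blk n j := by
  have hj : 2 * j ≤ n := by have := α.corank_le; omega
  have h1 : ∀ x : Fin n, x.val < 2 * j → rr α x = blk n j x := fun x hx =>
    (h.2 j).rr_eq hα le_rfl hc.ge hx
  have hsub : moved (blk n j) ⊆ moved (rr α) := by
    intro x hx
    rw [mem_moved] at hx ⊢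
    rwa [h1 x ((blk_ne_iff hj).1 hx)]
  have heq := Finset.eq_of_subset_of_card_le hsub (by rw [card_moved_rr, card_moved_blk hj, hc])
  funext x
  by_cases hx : x.val < 2 * j
  · exact h1 x hx
  · have : x ∉ moved (blk n j) := by rw [mem_moved, blk_ne_iff hj]; exact hx
    have h2 := this
    rw [heq] at h2
    rw [mem_moved, not_not] at this h2
    rw [h2, this]

theorem exists_proj (h : RCan Λ) {k : ℕ} (hk : 2 * k ≤ n) : ∃ E ∈ Λ, ll E = blk n k ∧
    rr E = blk n k ∧ ∀ x : Fin n, 2 * k ≤ x.val → E.mate (.inl x) = .inr x := by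
  obtain ⟨E, hE, e⟩ := h.1.exists_ll (blk_involutive n k)
  have e' := h.rr_eq_blk hE (j := k) (by rw [corank_eq_ll, e, card_moved_blk hk])
  exact ⟨E, hE, e, e', fun x hx => h.1.mate_inl_of_ll_eq_rr hE (e'.trans e.symm)
    (by rw [e, blk_of_le hx])⟩

section Pair

variable {a b : Fin n}

theorem rr_of_ll_swap (h : RCan Λ) (hα : α ∈ Λ) (e : ll α = Equiv.swap a b) (hab : a ≠ b) :
    rr α = blk n 1 :=
  h.rr_eq_blk hα (by rw [corank_eq_ll, e, card_moved_swap hab])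

theorem exists_line (e : ll α = Equiv.swap a b) {x : Fin n} (ha : x ≠ a) (hb : x ≠ b) :
    ∃ y, α.mate (.inl x) = .inr y :=
  ll_eq_self_iff.1 (by rw [e, Equiv.swap_apply_of_ne_of_ne ha hb])

theorem mate_pair (e : ll α = Equiv.swap a b) (hab : a ≠ b) : α.mate (.inl a) = .inl b := by
  have : ll α a = b := by rw [e, Equiv.swap_apply_left]
  have h1 := mate_inl_of_ll_ne (this.symm ▸ hab.symm : ll α a ≠ a)
  rwa [this] at h1

/-- The projection E onto the blocks up to that of a absorbs α, because a lies in a right-right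
block of E. Reading E * α = E along the horizontal lines of E gives the lines of α above the block
of a. The line of E at b passes through a and its partner, which shows where α sends the partner. -/
theorem lines_high (h : RCan Λ) (hα : α ∈ Λ) (e : ll α = Equiv.swap a b) (hab : a < b) {x : Fin n}
    (ha : x ≠ a) (hb : x ≠ b) : (2 * (a.val / 2) + 2 ≤ x.val → α.mate (.inl x) = .inr x) ∧
      (x.val = partner a.val → α.mate (.inl x) = .inr b) := by
  have hab' : a.val < b.val := hab
  have hbn := b.isLt
  have hk : 2 * (a.val / 2 + 1) ≤ n := by
    have := x.isLt
    have : x.val ≠ b.val := fun e => hb (Fin.ext e)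
    have : x.val ≠ a.val := fun e => ha (Fin.ext e)
    omega
  obtain ⟨E, hE, e1, e2, e3⟩ := h.exists_proj hk
  have hEb : 2 * (a.val / 2 + 1) ≤ b.val → ∀ c : Fin n, c.val = partner a.val → rr E a = c := by
    intro hb c hc
    rw [e2]
    apply Fin.ext
    rw [blk_val_of_lt hk (by omega), hc]
  have habs : E * α = E := by
    refine h.1.mul_eq_left hE hα (ll_mul_eq_left fun m h1 h2 => ?_)
    have hm : 2 * (a.val / 2 + 1) ≤ m.val := by
      by_contra hlt
      rw [e2] at h1
      exact (blk_ne_iff hk).2 (by omega) h1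
    rw [e] at h2 ⊢
    rcases Equiv.eq_or_eq_of_swap_apply_ne_self h2 with rfl | rfl
    · omega
    · have hpn : partner a.val < n := by unfold partner; omega
      rw [Equiv.swap_apply_right, hEb hm ⟨_, hpn⟩ rfl]
      have n1 : (⟨partner a.val, hpn⟩ : Fin n) ≠ a := fun e => by
        have := congrArg Fin.val e
        simp [partner] at this
        omega
      refine ⟨n1, Equiv.swap_apply_of_ne_of_ne n1 fun e => ?_⟩
      have := congrArg Fin.val e
      simp [partner] at this
      omega
  obtain ⟨y, hy⟩ := exists_line e ha hb
  constructor
  · intro hx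
    have := mul_line (e3 x (by omega)) hy
    rw [habs, e3 x (by omega)] at this
    rw [hy, this]
  · intro hx
    have hbx : 2 * (a.val / 2 + 1) ≤ b.val := by
      have : x.val ≠ b.val := fun e => hb (Fin.ext e)
      unfold partner at hx
      omega
    have h1 := hEb hbx x hx
    have h2 : E.mate (.inr a) = .inr x := by
      rw [← h1]
      exact mate_inr_of_rr_ne (by rw [h1]; exact ha)
    have := mul_zigzag (e3 b hbx) (α.mate_eq_iff.1 (mate_pair e hab.ne)) h2 hy
    rw [habs, e3 b hbx] at this
    rw [hy, this]

/-- Multiply α by the projection E onto the blocks 0, …, t. The product has so large a corank that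
canonicity gives it the right-right block {2t+2, 2t+3}. That block can only come from a block of E
pushed through α, and by induction the blocks below t already have other images. -/
theorem lines_low (h : RCan Λ) (hα : α ∈ Λ) (e : ll α = Equiv.swap a b) (hab : a < b) (t : ℕ)
    (ht : t < a.val / 2) : ∃ c : Bool, ∀ x y : Fin n, x.val / 2 = t → y.val = twist c (x.val + 2) →
      α.mate (.inl x) = .inr y := by
  induction t using Nat.strong_induction_on with
  | _ t ih =>
  have hab' : a.val < b.val := hab
  have han := a.isLt
  have hbn := b.isLt
  have hk : 2 * (t + 1) ≤ n := by omega
  obtain ⟨E, hE, e1, e2, e3⟩ := h.exists_proj hk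
  have hmem := h.1.mul_mem hE hα
  have hcap : (E * α).mate (.inl a) = .inl b :=
    mul_cap (e3 a (by omega)) (mate_pair e hab.ne) (E.mate_eq_iff.1 (e3 b (by omega)))
  have hcor : 2 * (t + 1) + 2 ≤ (E * α).corank := by
    rw [corank_eq_ll]
    refine le_card_moved hk (x := a) (y := b) (by omega) (by omega) hab.ne ?_ ?_ fun z hz => ?_
    · rw [ll_of_inl hcap]; exact hab.ne'
    · rw [ll_of_inl ((E * α).mate_eq_iff.1 hcap)]; exact hab.ne
    · have : ll E z ≠ z := by rw [e1, blk_ne_iff hk]; exact hz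
      rwa [ll_mul_of_ne this]
  let p : Fin n := ⟨2 * (t + 1), by omega⟩
  let q : Fin n := ⟨2 * (t + 1) + 1, by omega⟩
  have hpq : p ≠ q := by simp [p, q]
  have hrr := h.2 (t + 2) _ hmem (t + 1) (by omega) (by omega) p q rfl rfl
  have hpq' : (E * α).mate (.inr p) = .inr q := by
    rw [← hrr]
    exact mate_inr_of_rr_ne (by rw [hrr]; exact hpq.symm)
  have hr := h.rr_of_ll_swap hα e hab.ne
  obtain ⟨u, hu⟩ := rr_eq_self_iff.1 (show rr α p = p by rw [hr, blk_of_le]; simp [p])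
  -- Otherwise the line of α that ends at p' would prolong a horizontal line of E, and p' would lie
  -- on a line of the product.
  have hu2 : u.val < 2 * (t + 1) := by
    by_contra hge
    have := mul_line (e3 u (by omega)) (α.mate_eq_iff.1 hu)
    rw [(E * α).mate_eq_iff, hpq'] at this
    simp at this
  have hne : ∀ z : Fin n, z.val < 2 * (t + 1) → z ≠ a ∧ z ≠ b := fun z hz =>
    ⟨by rintro rfl; omega, by rintro rfl; omega⟩
  have hblk := blk_val_of_lt hk hu2
  have hu' : (blk n (t + 1) u).val < 2 * (t + 1) := by
    rw [hblk]; unfold partner; omega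
  obtain ⟨w, hw⟩ := exists_line e (hne _ hu').1 (hne _ hu').2
  have hEu : E.mate (.inr u) = .inr (blk n (t + 1) u) := by
    rw [← e2]
    exact mate_inr_of_rr_ne (by rw [e2, blk_ne_iff hk]; exact hu2)
  have hwq : w = q := by
    have := mul_cup hu hEu hw
    rw [hpq'] at this
    exact (Sum.inr_injective this).symm
  subst hwq
  have hut : 2 * t ≤ u.val := by
    by_contra hlt
    obtain ⟨c, hc⟩ := ih (u.val / 2) (by omega) (by omega)
    have hb := twist_div_two c (u.val + 2)
    have := hc u ⟨twist c (u.val + 2), by omega⟩ rfl rfl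
    rw [α.mate_eq_iff.1 hu] at this
    have := congrArg Fin.val (Sum.inr_injective this)
    simp only [p] at this
    omega
  have key : ∀ c : Bool, u.val = twist c (2 * t) → (∃ c : Bool, ∀ x y : Fin n, x.val / 2 = t →
      y.val = twist c (x.val + 2) → α.mate (.inl x) = .inr y) := by
    intro c hcu
    refine ⟨c, fun x y hx hy => ?_⟩
    unfold partner at hblk
    by_cases hxu : x = u
    · subst hxu
      rw [α.mate_eq_iff.1 hu]
      refine congrArg _ (Fin.ext ?_)
      rw [hy, hcu, twist_add_two, twist_twist, Bool.xor_self]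
      simp [p, twist]
      omega
    · have hxu' : x.val ≠ u.val := fun e => hxu (Fin.ext e)
      obtain rfl : x = blk n (t + 1) u := Fin.ext (by omega)
      rw [hw]
      refine congrArg _ (Fin.ext ?_)
      rw [hy, hblk]
      simp only [q]
      cases c <;> simp only [twist, partner] at hcu ⊢ <;> omega
  by_cases hu0 : u.val = 2 * t
  · exact key false hu0
  · refine key true ?_
    simp only [twist, partner]
    omega

theorem eq_chip (h : RCan Λ) (hα : α ∈ Λ) (e : ll α = Equiv.swap a b) (hab : a < b) :
    ∃ ε, α = chip ε a b hab := by
  have : ∀ t, ∃ c : Bool, t < a.val / 2 → ∀ x y : Fin n, x.val / 2 = t →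
      y.val = twist c (x.val + 2) → α.mate (.inl x) = .inr y := by
    intro t
    by_cases ht : t < a.val / 2
    · obtain ⟨c, hc⟩ := h.lines_low hα e hab t ht
      exact ⟨c, fun _ => hc⟩
    · exact ⟨false, fun h => absurd h ht⟩
  choose ε hε using this
  refine ⟨ε, eq_of_mate_inl (fun x => ?_) ((h.rr_of_ll_swap hα e hab.ne).trans rr_chip.symm)⟩
  by_cases ha : x = a
  · subst ha
    rw [mate_pair e hab.ne, mate_pair ll_chip hab.ne]
  by_cases hb : x = b
  · subst hb
    rw [α.mate_eq_iff.1 (mate_pair e hab.ne),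
      (chip ε a x hab).mate_eq_iff.1 (mate_pair ll_chip hab.ne)]
  rw [chip_line ha hb (y := ⟨_, fwd_lt hab b.isLt x.isLt⟩) rfl]
  rcases Nat.lt_or_ge x.val (2 * (a.val / 2)) with hx | hx
  · exact hε (x.val / 2) (by omega) x _ rfl (fwd_low hx)
  · have h2 := h.lines_high hα e hab ha hb
    by_cases hp : x.val = partner a.val
    · rw [h2.2 hp]
      refine congrArg _ (Fin.ext ?_)
      simp only [hp, fwd_partner]
    · have hx' : 2 * (a.val / 2) + 2 ≤ x.val := by
        have : x.val ≠ a.val := fun e => ha (Fin.ext e)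
        unfold partner at hp
        omega
      rw [h2.1 hx']
      refine congrArg _ (Fin.ext ?_)
      simp only [fwd_high hx']

theorem exists_chip (h : RCan Λ) (hab : a < b) : ∃ ε, chip ε a b hab ∈ Λ := by
  obtain ⟨α, hα, e⟩ := h.1.exists_ll (f := Equiv.swap a b) (fun x => Equiv.swap_apply_self _ _ _)
  obtain ⟨ε, rfl⟩ := h.eq_chip hα e hab
  exact ⟨ε, hα⟩

theorem bit_unique (h : RCan Λ) {hab : a < b} {ε ε' : ℕ → Bool} (h1 : chip ε a b hab ∈ Λ)
    (h2 : chip ε' a b hab ∈ Λ) {t : ℕ} (ht : t < a.val / 2) : ε t = ε' t :=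
  chip_inj (h.1.eq_of_ll h1 h2 (ll_chip.trans ll_chip.symm)) ht

end Pair

/-- Both products have exactly the left-left blocks {a, b} and {c, d}, as the second pair is pulled
back along lines of the first factor. This is the source of all equations between bits. -/
theorem mul_comm_pairs (h : IsRCrossSection Λ) {a b c d a' b' c' d' : Fin n} {α₁ α₂ β₁ β₂ : Brauer n}
    (h1 : α₁ ∈ Λ) (h2 : α₂ ∈ Λ) (h3 : β₁ ∈ Λ) (h4 : β₂ ∈ Λ)
    (e1 : ll α₁ = Equiv.swap a b) (e2 : ll α₂ = Equiv.swap c d)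
    (e3 : ll β₁ = Equiv.swap c' d') (e4 : ll β₂ = Equiv.swap a' b')
    (hc : α₁.mate (.inl c) = .inr c') (hd : α₁.mate (.inl d) = .inr d')
    (ha : α₂.mate (.inl a) = .inr a') (hb : α₂.mate (.inl b) = .inr b')
    (hab : a ≠ b) (hcd : c ≠ d) : α₁ * β₁ = α₂ * β₂ := by
  refine h.eq_of_ll (h.mul_mem h1 h3) (h.mul_mem h2 h4) (funext fun x => ?_)
  rw [ll_mul_swap e1 hc hd e3 hcd, ll_mul_swap e2 ha hb e4 hab]
  have h5 : Equiv.swap a b c = c := by rw [← e1]; exact ll_of_inr hc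
  have h6 : Equiv.swap a b d = d := by rw [← e1]; exact ll_of_inr hd
  have : Equiv.swap a b * Equiv.swap c d = Equiv.swap c d * Equiv.swap a b := by
    rw [Equiv.mul_swap_eq_swap_mul, h5, h6]
  exact congrArg (fun σ : Equiv.Perm (Fin n) => σ x) this

end RCan

/-! ### Block flips and normalization of the bits -/

section Chip

variable {ε ε' : ℕ → Bool} {a b c d : Fin n} {h : a < b} {h' : c < d}

theorem chip_low {x y : Fin n} (hx : x.val < 2 * (a.val / 2))
    (hy : y.val = twist (ε (x.val / 2)) (x.val + 2)) : (chip ε a b h).mate (.inl x) = .inr y := by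
  have hab : a.val < b.val := h
  exact chip_line (by rintro rfl; omega) (by rintro rfl; omega) (hy.trans (fwd_low hx).symm)

theorem chip_high {x : Fin n} (hx : 2 * (a.val / 2) + 2 ≤ x.val) (hb : x ≠ b) :
    (chip ε a b h).mate (.inl x) = .inr x :=
  chip_line (by rintro rfl; omega) hb (fwd_high hx).symm

theorem chip_partner {x : Fin n} (hx : x.val = partner a.val) (hb : x ≠ b) :
    (chip ε a b h).mate (.inl x) = .inr b :=
  chip_line (by rintro rfl; unfold partner at hx; omega) hb (by rw [hx, fwd_partner])

theorem chip_mul_chip_low {x y : Fin n} (hx : x.val < 2 * (a.val / 2))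
    (hx' : x.val / 2 + 1 < c.val / 2)
    (hy : y.val = twist (ε (x.val / 2) ^^ ε' (x.val / 2 + 1)) (x.val + 4)) :
    (chip ε a b h * chip ε' c d h').mate (.inl x) = .inr y := by
  have hab : a.val < b.val := h
  have hb := b.isLt
  have h1 := twist_div_two (ε (x.val / 2)) (x.val + 2)
  refine mul_line (m := ⟨twist (ε (x.val / 2)) (x.val + 2), by omega⟩) (chip_low hx rfl)
    (chip_low ?_ ?_)
  · simp only; omega
  · simp only
    rw [hy, h1, show (x.val + 2) / 2 = x.val / 2 + 1 by omega, ← twist_add_two, twist_twist,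
      Bool.xor_comm]

/-- The permutation `σ` preserves the blocks `{2t, 2t + 1}` and flips the ones with `f t`. -/
def IsBlockFlip (f : ℕ → Bool) (σ : Equiv.Perm (Fin n)) : Prop :=
  ∀ x : Fin n, (σ x).val = twist (f (x.val / 2)) x.val

theorem IsBlockFlip.div_two {f : ℕ → Bool} {σ : Equiv.Perm (Fin n)} (hσ : IsBlockFlip f σ)
    (x : Fin n) : (σ x).val / 2 = x.val / 2 := by
  rw [hσ, twist_div_two]

/-- The lines from block t to block t+1 see the flip at their source and the flip at their target,
so ε changes by the coboundary of f. If {a, b} is itself a flipped block, its ends are exchanged;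
hence the alternative in `hcd`. -/
theorem relabel_chip {f : ℕ → Bool} {σ : Equiv.Perm (Fin n)} (hσ : IsBlockFlip f σ)
    (hcd : (c = σ a ∧ d = σ b) ∨ (c = σ b ∧ d = σ a)) :
    relabel σ (chip ε a b h) = chip (fun t => ε t ^^ f t ^^ f (t + 1)) c d h' := by
  have hab : a.val < b.val := h
  have hcd' : c.val < d.val := h'
  have hbn := b.isLt
  have hc : c.val / 2 = a.val / 2 := by
    have h1 := hσ.div_two a
    have h2 := hσ.div_two b
    rcases hcd with ⟨h3, h4⟩ | ⟨h3, h4⟩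
    · rw [h3, h1]
    · rw [h3] at hcd' ⊢
      rw [h4] at hcd'
      omega
  have hll : ll (relabel σ (chip ε a b h)) = Equiv.swap c d := by
    have : Equiv.swap c d = Equiv.swap (σ a) (σ b) := by
      rcases hcd with ⟨h3, h4⟩ | ⟨h3, h4⟩
      · rw [h3, h4]
      · rw [h3, h4, Equiv.swap_comm]
    funext x
    obtain ⟨x, rfl⟩ := σ.surjective x
    rw [ll_relabel, ll_chip, this, Equiv.swap_apply_def, Equiv.swap_apply_def]
    simp only [σ.injective.eq_iff]
    split_ifs <;> rfl
  refine eq_of_mate_inl (fun x => ?_) (funext fun x => ?_)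
  · by_cases hx : Equiv.swap c d x = x
    · obtain ⟨u, rfl⟩ := σ.surjective x
      have hne : σ u ≠ c ∧ σ u ≠ d := by
        constructor <;> rintro e <;> rw [e] at hx
        · rw [Equiv.swap_apply_left] at hx; exact h'.ne' hx
        · rw [Equiv.swap_apply_right] at hx; exact h'.ne hx
      have hu : u ≠ a ∧ u ≠ b := by
        constructor <;> rintro rfl <;> rcases hcd with ⟨h3, h4⟩ | ⟨h3, h4⟩
        · exact hne.1 h3.symm
        · exact hne.2 h4.symm
        · exact hne.2 h4.symm
        · exact hne.1 h3.symm
      have hua : u.val ≠ a.val := fun e => hu.1 (Fin.ext e)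
      have hub : u.val ≠ b.val := fun e => hu.2 (Fin.ext e)
      have hσu := hσ u
      have hdu := hσ.div_two u
      rw [relabel_inl]
      rcases Nat.lt_or_ge u.val (2 * (a.val / 2)) with hlow | hge
      · have h1 := twist_div_two (ε (u.val / 2)) (u.val + 2)
        rw [chip_low (y := ⟨twist (ε (u.val / 2)) (u.val + 2), by omega⟩) hlow rfl]
        symm
        refine chip_low (by omega) ?_
        rw [hσ, hdu]
        simp only [h1, hσu, ← twist_add_two, twist_twist,
          show (u.val + 2) / 2 = u.val / 2 + 1 by omega]
        congr 1
        cases f (u.val / 2) <;> cases f (u.val / 2 + 1) <;> cases ε (u.val / 2) <;> rfl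
      · by_cases hp : u.val = partner a.val
        · rw [chip_partner hp hu.2]
          have hp' : a.val / 2 < b.val / 2 := by unfold partner at hp; omega
          have h1 := hσ.div_two a
          have h2 := hσ.div_two b
          rcases hcd with ⟨rfl, rfl⟩ | ⟨rfl, rfl⟩
          · symm
            refine chip_partner ?_ hne.2
            have hσu' := hσ a
            have h3 : u.val / 2 = a.val / 2 := by rw [hp]; unfold partner; omega
            rw [hσu, hσu', hp, ← hp, h3, hp]
            cases f (a.val / 2) <;> simp only [twist, partner]
          · omega
        · have hu2 : 2 * (a.val / 2) + 2 ≤ u.val := by unfold partner at hp; omega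
          rw [chip_high hu2 hu.2, chip_high (by omega) hne.2]
          rfl
    · rw [mate_inl_of_ll_ne (hll ▸ hx), mate_inl_of_ll_ne (ll_chip.symm ▸ hx), hll, ll_chip]
  · obtain ⟨u, rfl⟩ := σ.surjective x
    have hn := two_le_of_lt h
    have hσu := hσ u
    have hdu := hσ.div_two u
    rw [rr_relabel, rr_chip, rr_chip]
    apply Fin.ext
    by_cases hu : u.val < 2
    · have h3 := blk_val_of_lt hn (x := u) (by omega)
      rw [blk_val_of_lt hn (by omega), hσ, h3, hσu]
      rw [show partner u.val / 2 = u.val / 2 by unfold partner; omega]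
      cases f (u.val / 2) <;> simp only [twist]
    · rw [blk_of_le (by omega), blk_of_le (by omega)]

end Chip

theorem RCan.conj_of_flip {Λ : Set (Brauer n)} (h : RCan Λ) {f : ℕ → Bool}
    {σ : Equiv.Perm (Fin n)} (hσ : IsBlockFlip f σ) : RCan (conj σ Λ) := by
  refine ⟨h.1.conj σ, fun k => forall_mem_conj.2 fun α hα t ht hc x y hx hy => ?_⟩
  rw [corank_relabel] at hc
  obtain ⟨u, rfl⟩ := σ.surjective x
  have hn := α.corank_le
  have hu := hσ.div_two u
  have hσu := hσ u
  have h2 : 2 * (t + 1) ≤ n := by omega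
  have hb := blk_val_of_lt h2 (x := u) (by omega)
  rw [rr_relabel, (h.2 (t + 1)).rr_eq hα le_rfl (by omega) (by omega)]
  apply Fin.ext
  rw [hσ, hb, hy]
  have h3 : partner u.val / 2 = u.val / 2 := by unfold partner; omega
  rw [h3]
  rw [hσu] at hx
  generalize f (u.val / 2) = e at hx ⊢
  cases e <;> simp only [twist, partner] at hx ⊢ <;> omega

theorem isBlockFlip_swap {s : ℕ} (hs : 2 * s + 1 < n) :
    IsBlockFlip (fun t => decide (t = s))
      (Equiv.swap (⟨2 * s, by omega⟩ : Fin n) ⟨2 * s + 1, hs⟩) := by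
  intro x
  rw [Equiv.swap_apply_def]
  simp only [Fin.ext_iff]
  by_cases h1 : x.val / 2 = s
  · simp only [h1, decide_true, twist, partner]
    split_ifs
    · simp only; omega
    · simp only; omega
    · omega
  · simp only [h1, decide_false, twist]
    rw [if_neg (by omega), if_neg (by omega)]

/-- Canonical cross-sections such that the elements with the left-left block `{2t + 2, 2t + 3}`
connect `2t` with `(2t + 2)'`, for `t < k`. -/
def NormalUpTo (k : ℕ) (Λ : Set (Brauer n)) : Prop :=
  RCan Λ ∧ ∀ t < k, ∀ (a b : Fin n) (h : a < b) (ε : ℕ → Bool), a.val = 2 * t + 2 →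
    b.val = 2 * t + 3 → chip ε a b h ∈ Λ → ε t = false

/-- A wrong bit k of the pair {2k+2, 2k+3} is repaired by flipping block k+1. This flip affects only
the bits with index k and k+1, so the bits normalized before are kept. -/
theorem RCan.exists_normalUpTo {Λ : Set (Brauer n)} (h : RCan Λ) (k : ℕ) :
    ∃ σ : Equiv.Perm (Fin n), NormalUpTo k (conj σ Λ) := by
  induction k with
  | zero => exact ⟨1, by rwa [conj_one], fun t ht => absurd ht (by omega)⟩
  | succ k ih =>
    obtain ⟨σ, hσ, hk⟩ := ih
    by_cases hall : ∀ (a b : Fin n) (h : a < b) (ε : ℕ → Bool), a.val = 2 * k + 2 →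
        b.val = 2 * k + 3 → chip ε a b h ∈ conj σ Λ → ε k = false
    · refine ⟨σ, hσ, fun t ht => ?_⟩
      rcases Nat.lt_or_ge t k with h | h
      · exact hk t h
      · obtain rfl : t = k := by omega
        exact hall
    · push Not at hall
      obtain ⟨a₀, b₀, hab₀, ε₀, ha₀, hb₀, hmem, hbit⟩ := hall
      have hn : 2 * (k + 1) + 1 < n := by have := b₀.isLt; omega
      have hτ := isBlockFlip_swap hn
      set τ := Equiv.swap (⟨2 * (k + 1), by omega⟩ : Fin n) ⟨2 * (k + 1) + 1, hn⟩
      refine ⟨τ * σ, ?_⟩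
      rw [← conj_conj]
      refine ⟨hσ.conj_of_flip hτ, fun t ht a b hab ε ha hb hε => ?_⟩
      have hcan := hσ.conj_of_flip hτ
      obtain ⟨ε₁, hε₁⟩ := hσ.exists_chip hab
      have hsorted : (a = τ a ∧ b = τ b) ∨ (a = τ b ∧ b = τ a) := by
        have h1 : (τ a).val = twist (decide (a.val / 2 = k + 1)) a.val := hτ a
        have h2 : (τ b).val = twist (decide (b.val / 2 = k + 1)) b.val := hτ b
        simp only [Fin.ext_iff]
        rw [h1, h2, ha, hb, show (2 * t + 2) / 2 = t + 1 by omega,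
          show (2 * t + 3) / 2 = t + 1 by omega]
        cases decide (t + 1 = k + 1)
        · exact .inl ⟨rfl, rfl⟩
        · simp only [twist, partner]
          omega
      have h2 : relabel τ (chip ε₁ a b hab) ∈ conj τ (conj σ Λ) := relabel_mem_conj.2 hε₁
      rw [relabel_chip hτ (h' := hab) hsorted] at h2
      rw [hcan.bit_unique hε h2 (t := t) (by omega)]
      rcases Nat.lt_or_ge t k with htk | htk
      · rw [hk t htk a b hab ε₁ ha hb hε₁]
        have h3 : t ≠ k + 1 := by omega
        have h4 : t ≠ k := by omega
        simp [h3, h4]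
      · obtain rfl : t = k := by omega
        obtain rfl : a = a₀ := Fin.ext (by omega)
        obtain rfl : b = b₀ := Fin.ext (by omega)
        rw [hσ.bit_unique hε₁ hmem (t := t) (by omega)]
        simpa using hbit

/-- Canonical cross-sections such that the elements with the left-left block `{2t + 2, 2t + 3}`
connect `2t` with `(2t + 2)'`. -/
def Normal (Λ : Set (Brauer n)) : Prop := ∀ k, NormalUpTo k Λ

theorem RCan.exists_normal {Λ : Set (Brauer n)} (h : RCan Λ) :
    ∃ σ : Equiv.Perm (Fin n), Normal (conj σ Λ) := by
  obtain ⟨σ, hσ, hn⟩ := h.exists_normalUpTo n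
  refine ⟨σ, fun k => ⟨hσ, fun t _ a b hab ε ha => hn t ?_ a b hab ε ha⟩⟩
  have := a.isLt
  omega

/-! ### Equations between the bits and their solution -/

section Relations

variable {Λ : Set (Brauer n)} (h : IsRCrossSection Λ)
include h

/-- The chip of {a, b} fixes c and d, while that of {c, d} sends a, b to a', b'. The two
factorizations of the element with both pairs push block t up by two, and their total flips must
agree. -/
theorem xor_bits_of_lt {a b c d r s a' b' : Fin n} {hab : a < b} {hcd : c < d} {hrs : r < s}
    {ε ε' ε'' : ℕ → Bool} (h1 : chip ε a b hab ∈ Λ) (h2 : chip ε' c d hcd ∈ Λ)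
    (h3 : chip ε'' r s hrs ∈ Λ) (hlt : a.val / 2 < c.val / 2) (hbc : b ≠ c) (hbd : b ≠ d)
    (ha' : (chip ε' c d hcd).mate (.inl a) = .inr a')
    (hb' : (chip ε' c d hcd).mate (.inl b) = .inr b')
    (hsw : Equiv.swap r s = Equiv.swap a' b') (hr : r.val / 2 = a.val / 2 + 1) {t : ℕ}
    (ht : t < a.val / 2) : (ε t ^^ ε' (t + 1)) = (ε' t ^^ ε'' (t + 1)) := by
  have hcd' : c.val < d.val := hcd
  have hcn := c.isLt
  have e := RCan.mul_comm_pairs h h1 h2 h2 h3 ll_chip ll_chip ll_chip (ll_chip.trans (by rw [hsw]))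
    (chip_high (by omega) hbc.symm) (chip_high (by omega) hbd.symm) ha' hb' hab.ne hcd.ne
  have hx : (2 * t) / 2 = t := by omega
  have b1 := twist_div_two (ε t ^^ ε' (t + 1)) (2 * t + 4)
  have b2 := twist_div_two (ε' t ^^ ε'' (t + 1)) (2 * t + 4)
  have e1 := chip_mul_chip_low (ε := ε) (ε' := ε') (h := hab) (h' := hcd) (x := ⟨2 * t, by omega⟩)
    (y := ⟨twist (ε t ^^ ε' (t + 1)) (2 * t + 4), by omega⟩) (by simp only; omega)
    (by simp only; omega) (by simp only [hx])
  have e2 := chip_mul_chip_low (ε := ε') (ε' := ε'') (h := hcd) (h' := hrs)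
    (x := ⟨2 * t, by omega⟩)
    (y := ⟨twist (ε' t ^^ ε'' (t + 1)) (2 * t + 4), by omega⟩) (by simp only; omega)
    (by simp only; omega) (by simp only [hx])
  rw [e, e2] at e1
  exact (twist_inj (congrArg Fin.val (Sum.inr_injective e1))).symm

/-- When a and c are partners, both factorizations have the same second factor, the chip of {b, d},
and its bits cancel. -/
theorem bits_eq_of_partner {a b c d r s : Fin n} {hab : a < b} {hcd : c < d} {hrs : r < s}
    {ε ε' ε'' : ℕ → Bool} (h1 : chip ε a b hab ∈ Λ) (h2 : chip ε' c d hcd ∈ Λ)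
    (h3 : chip ε'' r s hrs ∈ Λ) (hac : c.val = partner a.val) (hb : a.val / 2 < b.val / 2)
    (hd : a.val / 2 < d.val / 2) (hbd : b ≠ d) (hsw : Equiv.swap r s = Equiv.swap b d)
    (hr : a.val / 2 < r.val / 2) {t : ℕ} (ht : t < a.val / 2) : ε t = ε' t := by
  have han := b.isLt
  have hcn := d.isLt
  have hca : a.val = partner c.val := by rw [hac]; unfold partner; omega
  have hac2 : c.val / 2 = a.val / 2 := by rw [hac]; unfold partner; omega
  have e := RCan.mul_comm_pairs h h1 h2 h3 h3 ll_chip ll_chip (ll_chip.trans (by rw [hsw]))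
    (ll_chip.trans (by rw [hsw, Equiv.swap_comm]))
    (chip_partner hac (by rintro rfl; omega)) (chip_high (by omega) hbd.symm)
    (chip_partner hca (by rintro rfl; omega)) (chip_high (by omega) hbd) hab.ne hcd.ne
  have hx : (2 * t) / 2 = t := by omega
  have b1 := twist_div_two (ε t ^^ ε'' (t + 1)) (2 * t + 4)
  have b2 := twist_div_two (ε' t ^^ ε'' (t + 1)) (2 * t + 4)
  have e1 := chip_mul_chip_low (ε := ε) (ε' := ε'') (h := hab) (h' := hrs) (x := ⟨2 * t, by omega⟩)
    (y := ⟨twist (ε t ^^ ε'' (t + 1)) (2 * t + 4), by omega⟩) (by simp only; omega)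
    (by simp only; omega) (by simp only [hx])
  have e2 := chip_mul_chip_low (ε := ε') (ε' := ε'') (h := hcd) (h' := hrs)
    (x := ⟨2 * t, by omega⟩)
    (y := ⟨twist (ε' t ^^ ε'' (t + 1)) (2 * t + 4), by omega⟩) (by simp only; omega)
    (by simp only; omega) (by simp only [hx])
  rw [e, e2] at e1
  have := twist_inj (congrArg Fin.val (Sum.inr_injective e1))
  revert this
  cases ε t <;> cases ε' t <;> cases ε'' (t + 1) <;> simp

end Relations

theorem swap_eq_swap_twist (e : Bool) (m : ℕ) {r s a b : Fin n} (hr : r.val = 2 * m)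
    (hs : s.val = 2 * m + 1) (ha : a.val = twist e (2 * m)) (hb : b.val = twist e (2 * m + 1)) :
    Equiv.swap r s = Equiv.swap a b := by
  cases e <;> simp only [twist, partner] at ha hb
  · rw [show r = a from Fin.ext (by omega), show s = b from Fin.ext (by omega)]
  · rw [show r = b from Fin.ext (by omega), show s = a from Fin.ext (by omega), Equiv.swap_comm]

/-- The parameters of the normal cross-sections. -/
def bit (u v : Bool) (a b : ℕ) : Bool :=
  if b = partner a then false else if (a + b) % 2 = 0 then u else v

theorem Normal.exists_bit {Λ : Set (Brauer n)} (h : Normal Λ) : ∃ u v : Bool, (7 ≤ n → u = v) ∧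
    ∀ (a b : Fin n) (hab : a < b), chip (fun _ => bit u v a b) a b hab ∈ Λ := by
  have hcan := (h 0).1
  have hnorm : ∀ (t : ℕ) (a b : Fin n) (hab : a < b) (ε : ℕ → Bool), a.val = 2 * t + 2 →
      b.val = 2 * t + 3 → chip ε a b hab ∈ Λ → ε t = false := fun t => (h (t + 1)).2 t (by omega)
  have hex : ∀ (a b : Fin n) (hab : a < b), ∃ ε, chip ε a b hab ∈ Λ := fun a b hab =>
    hcan.exists_chip hab
  choose ε hε using hex
  -- The chip of {a, b} carries the block t+1 to the block t+2, and the bits of these two block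
  -- pairs that enter the equation are normalized to zero.
  have const_succ : ∀ (a b : Fin n) (hab : a < b) (t : ℕ), t + 1 < a.val / 2 →
      ε a b hab (t + 1) = ε a b hab t := by
    intro a b hab t ht
    have hab' : a.val < b.val := hab
    have hbn := b.isLt
    let p : Fin n := ⟨2 * t + 2, by omega⟩
    let q : Fin n := ⟨2 * t + 3, by omega⟩
    let r : Fin n := ⟨2 * t + 4, by omega⟩
    let s : Fin n := ⟨2 * t + 5, by omega⟩
    have hpq : p < q := by simp [p, q]
    have hrs : r < s := by simp [r, s]
    have h1 := hnorm t p q hpq _ rfl rfl (hε p q hpq)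
    have h2 := hnorm (t + 1) r s hrs _ rfl rfl (hε r s hrs)
    have hp := twist_div_two (ε a b hab (t + 1)) (2 * t + 4)
    have hq := twist_div_two (ε a b hab (t + 1)) (2 * t + 5)
    have e := xor_bits_of_lt hcan.1 (hε p q hpq) (hε a b hab) (hε r s hrs) (t := t)
      (a' := ⟨twist (ε a b hab (t + 1)) (2 * t + 4), by omega⟩)
      (b' := ⟨twist (ε a b hab (t + 1)) (2 * t + 5), by omega⟩)
      (by simp only [p]; omega) (Fin.ne_of_val_ne (by simp only [q]; omega))
      (Fin.ne_of_val_ne (by simp only [q]; omega))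
      (chip_low (by simp only [p]; omega)
        (by simp only [p]; rw [show (2 * t + 2) / 2 = t + 1 by omega]))
      (chip_low (by simp only [q]; omega)
        (by simp only [q]; rw [show (2 * t + 3) / 2 = t + 1 by omega]))
      (swap_eq_swap_twist _ (t + 2) rfl rfl rfl rfl)
      (by simp only [p, r]; omega) (by simp only [p]; omega)
    rw [h1, h2] at e
    simpa using e
  have const : ∀ (a b : Fin n) (hab : a < b) (t : ℕ), t < a.val / 2 →
      ε a b hab t = ε a b hab 0 := by
    intro a b hab t ht
    induction t with
    | zero => rfl
    | succ t ih => rw [const_succ a b hab t ht, ih (by omega)]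
  let G : ℕ → ℕ → Bool := fun a b =>
    if h : a < b ∧ b < n then ε ⟨a, by omega⟩ ⟨b, h.2⟩ (by simpa using h.1) 0 else false
  have hG : ∀ (a b : Fin n) (hab : a < b), G a b = ε a b hab 0 := fun a b hab =>
    dif_pos ⟨hab, b.isLt⟩
  have hblock : ∀ a b : ℕ, 2 ≤ a → a < b → b < n → b = partner a → G a b = false := by
    intro a b ha hab hb hp
    unfold partner at hp
    have hab' : (⟨a, by omega⟩ : Fin n) < ⟨b, hb⟩ := by simpa using hab
    refine (hG ⟨a, by omega⟩ ⟨b, hb⟩ hab').trans ?_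
    rw [← const _ _ hab' (a / 2 - 1) (by simp only; omega)]
    exact hnorm _ _ _ hab' _ (by simp only; omega) (by simp only; omega) (hε _ _ hab')
  -- The pair {a - 2, b} is compared with the block {c, d} of a. All relevant bits of that block
  -- vanish, so its chip sends a - 2 to a and fixes b.
  have hdown : ∀ a b : ℕ, 4 ≤ a → a < b → b < n → b ≠ partner a → G a b = G (a - 2) b := by
    intro a b ha hab hb hp
    unfold partner at hp
    let p : Fin n := ⟨a - 2, by omega⟩
    let q : Fin n := ⟨b, hb⟩
    let r : Fin n := ⟨a, by omega⟩
    let c : Fin n := ⟨2 * (a / 2), by omega⟩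
    let d : Fin n := ⟨2 * (a / 2) + 1, by omega⟩
    have hpq : p < q := by simp [p, q]; omega
    have hrq : r < q := by simpa [r, q] using hab
    have hcd : c < d := by simp [c, d]
    have hz : ∀ t < a / 2, ε c d hcd t = false := by
      intro t ht
      rw [const c d hcd t (by simp only [c]; omega), ← hG]
      exact hblock _ _ (by simp only [c]; omega) hcd d.isLt (by simp only [c, d, partner]; omega)
    have e := xor_bits_of_lt hcan.1 (hε p q hpq) (hε c d hcd) (hε r q hrq) (t := 0)
      (a' := r) (b' := q)
      (by simp only [p, c]; omega) (by simp [q, c]; omega) (by simp [q, d]; omega)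
      (chip_low (by simp only [p, c]; omega)
        (by simp only [p, r]; rw [hz _ (by omega)]; simp only [twist]; omega))
      (chip_high (by simp only [c, q]; omega) (by simp [q, d]; omega))
      rfl (by simp only [p, r]; omega) (by simp only [p]; omega)
    rw [hz _ (by omega), hz _ (by omega)] at e
    have e1 : G a b = ε r q hrq 0 := hG r q hrq
    have e2 : G (a - 2) b = ε p q hpq 0 := hG p q hpq
    rw [e1, e2, ← const r q hrq 1 (by simp only [r]; omega)]
    simpa using e.symm
  have hbase : ∀ a b : ℕ, 2 ≤ a → a < b → b < n → b ≠ partner a → G a b = G (2 + a % 2) b := by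
    intro a
    induction a using Nat.strong_induction_on with
    | _ a ih =>
    intro b ha hab hb hp
    rcases Nat.lt_or_ge a 4 with h4 | h4
    · rw [show 2 + a % 2 = a by omega]
    · have hp' := hp
      unfold partner at hp'
      rw [hdown a b h4 hab hb hp, ih (a - 2) (by omega) b (by omega) (by omega) hb
        (by unfold partner; omega), show (a - 2) % 2 = a % 2 by omega]
  have hcross : ∀ b d : ℕ, 4 ≤ b → 4 ≤ d → b < n → d < n → b ≠ d → G 2 b = G 3 d := by
    intro b d hb4 hd4 hb hd hbd
    let a : Fin n := ⟨2, by omega⟩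
    let c : Fin n := ⟨3, by omega⟩
    let b' : Fin n := ⟨b, hb⟩
    let d' : Fin n := ⟨d, hd⟩
    have hab : a < b' := by simp [a, b']; omega
    have hcd : c < d' := by simp [c, d']; omega
    have hbd' : b' ≠ d' := by simpa [b', d'] using hbd
    have e1 : G 2 b = ε a b' hab 0 := hG a b' hab
    have e2 : G 3 d = ε c d' hcd 0 := hG c d' hcd
    rw [e1, e2]
    rcases lt_or_gt_of_ne hbd' with hlt | hlt
    · exact bits_eq_of_partner hcan.1 (hε a b' hab) (hε c d' hcd) (hε b' d' hlt)
        (by simp [a, c, partner]) (by simp only [a, b']; omega) (by simp only [a, d']; omega) hbd'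
        rfl (by simp only [a, b']; omega) (by simp only [a]; omega)
    · exact bits_eq_of_partner hcan.1 (hε a b' hab) (hε c d' hcd) (hε d' b' hlt)
        (by simp [a, c, partner]) (by simp only [a, b']; omega) (by simp only [a, d']; omega) hbd'
        (Equiv.swap_comm _ _) (by simp only [a, d']; omega) (by simp only [a]; omega)
  have hbit : ∀ (u v : Bool), (∀ a b : ℕ, 2 ≤ a → a < 4 → 4 ≤ b → b < n →
      G a b = if (a + b) % 2 = 0 then u else v) →
      ∀ (a b : Fin n) (hab : a < b), chip (fun _ => bit u v a b) a b hab ∈ Λ := by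
    intro u v huv a b hab
    have hab' : a.val < b.val := hab
    have := hε a b hab
    rw [chip_congr (ε' := fun _ => bit u v a b)] at this
    · exact this
    · intro t ht
      rw [const a b hab t ht, ← hG]
      unfold bit
      split_ifs with hp hpar
      · exact hblock _ _ (by omega) hab b.isLt hp
      · rw [hbase _ _ (by omega) hab b.isLt hp, huv _ _ (by omega) (by omega)
          (by unfold partner at hp; omega) b.isLt, if_pos (by omega)]
      · rw [hbase _ _ (by omega) hab b.isLt hp, huv _ _ (by omega) (by omega)
          (by unfold partner at hp; omega) b.isLt, if_neg (by omega)]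
  by_cases hn : 7 ≤ n
  · refine ⟨G 2 4, G 2 4, fun _ => rfl, hbit _ _ fun a b ha ha4 hb hbn => ?_⟩
    rw [ite_self]
    -- The path (3,4), (2,5), (3,6), (2,4) needs three values above 3, hence n ≥ 7. With only 4 and
    -- 5 available, the relation preserves the parity of a + b and leaves two classes.
    have h34 : G 3 4 = G 2 4 := by
      rw [← hcross 5 4 (by omega) (by omega) (by omega) (by omega) (by omega),
        hcross 5 6 (by omega) (by omega) (by omega) (by omega) (by omega),
        ← hcross 4 6 (by omega) (by omega) (by omega) (by omega) (by omega)]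
    by_cases hb4 : b = 4
    · subst hb4
      obtain rfl | rfl : a = 2 ∨ a = 3 := by omega
      · rfl
      · exact h34
    · obtain rfl | rfl : a = 2 ∨ a = 3 := by omega
      · rw [hcross b 4 hb (by omega) hbn (by omega) hb4, h34]
      · rw [hcross 4 b (by omega) hb (by omega) hbn (Ne.symm hb4)]
  · refine ⟨G 2 4, G 3 4, fun h => absurd h hn, hbit _ _ fun a b ha ha4 hb hbn => ?_⟩
    obtain rfl | rfl : a = 2 ∨ a = 3 := by omega
    · obtain rfl | rfl : b = 4 ∨ b = 5 := by omega
      · rfl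
      · exact hcross 5 4 (by omega) (by omega) (by omega) (by omega) (by omega)
    · obtain rfl | rfl : b = 4 ∨ b = 5 := by omega
      · rfl
      · exact (hcross 4 5 (by omega) (by omega) (by omega) (by omega) (by omega)).symm

/-! ### Left multiplication when the second factor avoids the right-right blocks -/

section Transport

variable {α β β' : Brauer n}

/-- No left-left block of β meets a right-right block of α, so no path zigzags: the left-left blocks
of β are simply pulled back along the lines of α. Cancellation and descent of the corank follow. -/
theorem mate_ll_mul (hβ : ∀ y, rr α y ≠ y → ll β y = y) {x y : Fin n}
    (h : α.mate (.inl x) = .inr y) : α.mate (.inl (ll (α * β) x)) = .inr (ll β y) := by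
  by_cases hy : ll β y = y
  · obtain ⟨z, hz⟩ := ll_eq_self_iff.1 hy
    rw [ll_of_inr (mul_line h hz), hy, h]
  · have hz : rr α (ll β y) = ll β y := by
      by_contra hc
      have := hβ _ hc
      rw [ll_involutive β] at this
      exact hy this.symm
    obtain ⟨x', hx'⟩ := rr_eq_self_iff.1 hz
    rw [ll_of_inl (mul_cap h (mate_inl_of_ll_ne hy) hx'), α.mate_eq_iff.1 hx']

theorem ll_eq_of_ll_mul_eq (hβ : ∀ y, rr α y ≠ y → ll β y = y)
    (hβ' : ∀ y, rr α y ≠ y → ll β' y = y) (h : ll (α * β) = ll (α * β')) : ll β = ll β' := by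
  funext y
  by_cases hy : rr α y = y
  · obtain ⟨x, hx⟩ := rr_eq_self_iff.1 hy
    have h1 := mate_ll_mul hβ (α.mate_eq_iff.1 hx)
    have h2 := mate_ll_mul hβ' (α.mate_eq_iff.1 hx)
    rw [h, h2] at h1
    exact (Sum.inr_injective h1).symm
  · rw [hβ y hy, hβ' y hy]

theorem card_moved_lt (hβ : ∀ y, rr α y ≠ y → ll β y = y) {a : Fin n} (ha : ll α a ≠ a) :
    (moved (ll β)).card < (moved (ll (α * β))).card := by
  have hmem : a ∈ moved (ll (α * β)) := mem_moved.2 (by rwa [ll_mul_of_ne ha])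
  have hline : ∀ y ∈ moved (ll β), ∃ x, α.mate (.inr y) = .inl x := by
    intro y hy
    rw [mem_moved] at hy
    by_contra hc
    exact hy (hβ y fun h => hc (rr_eq_self_iff.1 h))
  refine lt_of_le_of_lt ?_ (Finset.card_erase_lt_of_mem hmem)
  refine Finset.card_le_card_of_injOn (fun y => (α.mate (.inr y)).elim id id) ?_ ?_
  · intro y hy
    obtain ⟨x, hx⟩ := hline y hy
    have hx' := α.mate_eq_iff.1 hx
    simp only [hx, Sum.elim_inl, id, Finset.coe_erase, Set.mem_sdiff, Finset.mem_coe, mem_moved,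
      Set.mem_singleton_iff]
    refine ⟨fun h => ?_, ?_⟩
    · have := mate_ll_mul hβ hx'
      rw [h, hx'] at this
      exact mem_moved.1 hy (Sum.inr_injective this).symm
    · rintro rfl
      exact ha (ll_of_inr hx')
  · intro y hy y' hy' e
    obtain ⟨x, hx⟩ := hline y hy
    obtain ⟨x', hx'⟩ := hline y' hy'
    simp only [hx, hx', Sum.elim_inl, id] at e
    subst e
    exact Sum.inr_injective (α.mate_injective (hx.trans hx'.symm))

theorem corank_mul_le : (α * β).corank ≤ α.corank + β.corank := by
  simp only [corank_eq_ll]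
  refine le_trans (Finset.card_le_card (t := moved (ll α) ∪
    (moved (ll β)).image fun y => (α.mate (.inr y)).elim id id) fun x hx => ?_)
    ((Finset.card_union_le _ _).trans (Nat.add_le_add_left Finset.card_image_le _))
  rw [Finset.mem_union, mem_moved, or_iff_not_imp_left, not_not]
  intro h
  obtain ⟨y, hy⟩ := ll_eq_self_iff.1 h
  refine Finset.mem_image.2 ⟨y, mem_moved.2 fun h' => ?_, by simp [α.mate_eq_iff.1 hy]⟩
  obtain ⟨z, hz⟩ := ll_eq_self_iff.1 h'
  exact mem_moved.1 hx (ll_of_inr (mul_line hy hz))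

/-- The blocks of f other than those of α consist of ends of lines of α; pushing them along these
lines yields g. This is how one pair is split off an involution. -/
theorem exists_involutive_of_extends {f : Fin n → Fin n} (hf : Function.Involutive f)
    (he : ∀ a, ll α a ≠ a → f a = ll α a) : ∃ g : Fin n → Fin n, Function.Involutive g ∧
      (∀ y, rr α y ≠ y → g y = y) ∧ ∀ β, ll β = g → ll (α * β) = f := by
  let g : Fin n → Fin n := fun y => match α.mate (.inr y) with
    | .inr _ => y
    | .inl x => match α.mate (.inl (f x)) with
      | .inr z => z
      | .inl _ => y
  have hline : ∀ x y, α.mate (.inl x) = .inr y → α.mate (.inl (f x)) = .inr (g y) := by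
    intro x y h
    have h1 : ll α (f x) = f x := by
      by_contra hc
      have h2 := he _ hc
      rw [hf x] at h2
      have h3 := congrArg (ll α) h2
      rw [ll_involutive α, ll_of_inr h] at h3
      rw [← h3, ll_of_inr h] at hc
      exact hc rfl
    obtain ⟨z, hz⟩ := ll_eq_self_iff.1 h1
    have : g y = z := by simp only [g, α.mate_eq_iff.1 h, hz]
    rw [this, hz]
  have hfix : ∀ y, rr α y ≠ y → g y = y := fun y hy => by
    simp only [g, mate_inr_of_rr_ne hy]
  refine ⟨g, fun y => ?_, hfix, fun β hβ => funext fun x => ?_⟩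
  · by_cases hy : rr α y = y
    · obtain ⟨x, hx⟩ := rr_eq_self_iff.1 hy
      have h1 := α.mate_eq_iff.1 hx
      have h2 := hline _ _ (hline _ _ h1)
      rw [hf x, h1] at h2
      exact (Sum.inr_injective h2).symm
    · rw [hfix y hy, hfix y hy]
  · by_cases hx : ll α x = x
    · obtain ⟨y, hy⟩ := ll_eq_self_iff.1 hx
      have h1 := mate_ll_mul (β := β) (hβ ▸ hfix) hy
      rw [hβ, ← hline x y hy] at h1
      exact Sum.inl_injective (α.mate_injective h1)
    · rw [ll_mul_of_ne hx, he x hx]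

end Transport

/-! ### Identities between products of two chips -/

section ChipProducts

variable {ε ε' : ℕ → Bool} {a b c d r s r' s' a' b' c' d' : Fin n} {hab : a < b}
  {hcd : c < d} {hrs : r < s} {hrs' : r' < s'}

theorem chip_low_two (hr : 2 ≤ r.val) {x : Fin n} (hx : x.val < 2) :
    ∃ y : Fin n, y.val / 2 = 1 ∧ (chip ε r s hrs).mate (.inl x) = .inr y := by
  have h1 := twist_div_two (ε (x.val / 2)) (x.val + 2)
  have hrs' : r.val < s.val := hrs
  have := s.isLt
  exact ⟨⟨twist (ε (x.val / 2)) (x.val + 2), by omega⟩, by simp only; omega,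
    chip_low (by omega) rfl⟩

theorem exists_chip_low {y : Fin n} (hy : 2 ≤ y.val) (hy' : y.val / 2 ≤ r.val / 2) :
    ∃ x : Fin n, x.val / 2 + 1 = y.val / 2 ∧ (chip ε r s hrs).mate (.inl x) = .inr y := by
  have hyn := y.isLt
  have hrn := r.isLt
  have h1 := twist_div_two (ε (y.val / 2 - 1)) (y.val - 2)
  refine ⟨⟨twist (ε (y.val / 2 - 1)) (y.val - 2), by omega⟩, by simp only; omega,
    chip_low (by simp only; omega) ?_⟩
  simp only
  rw [show twist (ε (y.val / 2 - 1)) (y.val - 2) / 2 = y.val / 2 - 1 by omega, twist_add_two,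
    twist_twist, Bool.xor_self]
  simp only [twist]
  omega

/-- As r lies above block 0, the second chip pushes the right-right block {0', 1'} of the first one
to {2', 3'} and adds its own block {0', 1'}. -/
theorem rr_chip_mul_chip (hr : 2 ≤ r.val) : rr (chip ε a b hab * chip ε' r s hrs) = blk n 2 := by
  have hn : 2 * 2 ≤ n := by
    have h1 : r.val < s.val := hrs
    have := s.isLt
    omega
  funext y
  by_cases hy : y.val < 2
  · have h1 : rr (chip ε' r s hrs) y ≠ y := by rw [rr_chip, blk_ne_iff (by omega)]; omega
    rw [rr_mul_of_ne h1, rr_chip]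
    apply Fin.ext
    rw [blk_val_of_lt (by omega) (by omega), blk_val_of_lt (by omega) (by omega)]
  · obtain ⟨m, hm⟩ := rr_eq_self_iff.1
      (show rr (chip ε' r s hrs) y = y by rw [rr_chip, blk_of_le (by omega)])
    by_cases hm2 : m.val < 2
    · obtain ⟨y', hy', h2⟩ := chip_low_two (ε := ε') (hrs := hrs) hr hm2
      rw [Brauer.mate_eq_iff, h2] at hm
      obtain rfl := Sum.inr_injective hm
      have hb := blk_val_of_lt (n := n) (k := 1) (by omega) (x := m) (by omega)
      obtain ⟨z, hz, h3⟩ := chip_low_two (ε := ε') (hrs := hrs) hr (x := blk n 1 m)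
        (by rw [hb]; unfold partner; omega)
      have h4 : (chip ε a b hab).mate (.inr m) = .inr (blk n 1 m) := by
        rw [← rr_chip (ε := ε) (h := hab)]
        exact mate_inr_of_rr_ne (by rw [rr_chip, blk_ne_iff (by omega)]; omega)
      rw [rr_of_inr (mul_cup ((Brauer.mate_eq_iff _).1 h2) h4 h3)]
      have hne : z ≠ y' := by
        rintro rfl
        have := Sum.inl_injective (Brauer.mate_injective _ (h3.trans h2.symm))
        exact (blk_ne_iff (n := n) (k := 1) (by omega)).2 (by omega) this
      have hne' : z.val ≠ y'.val := fun e => hne (Fin.ext e)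
      apply Fin.ext
      rw [blk_val_of_lt (by omega) (by omega)]
      unfold partner
      omega
    · obtain ⟨x, hx⟩ := rr_eq_self_iff.1
        (show rr (chip ε a b hab) m = m by rw [rr_chip, blk_of_le (by omega)])
      have h5 := mul_line ((Brauer.mate_eq_iff _).1 hx) ((Brauer.mate_eq_iff _).1 hm)
      rw [rr_of_inl ((Brauer.mate_eq_iff _).1 h5), blk_of_le]
      by_contra hlt
      obtain ⟨x', hx', h6⟩ := exists_chip_low (ε := ε') (hrs := hrs) (y := y) (by omega) (by omega)
      obtain rfl := Sum.inl_injective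
        (Brauer.mate_injective _ (((Brauer.mate_eq_iff _).1 hm).trans h6.symm))
      omega

/-- The left-left blocks agree because disjoint transpositions commute, and the right-right blocks
because r and r' lie above block 0. Only the remaining lines have to be compared, which is
arithmetic with `fwd`. -/
theorem chip_mul_eq_chip_mul {ε₁ ε₂ : ℕ → Bool} (hac : a ≠ c) (had : a ≠ d) (hbc : b ≠ c)
    (hbd : b ≠ d) (hr : 2 ≤ r.val) (hr' : 2 ≤ r'.val)
    (hc : (chip ε a b hab).mate (.inl c) = .inr c') (hd : (chip ε a b hab).mate (.inl d) = .inr d')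
    (ha : (chip ε' c d hcd).mate (.inl a) = .inr a')
    (hb : (chip ε' c d hcd).mate (.inl b) = .inr b')
    (hs : Equiv.swap r s = Equiv.swap c' d') (hs' : Equiv.swap r' s' = Equiv.swap a' b')
    (hx : ∀ x : ℕ, x ≠ a.val → x ≠ b.val → x ≠ c.val → x ≠ d.val →
      fwd ε₁ r s (fwd ε a b x) = fwd ε₂ r' s' (fwd ε' c d x)) :
    chip ε a b hab * chip ε₁ r s hrs = chip ε' c d hcd * chip ε₂ r' s' hrs' := by
  have e1 := ll_mul_swap ll_chip hc hd ((ll_chip (ε := ε₁) (h := hrs)).trans (by rw [hs])) hcd.ne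
  have e2 := ll_mul_swap ll_chip ha hb ((ll_chip (ε := ε₂) (h := hrs')).trans (by rw [hs'])) hab.ne
  have hline : ∀ {p q u v : Fin n} {p' q' u' v' : Fin n} {ε ε₁ : ℕ → Bool} (hpq : p < q)
      (huv : u < v), (chip ε p q hpq).mate (.inl p') = .inr u' →
      (chip ε p q hpq).mate (.inl q') = .inr v' → Equiv.swap u v = Equiv.swap u' v' →
      ∀ x y : Fin n, x ≠ p → x ≠ q → x ≠ p' → x ≠ q' → y.val = fwd ε₁ u v (fwd ε p q x) →
      (chip ε p q hpq * chip ε₁ u v huv).mate (.inl x) = .inr y := by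
    intro p q u v p' q' u' v' ε ε₁ hpq huv h1 h2 h3 x y n1 n2 n3 n4 hy
    have h4 := chip_line (ε := ε) (h := hpq) n1 n2
      (y := ⟨fwd ε p q x, fwd_lt hpq q.isLt x.isLt⟩) rfl
    have m1 : (⟨fwd ε p q x, fwd_lt hpq q.isLt x.isLt⟩ : Fin n) ≠ u' := by
      rintro rfl
      exact n3 (Sum.inl_injective (Brauer.mate_injective _ (h4.trans h1.symm)))
    have m2 : (⟨fwd ε p q x, fwd_lt hpq q.isLt x.isLt⟩ : Fin n) ≠ v' := by
      rintro rfl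
      exact n4 (Sum.inl_injective (Brauer.mate_injective _ (h4.trans h2.symm)))
    have m3 := Equiv.swap_apply_of_ne_of_ne m1 m2
    rw [← h3] at m3
    refine mul_line h4 (chip_line ?_ ?_ hy)
    · intro e
      rw [e, Equiv.swap_apply_left] at m3
      exact huv.ne' m3
    · intro e
      rw [e, Equiv.swap_apply_right] at m3
      exact huv.ne m3
  refine eq_of_mate_inl (fun x => ?_) ((rr_chip_mul_chip hr).trans (rr_chip_mul_chip hr').symm)
  by_cases hxs : x = a ∨ x = b ∨ x = c ∨ x = d
  · have h1 : Equiv.swap a b (Equiv.swap c d x) = Equiv.swap c d (Equiv.swap a b x) := by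
      have := Equiv.mul_swap_eq_swap_mul (Equiv.swap a b) c d
      rw [Equiv.swap_apply_of_ne_of_ne hac.symm hbc.symm,
        Equiv.swap_apply_of_ne_of_ne had.symm hbd.symm] at this
      exact congrArg (fun σ : Equiv.Perm (Fin n) => σ x) this
    have h2 : Equiv.swap c d (Equiv.swap a b x) ≠ x := by
      rw [← h1]
      rcases hxs with rfl | rfl | rfl | rfl
      · rw [Equiv.swap_apply_of_ne_of_ne hac had, Equiv.swap_apply_left]; exact hab.ne'
      · rw [Equiv.swap_apply_of_ne_of_ne hbc hbd, Equiv.swap_apply_right]; exact hab.ne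
      · rw [Equiv.swap_apply_left, Equiv.swap_apply_of_ne_of_ne had.symm hbd.symm]; exact hcd.ne'
      · rw [Equiv.swap_apply_right, Equiv.swap_apply_of_ne_of_ne hac.symm hbc.symm]; exact hcd.ne
    rw [mate_inl_of_ll_ne (by rw [e1, h1]; exact h2), mate_inl_of_ll_ne (by rw [e2]; exact h2),
      e1, e2, h1]
  · push Not at hxs
    obtain ⟨n1, n2, n3, n4⟩ := hxs
    have h1 : fwd ε₁ r s (fwd ε a b x) < n :=
      fwd_lt hrs s.isLt (fwd_lt hab b.isLt x.isLt)
    rw [hline hab hrs hc hd hs x ⟨_, h1⟩ n1 n2 n3 n4 rfl,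
      hline hcd hrs' ha hb hs' x ⟨_, h1⟩ n3 n4 n1 n2 (hx x (fun e => n1 (Fin.ext e))
        (fun e => n2 (Fin.ext e)) (fun e => n3 (Fin.ext e)) (fun e => n4 (Fin.ext e)))]

/-- The pin c meets the right-right block {0', 1'} of the first chip. A line arriving at d is led
through c to its partner and, by the shape of the second chip, back to d'. Here absorption is an
identity of chips, with no cross-section assumed. -/
theorem chip_mul_chip_of_low (hc : c.val < 2) :
    chip ε a b hab * chip ε' c d hcd = chip ε a b hab := by
  have hn := two_le_of_lt hab
  have hrr : rr (chip ε a b hab) = blk n 1 := rr_chip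
  have hll : ll (chip ε a b hab * chip ε' c d hcd) = ll (chip ε a b hab) := by
    refine ll_mul_eq_left fun m h1 h2 => ?_
    rw [hrr] at h1 ⊢
    have hm : 2 ≤ m.val := by
      by_contra h
      exact (blk_ne_iff hn).2 (by omega) h1
    have hcp : (blk n 1 c).val = partner c.val := blk_val_of_lt hn (by omega)
    rw [ll_chip] at h2 ⊢
    rcases Equiv.eq_or_eq_of_swap_apply_ne_self h2 with rfl | rfl
    · omega
    · rw [Equiv.swap_apply_right]
      have h3 : blk n 1 c ≠ c := (blk_ne_iff hn).2 (by omega)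
      refine ⟨h3, Equiv.swap_apply_of_ne_of_ne h3 fun h => ?_⟩
      rw [h] at hcp
      unfold partner at hcp
      omega
  have hline : ∀ x m, (chip ε a b hab).mate (.inl x) = .inr m →
      (chip ε a b hab * chip ε' c d hcd).mate (.inl x) = .inr m := by
    intro x m hm
    have hm2 : 2 ≤ m.val := by
      by_contra h
      have h1 := rr_of_inl ((Brauer.mate_eq_iff _).1 hm)
      rw [hrr] at h1
      exact (blk_ne_iff hn).2 (by omega) h1
    by_cases hmd : m = d
    · subst hmd
      have h3 : blk n 1 c ≠ c := (blk_ne_iff hn).2 (by omega)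
      have hcp : (blk n 1 c).val = partner c.val := blk_val_of_lt hn (by omega)
      have h1 : (chip ε' c m hcd).mate (.inl m) = .inl c :=
        (Brauer.mate_eq_iff _).1 (RCan.mate_pair ll_chip hcd.ne)
      have h2 : (chip ε a b hab).mate (.inr c) = .inr (blk n 1 c) := by
        rw [← hrr]
        exact mate_inr_of_rr_ne (by rw [hrr]; exact h3)
      exact mul_zigzag hm h1 h2 (chip_partner hcp (by
        rintro rfl
        rw [hcp] at hm2
        unfold partner at hm2
        omega))
    · exact mul_line hm (chip_high (by omega) hmd)
  refine eq_of_mate_inl (fun x => ?_) (funext fun y => ?_)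
  · by_cases hx : ll (chip ε a b hab) x = x
    · obtain ⟨m, hm⟩ := ll_eq_self_iff.1 hx
      rw [hm, hline x m hm]
    · rw [mate_inl_of_ll_ne hx, mate_inl_of_ll_ne (hll ▸ hx), hll]
  · by_cases hy : y.val < 2
    · have : rr (chip ε' c d hcd) y ≠ y := by
        rw [rr_chip, blk_ne_iff hn]
        omega
      rw [rr_mul_of_ne this, rr_chip, rr_chip]
    · obtain ⟨x, hx⟩ := rr_eq_self_iff.1
        (show rr (chip ε a b hab) y = y by rw [hrr, blk_of_le (by omega)])
      rw [rr_of_inl hx, rr_of_inl ((Brauer.mate_eq_iff _).1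
        (hline x y ((Brauer.mate_eq_iff _).1 hx)))]

end ChipProducts

/-! ### Construction of the normal cross-sections -/

/-- The elements of corank `2` of the normal cross-section with parameters `u` and `v`. -/
def cell (u v : Bool) (a b : Fin n) (h : a < b) : Brauer n := chip (fun _ => bit u v a b) a b h

theorem ll_cell {u v : Bool} {a b : Fin n} {h : a < b} :
    ll (cell u v a b h) = Equiv.swap a b := ll_chip

theorem rr_cell {u v : Bool} {a b : Fin n} {h : a < b} : rr (cell u v a b h) = blk n 1 := rr_chip

theorem mate_cell {u v : Bool} {a b : Fin n} {h : a < b} :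
    (cell u v a b h).mate (.inl a) = .inl b := RCan.mate_pair ll_cell h.ne

theorem bit_congr {u v : Bool} {a b c d : ℕ} (h : b = partner a ↔ d = partner c)
    (h' : u = v ∨ ((a + b) % 2 = 0 ↔ (c + d) % 2 = 0)) : bit u v a b = bit u v c d := by
  unfold bit
  rcases h' with rfl | h'
  · simp only [ite_self, h]
  · simp only [h, h']

theorem twist_false (y : ℕ) : twist false y = y := rfl

/-- Cells with disjoint pairs commute, up to a change of the second factors. -/
def CommutingCells (u v : Bool) (a b c d : Fin n) (hab : a < b) (hcd : c < d) : Prop :=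
  ∃ (r s r' s' c' d' : Fin n) (hrs : r < s) (hrs' : r' < s'), 2 ≤ r.val ∧ 2 ≤ r'.val ∧
    (cell u v a b hab).mate (.inl c) = .inr c' ∧ (cell u v a b hab).mate (.inl d) = .inr d' ∧
    Equiv.swap r s = Equiv.swap c' d' ∧
    cell u v a b hab * cell u v r s hrs = cell u v c d hcd * cell u v r' s' hrs'

theorem commutingCells_of_eq {u v : Bool} (hn : 7 ≤ n → u = v) {a b c d : Fin n} (hab : a < b)
    (hcd : c < d) (hac : a ≠ c) (had : a ≠ d) (hbc : b ≠ c) (hbd : b ≠ d)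
    (h : a.val / 2 = c.val / 2) : CommutingCells u v a b c d hab hcd := by
  have hab' : a.val < b.val := hab
  have hcd' : c.val < d.val := hcd
  have hbn := b.isLt
  have hdn := d.isLt
  have hac' := Fin.val_ne_of_ne hac
  have had' := Fin.val_ne_of_ne had
  have hbc' := Fin.val_ne_of_ne hbc
  have hbd' := Fin.val_ne_of_ne hbd
  obtain ⟨r, s, hrs, hsw, hr⟩ : ∃ (r s : Fin n) (_ : r < s), Equiv.swap r s = Equiv.swap b d ∧
      2 * (a.val / 2) + 2 ≤ r.val := by
    rcases lt_or_gt_of_ne hbd with hlt | hlt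
    · exact ⟨b, d, hlt, rfl, by omega⟩
    · exact ⟨d, b, hlt, Equiv.swap_comm _ _, by omega⟩
  have h1 : (cell u v a b hab).mate (.inl c) = .inr b :=
    chip_partner (by unfold partner; omega) hbc.symm
  have h2 : (cell u v a b hab).mate (.inl d) = .inr d := chip_high (by omega) hbd.symm
  refine ⟨r, s, r, s, b, d, hrs, hrs, by omega, by omega, h1, h2, hsw, ?_⟩
  refine chip_mul_eq_chip_mul hac had hbc hbd (by omega) (by omega) h1 h2 (a' := d) (b' := b)
    (chip_partner (by unfold partner; omega) had) (chip_high (by omega) hbd) hsw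
    (by rw [hsw, Equiv.swap_comm]) fun x ha hb hc hd => ?_
  congr 1
  rcases Nat.lt_or_ge x (2 * (a.val / 2)) with hx | hx
  · have : bit u v a b = bit u v c d := by
      refine bit_congr (by unfold partner; omega) ?_
      -- If n ≤ 6, then b and d are 4 and 5 in some order, while a and c are partners; so a + b and
      -- c + d have the same parity.
      by_cases h7 : 7 ≤ n
      · exact .inl (hn h7)
      · exact .inr (by omega)
    rw [fwd_low hx, fwd_low (by omega), this]
  · rw [fwd_high (by omega), fwd_high (by omega)]

theorem cells_of_lt {u v : Bool} (hn : 7 ≤ n → u = v) {a b c d : Fin n} (hab : a < b)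
    (hcd : c < d) (hbc : b ≠ c) (hbd : b ≠ d) (h : a.val / 2 < c.val / 2) :
    ∃ (r s a' b' : Fin n) (hrs : r < s), 2 ≤ r.val ∧
    (cell u v a b hab).mate (.inl c) = .inr c ∧ (cell u v a b hab).mate (.inl d) = .inr d ∧
    (cell u v c d hcd).mate (.inl a) = .inr a' ∧ (cell u v c d hcd).mate (.inl b) = .inr b' ∧
    Equiv.swap r s = Equiv.swap a' b' ∧
    cell u v a b hab * cell u v c d hcd = cell u v c d hcd * cell u v r s hrs := by
  have hab' : a.val < b.val := hab
  have hcd' : c.val < d.val := hcd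
  have hbn := b.isLt
  have hdn := d.isLt
  have hbc' := Fin.val_ne_of_ne hbc
  have hbd' := Fin.val_ne_of_ne hbd
  have h1 : (cell u v a b hab).mate (.inl c) = .inr c := chip_high (by omega) hbc.symm
  have h2 : (cell u v a b hab).mate (.inl d) = .inr d := chip_high (by omega) hbd.symm
  have ta := twist_div_two (bit u v c d) (a.val + 2)
  let a' : Fin n := ⟨twist (bit u v c d) (a.val + 2), by omega⟩
  have h3 : (cell u v c d hcd).mate (.inl a) = .inr a' := chip_low (by omega) rfl
  let b' : Fin n := ⟨fwd (fun _ => bit u v c d) c d b, fwd_lt hcd hdn hbn⟩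
  have h4 : (cell u v c d hcd).mate (.inl b) = .inr b' := chip_line hbc hbd rfl
  -- the image of `b` and of the points above the block of `a`
  have himg : ∀ x : ℕ, 2 * (a.val / 2) + 2 ≤ x → x ≠ c.val → x ≠ d.val →
      2 * (a.val / 2) + 4 ≤ fwd (fun _ => bit u v c d) c d x := by
    intro x hx hxc hxd
    rcases Nat.lt_or_ge x (2 * (c.val / 2)) with hlow | hge
    · have := twist_div_two (bit u v c d) (x + 2)
      rw [fwd_low hlow]
      omega
    · by_cases hp : x = partner c.val
      · rw [hp, fwd_partner]
        unfold partner at hp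
        omega
      · unfold partner at hp
        rw [fwd_high (by omega)]
        omega
  have hA : a'.val = twist (bit u v c d) (a.val + 2) := rfl
  have hB : b'.val = fwd (fun _ => bit u v c d) c d b := rfl
  by_cases hp : b.val = partner a.val
  · have hp' : b.val = a.val + 1 ∧ a.val % 2 = 0 := by unfold partner at hp; omega
    let r : Fin n := ⟨a.val + 2, by omega⟩
    let s : Fin n := ⟨a.val + 3, by omega⟩
    have hrs : r < s := by simp [r, s]
    have hB' : b'.val = twist (bit u v c d) (b.val + 2) := by rw [hB, fwd_low (by omega)]
    have hsw : Equiv.swap r s = Equiv.swap a' b' :=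
      swap_eq_swap_twist (bit u v c d) (a.val / 2 + 1) (by simp only [r]; omega)
        (by simp only [s]; omega) (by rw [hA]; congr 1; omega) (by rw [hB']; congr 1; omega)
    refine ⟨r, s, a', b', hrs, by simp [r], h1, h2, h3, h4, hsw, ?_⟩
    refine chip_mul_eq_chip_mul (Fin.ne_of_val_ne (by omega)) (Fin.ne_of_val_ne (by omega)) hbc hbd
      (by omega) (by simp [r]) h1 h2 h3 h4 rfl hsw fun x ha hb hc hd => ?_
    have e1 : bit u v a b = false := if_pos hp
    have e2 : bit u v r s = false := if_pos (by simp only [r, s, partner]; omega)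
    rw [e1, e2]
    rcases Nat.lt_or_ge x (2 * (a.val / 2)) with hx | hx
    · have := twist_div_two (bit u v c d) (x + 2)
      rw [fwd_low hx, fwd_low (x := x) (by omega), fwd_low (by rw [twist_false]; omega),
        fwd_low (by simp only [r]; omega)]
      simp only [twist_false, twist_add_two]
    · have := himg x (by omega) hc hd
      rw [fwd_high (x := x) (by omega), fwd_high (a := r.val) (by simp only [r]; omega)]
  · have hp' : 2 * (a.val / 2) + 2 ≤ b.val := by unfold partner at hp; omega
    have hbb := himg b hp' hbc' hbd'
    have hrs : a' < b' := by
      rw [Fin.lt_def, hA, hB]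
      omega
    refine ⟨a', b', a', b', hrs, by rw [hA]; omega, h1, h2, h3, h4, rfl, ?_⟩
    refine chip_mul_eq_chip_mul (Fin.ne_of_val_ne (by omega)) (Fin.ne_of_val_ne (by omega)) hbc hbd
      (by omega) (by rw [hA]; omega) h1 h2 h3 h4 rfl rfl fun x ha hb hc hd => ?_
    rcases Nat.lt_or_ge x (2 * (a.val / 2)) with hx | hx
    · have t1 := twist_div_two (bit u v c d) (x + 2)
      have t2 := twist_div_two (bit u v a b) (x + 2)
      -- Here a ≥ 2, and b, c, d are three distinct pins from 4 on; so n ≥ 7 and u = v.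
      have e : bit u v a' b' = bit u v a b := by
        exact bit_congr (by unfold partner at *; omega) (.inl (hn (by omega)))
      rw [fwd_low hx, fwd_low (x := x) (by omega), fwd_low (by omega),
        fwd_low (by rw [hA]; omega), e]
      simp only [twist_add_two, twist_twist, Bool.xor_comm]
    · by_cases hxp : x = partner a.val
      · have hax : partner (twist (bit u v c d) (a.val + 2)) = twist (bit u v c d) (x + 2) := by
          rw [hxp]
          cases bit u v c d <;> simp only [twist, partner] <;> omega
        have e1 : fwd (fun _ => bit u v a b) a b x = b.val := by rw [hxp, fwd_partner]
        have e2 : fwd (fun _ => bit u v c d) c d x = partner a'.val := by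
          rw [hA, hax, fwd_low]
          unfold partner at hxp
          omega
        rw [e1, e2, fwd_partner]
      · have hx2 : 2 * (a.val / 2) + 2 ≤ x := by unfold partner at hxp; omega
        have := himg x hx2 hc hd
        rw [fwd_high (x := x) hx2, fwd_high (a := a'.val) (by rw [hA]; omega)]

theorem commutingCells {u v : Bool} (hn : 7 ≤ n → u = v) {a b c d : Fin n} (hab : a < b)
    (hcd : c < d) (hac : a ≠ c) (had : a ≠ d) (hbc : b ≠ c) (hbd : b ≠ d) :
    CommutingCells u v a b c d hab hcd := by
  rcases lt_trichotomy (a.val / 2) (c.val / 2) with h | h | h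
  · obtain ⟨r, s, a', b', hrs, hr, h1, h2, -, -, -, e⟩ := cells_of_lt hn hab hcd hbc hbd h
    exact ⟨c, d, r, s, c, d, hcd, hrs, by omega, hr, h1, h2, rfl, e⟩
  · exact commutingCells_of_eq hn hab hcd hac had hbc hbd h
  · obtain ⟨r, s, c', d', hrs, hr, -, -, h1, h2, hsw, e⟩ :=
      cells_of_lt hn hcd hab had.symm hbd.symm h
    exact ⟨r, s, a, b, c', d', hrs, hab, hr, by omega, h1, h2, hsw, e.symm⟩

/-- The products of `k` cells whose tails avoid the pins `0` and `1`. -/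
inductive Gen (u v : Bool) : ℕ → Brauer n → Prop
  | one : Gen u v 0 1
  | mul {k : ℕ} {β : Brauer n} (a b : Fin n) (hab : a < b) (hβ : Gen u v k β)
      (h : ∀ x : Fin n, x.val < 2 → ll β x = x) : Gen u v (k + 1) (cell u v a b hab * β)

theorem rr_cell_fix {u v : Bool} {a b : Fin n} {hab : a < b} {β : Brauer n}
    (h : ∀ x : Fin n, x.val < 2 → ll β x = x) (y : Fin n)
    (hy : rr (cell u v a b hab) y ≠ y) : ll β y = y := by
  rw [rr_cell, blk_ne_iff (two_le_of_lt hab)] at hy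
  exact h y (by omega)

theorem exists_gen (u v : Bool) {f : Fin n → Fin n} (hf : Function.Involutive f) :
    ∃ k β, Gen u v k β ∧ ll β = f := by
  obtain ⟨N, hN⟩ : ∃ N, (moved f).card = N := ⟨_, rfl⟩
  induction N using Nat.strong_induction_on generalizing f with
  | _ N ih =>
  by_cases h : f = id
  · exact ⟨0, 1, .one, h.symm⟩
  · obtain ⟨a, ha⟩ : ∃ a, f a ≠ a := by
      by_contra hc
      push Not at hc
      exact h (funext hc)
    obtain ⟨a, b, hab, hfa⟩ : ∃ (a b : Fin n) (_ : a < b), f a = b := by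
      rcases lt_or_gt_of_ne ha with hlt | hlt
      · exact ⟨f a, a, hlt, hf a⟩
      · exact ⟨a, f a, hlt, rfl⟩
    have hfb : f b = a := by rw [← hfa, hf a]
    obtain ⟨g, hg, h1, h2⟩ := exists_involutive_of_extends (α := cell u v a b hab) hf (by
      intro x hx
      rw [ll_cell] at hx ⊢
      rcases Equiv.eq_or_eq_of_swap_apply_ne_self hx with rfl | rfl
      · rw [Equiv.swap_apply_left, hfa]
      · rw [Equiv.swap_apply_right, hfb])
    have hlt : (moved g).card < N := by
      have h3 := h2 _ (ll_ofInvolutive g hg)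
      have h4 := card_moved_lt (α := cell u v a b hab) (β := ofInvolutive g hg)
        (by rwa [ll_ofInvolutive]) (a := a)
      rw [h3, ll_ofInvolutive, hN] at h4
      refine h4 ?_
      rw [ll_cell, Equiv.swap_apply_left]
      exact hab.ne'
    obtain ⟨k, γ, hγ, e⟩ := ih _ hlt hg rfl
    refine ⟨k + 1, cell u v a b hab * γ, .mul a b hab hγ fun x hx => ?_, h2 γ e⟩
    rw [e]
    exact h1 x (by rw [rr_cell, blk_ne_iff (two_le_of_lt hab)]; omega)

theorem exists_gen_mul (u v : Bool) {f : Fin n → Fin n} (hf : Function.Involutive f) {a b : Fin n}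
    (hab : a < b) (hfa : f a = b) : ∃ k γ, Gen u v k γ ∧ (∀ x : Fin n, x.val < 2 → ll γ x = x) ∧
      ll (cell u v a b hab * γ) = f := by
  have hfb : f b = a := by rw [← hfa, hf a]
  obtain ⟨g, hg, h1, h2⟩ := exists_involutive_of_extends (α := cell u v a b hab) hf (by
    intro x hx
    rw [ll_cell] at hx ⊢
    rcases Equiv.eq_or_eq_of_swap_apply_ne_self hx with rfl | rfl
    · rw [Equiv.swap_apply_left, hfa]
    · rw [Equiv.swap_apply_right, hfb])
  obtain ⟨k, γ, hγ, e⟩ := exists_gen u v hg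
  refine ⟨k, γ, hγ, fun x hx => ?_, h2 γ e⟩
  rw [e]
  exact h1 x (by rw [rr_cell, blk_ne_iff (two_le_of_lt hab)]; omega)

/-- Diamond argument, by induction on the number of moved pins. If the leading pairs coincide,
cancel them. Otherwise they are disjoint blocks {a, b} and {c, d} of one involution: by induction
the tail of the first product may be rewritten so that it starts with the cell of {r, s}, and the
commutation identity then brings {c, d} to the front. -/
theorem Gen.ext {u v : Bool} (hn : 7 ≤ n → u = v) {k k' : ℕ} {β β' : Brauer n}
    (hβ : Gen u v k β) (hβ' : Gen u v k' β') (h : ll β = ll β') : β = β' := by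
  obtain ⟨N, hN⟩ : ∃ N, (moved (ll β)).card = N := ⟨_, rfl⟩
  induction N using Nat.strong_induction_on generalizing k k' β β' with
  | _ N ih =>
  have hmv : ∀ {a b : Fin n} {hab : a < b} {γ : Brauer n},
      ll (cell u v a b hab * γ) a = b := fun {a b hab γ} =>
    ll_of_inl (mul_left_left mate_cell)
  cases hβ with
  | one =>
    cases hβ' with
    | one => rfl
    | mul c d hcd hγ' hf' =>
      have := hmv (hab := hcd) (γ := ‹_›)
      rw [← h, ll_one] at this
      exact absurd this hcd.ne
  | @mul j γ a b hab hγ hf =>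
    cases hβ' with
    | one =>
      have := hmv (hab := hab) (γ := γ)
      rw [h, ll_one] at this
      exact absurd this hab.ne
    | @mul j' γ' c d hcd hγ' hf' =>
      have e1 := hmv (hab := hab) (γ := γ)
      have e2 := hmv (hab := hcd) (γ := γ')
      rw [← h] at e2
      have hlt : (moved (ll γ)).card < N := by
        rw [← hN]
        refine card_moved_lt (rr_cell_fix hf) (a := a) ?_
        rw [ll_cell, Equiv.swap_apply_left]
        exact hab.ne'
      by_cases hac : a = c
      · subst hac
        obtain rfl : b = d := e1.symm.trans e2
        rw [ih _ hlt hγ hγ' (ll_eq_of_ll_mul_eq (rr_cell_fix hf) (rr_cell_fix hf') h) rfl]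
      · have e1' : ll (cell u v a b hab * γ) b = a := by
          have := ll_involutive (cell u v a b hab * γ) a
          rwa [e1] at this
        have had : a ≠ d := by
          rintro rfl
          have := ll_involutive (cell u v a b hab * γ) c
          rw [e2, e1] at this
          subst this
          exact lt_asymm hab hcd
        have hbc : b ≠ c := by
          rintro rfl
          exact had (e1'.symm.trans e2)
        have hbd : b ≠ d := by
          rintro rfl
          have := ll_involutive (cell u v a b hab * γ) c
          rw [e2, e1'] at this
          exact hac this
        obtain ⟨r, s, r', s', c', d', hrs, hrs', hr, hr', hc', hd', hsw, hcomm⟩ :=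
          commutingCells hn hab hcd hac had hbc hbd
        have hγr : ll γ r = s := by
          have h1 := mate_ll_mul (rr_cell_fix hf) hc'
          rw [e2, hd'] at h1
          have h1 := (Sum.inr_injective h1).symm
          have h2 : Equiv.swap c' d' r = s := by rw [← hsw, Equiv.swap_apply_left]
          have h3 : Equiv.swap c' d' r ≠ r := by rw [h2]; exact hrs.ne'
          rcases Equiv.eq_or_eq_of_swap_apply_ne_self h3 with rfl | rfl
          · rw [h1, ← h2, Equiv.swap_apply_left]
          · rw [← h1, ll_involutive, ← h2, ← h1, Equiv.swap_apply_right]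
        obtain ⟨i, δ, hδ, hδf, hδe⟩ := exists_gen_mul u v (ll_involutive γ) hrs hγr
        have hγδ : γ = cell u v r s hrs * δ :=
          ih _ hlt hγ (.mul r s hrs hδ hδf) hδe.symm rfl
        -- The tail γ avoids block 0, which the cell of {r, s} sends to block 1; hence δ avoids
        -- block 1. The cell of {r', s'} also sends block 0 to block 1, so the new tail avoids block
        -- 0 as `Gen` requires.
        have hδ4 : ∀ y : Fin n, y.val / 2 = 1 → ll δ y = y := by
          intro y hy
          obtain ⟨x, hx, hxy⟩ := exists_chip_low (ε := fun _ => bit u v r s) (hrs := hrs) (y := y)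
            (by omega) (by omega)
          have h1 := mate_ll_mul (α := cell u v r s hrs) (rr_cell_fix hδf) hxy
          rw [hδe, hf x (by omega)] at h1
          exact (Sum.inr_injective (h1.symm.trans hxy))
        have hfix : ∀ x : Fin n, x.val < 2 → ll (cell u v r' s' hrs' * δ) x = x := by
          intro x hx
          obtain ⟨y, hy, hxy⟩ := chip_low_two (ε := fun _ => bit u v r' s') (hrs := hrs') hr' hx
          obtain ⟨z, hz⟩ := ll_eq_self_iff.1 (hδ4 y hy)
          exact ll_of_inr (mul_line hxy hz)
        have hassoc : cell u v a b hab * γ = cell u v c d hcd * (cell u v r' s' hrs' * δ) := by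
          rw [hγδ, ← mul_assoc, hcomm, mul_assoc]
        rw [hassoc] at h hN ⊢
        have hlt' : (moved (ll (cell u v r' s' hrs' * δ))).card < N := by
          rw [← hN]
          refine card_moved_lt (rr_cell_fix hfix) (a := c) ?_
          rw [ll_cell, Equiv.swap_apply_left]
          exact hcd.ne'
        rw [ih _ hlt' (.mul r' s' hrs' hδ hδf) hγ'
          (ll_eq_of_ll_mul_eq (rr_cell_fix hfix) (rr_cell_fix hf') h) rfl]

/-- If β moves one of the pins 0 and 1, uniqueness allows β to be rewritten with a leading cell at
such a pin, and this cell is absorbed by the new one on its left. -/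
theorem Gen.cell_mul {u v : Bool} (hn : 7 ≤ n → u = v) {k : ℕ} {β : Brauer n}
    (hβ : Gen u v k β) {a b : Fin n} (hab : a < b) : ∃ j, Gen u v j (cell u v a b hab * β) := by
  by_cases h : ∀ x : Fin n, x.val < 2 → ll β x = x
  · exact ⟨k + 1, .mul a b hab hβ h⟩
  · push Not at h
    obtain ⟨x, hx, hne⟩ := h
    obtain ⟨c, d, hcd, hc, e⟩ : ∃ (c d : Fin n) (_ : c < d), c.val < 2 ∧ ll β c = d := by
      rcases lt_or_gt_of_ne hne with hlt | hlt
      · exact ⟨ll β x, x, hlt, by have : (ll β x).val < x.val := hlt; omega, ll_involutive β x⟩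
      · exact ⟨x, ll β x, hlt, hx, rfl⟩
    obtain ⟨j, γ, hγ, hf, hll⟩ := exists_gen_mul u v (ll_involutive β) hcd e
    have : β = cell u v c d hcd * γ := hβ.ext hn (.mul c d hcd hγ hf) hll.symm
    refine ⟨j + 1, ?_⟩
    rw [this, ← mul_assoc, show cell u v a b hab * cell u v c d hcd = cell u v a b hab from
      chip_mul_chip_of_low hc]
    exact .mul a b hab hγ hf

theorem Gen.mul_gen {u v : Bool} (hn : 7 ≤ n → u = v) {k j : ℕ} {β β' : Brauer n}
    (hβ : Gen u v k β) (hβ' : Gen u v j β') : ∃ i, Gen u v i (β * β') := by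
  induction hβ with
  | one => exact ⟨j, by rwa [one_mul]⟩
  | mul a b hab _ _ ih =>
    obtain ⟨i, hi⟩ := ih
    rw [mul_assoc]
    exact hi.cell_mul hn hab

theorem corank_cell {u v : Bool} {a b : Fin n} {hab : a < b} : (cell u v a b hab).corank = 2 := by
  rw [corank_eq_ll, ll_cell, card_moved_swap hab.ne]

theorem Gen.corank_le {u v : Bool} {k : ℕ} {β : Brauer n} (hβ : Gen u v k β) :
    β.corank ≤ 2 * k := by
  induction hβ with
  | one =>
    have : moved (id : Fin n → Fin n) = ∅ := by ext; simp [mem_moved]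
    rw [corank_eq_ll, ll_one, this]
    rfl
  | @mul k β a b hab _ _ ih =>
    have := corank_mul_le (α := cell u v a b hab) (β := β)
    rw [corank_cell] at this
    omega

theorem Gen.shift {u v : Bool} {k : ℕ} {β : Brauer n} (hβ : Gen u v k β) (j : ℕ)
    (h : ∀ x : Fin n, x.val < 2 * j + 2 → ll β x = x) (x : Fin n) (hx : x.val / 2 = j) :
    ∃ y : Fin n, y.val / 2 = j + k ∧ β.mate (.inl x) = .inr y := by
  induction hβ generalizing j x with
  | one => exact ⟨x, hx, rfl⟩
  | @mul k γ a b hab hγ hf ih =>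
    have hne : ll (cell u v a b hab * γ) a ≠ a := by
      rw [ll_of_inl (mul_left_left mate_cell)]
      exact hab.ne'
    have ha : 2 * j + 2 ≤ a.val := by
      by_contra hlt
      exact hne (h a (by omega))
    have hab' : a.val < b.val := hab
    have hbn := b.isLt
    have ht := twist_div_two (bit u v a b) (x.val + 2)
    let y : Fin n := ⟨twist (bit u v a b) (x.val + 2), by omega⟩
    have hy : y.val / 2 = (x.val + 2) / 2 := ht
    have hxy : (cell u v a b hab).mate (.inl x) = .inr y := chip_low (by omega) rfl
    obtain ⟨z, hz, hyz⟩ := ih (j + 1) (fun w hw => by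
      by_cases hw2 : w.val < 2
      · exact hf w hw2
      · obtain ⟨x', hx', h1⟩ := exists_chip_low (ε := fun _ => bit u v a b) (hrs := hab) (y := w)
          (by omega) (by omega)
        have h2 := mate_ll_mul (α := cell u v a b hab) (rr_cell_fix hf) h1
        rw [h x' (by omega)] at h2
        exact Sum.inr_injective (h2.symm.trans h1)) y (by omega)
    exact ⟨z, by omega, mul_line hxy hyz⟩

/-- Each further cell shifts block 0 up by one, so the block {0', 1'} of the leading cell is pushed
by its tail of length k to block k. Together with the right-right blocks of the tail this gives
canonicity. -/
theorem Gen.rr_eq {u v : Bool} {k : ℕ} {β : Brauer n} (hβ : Gen u v k β) {t : ℕ} (ht : t < k)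
    {x y : Fin n} (hx : x.val = 2 * t) (hy : y.val = 2 * t + 1) : rr β x = y := by
  induction hβ with
  | one => omega
  | @mul k γ a b hab hγ hf ih =>
    rcases Nat.lt_or_ge t k with h | h
    · have h1 := ih h
      rw [rr_mul_of_ne (by rw [h1]; rintro rfl; omega), h1]
    · obtain rfl : t = k := by omega
      have hn := two_le_of_lt hab
      obtain ⟨p, hp, h0⟩ := hγ.shift 0 (by simpa using hf) ⟨0, by omega⟩ (by simp)
      obtain ⟨q, hq, h1⟩ := hγ.shift 0 (by simpa using hf) ⟨1, by omega⟩ (by simp)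
      have hpq : p.val ≠ q.val := by
        intro e
        obtain rfl := Fin.ext e
        have := Sum.inl_injective (γ.mate_injective (h0.trans h1.symm))
        simp at this
      have hcup : (cell u v a b hab).mate (.inr ⟨0, by omega⟩) = .inr ⟨1, by omega⟩ := by
        have : rr (cell u v a b hab) ⟨0, by omega⟩ = ⟨1, by omega⟩ := by
          rw [rr_cell]
          apply Fin.ext
          rw [blk_val_of_lt hn (by simp)]
          rfl
        rw [← this]
        exact mate_inr_of_rr_ne (by rw [this]; simp)
      have e1 : rr (cell u v a b hab * γ) p = q :=
        rr_of_inr (mul_cup (γ.mate_eq_iff.1 h0) hcup h1)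
      by_cases hpx : p.val = x.val
      · obtain rfl : p = x := Fin.ext hpx
        rw [e1]
        exact Fin.ext (by omega)
      · obtain rfl : p = y := Fin.ext (by omega)
        obtain rfl : q = x := Fin.ext (by omega)
        rw [← e1, rr_involutive]

/-- The normal cross-section with parameters `u` and `v`. -/
def normalSection (n : ℕ) (u v : Bool) : Set (Brauer n) := {β | ∃ k, Gen u v k β}

theorem cell_mem {u v : Bool} {a b : Fin n} (hab : a < b) :
    cell u v a b hab ∈ normalSection n u v :=
  ⟨1, by simpa using Gen.mul a b hab (.one (u := u) (v := v)) fun _ _ => rfl⟩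

theorem rCan_normalSection {u v : Bool} (hn : 7 ≤ n → u = v) : RCan (normalSection n u v) := by
  refine ⟨isRCrossSection_iff.2 ⟨?_, fun f hf => ?_, ?_⟩, ?_⟩
  · rintro α ⟨k, hα⟩ β ⟨j, hβ⟩
    exact hα.mul_gen hn hβ
  · obtain ⟨k, β, hβ, e⟩ := exists_gen u v hf
    exact ⟨β, ⟨k, hβ⟩, e⟩
  · rintro α ⟨k, hα⟩ β ⟨j, hβ⟩ e
    exact hα.ext hn hβ e
  · rintro - α ⟨j, hα⟩ t - hc x y hx hy
    have := hα.corank_le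
    exact hα.rr_eq (by omega) hx hy

theorem normal_normalSection {u v : Bool} (hn : 7 ≤ n → u = v) :
    Normal (normalSection n u v) := by
  refine fun k => ⟨rCan_normalSection hn, fun t _ a b hab ε ha hb hε => ?_⟩
  rw [(rCan_normalSection hn).bit_unique hε (cell_mem hab) (t := t) (by omega)]
  exact if_pos (by unfold partner; omega)

/-- Splitting off one pair at a time shows that the elements of corank 2 generate the cross-section.
-/
theorem RCan.eq_of_chips {Λ Θ : Set (Brauer n)} (h : RCan Λ) (h' : IsRCrossSection Θ)
    (hc : ∀ (a b : Fin n) (hab : a < b), ∃ ε, chip ε a b hab ∈ Λ ∧ chip ε a b hab ∈ Θ) :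
    Λ = Θ := by
  refine h.1.eq_of_subset h' fun α hα => ?_
  obtain ⟨N, hN⟩ : ∃ N, (moved (ll α)).card = N := ⟨_, rfl⟩
  induction N using Nat.strong_induction_on generalizing α with
  | _ N ih =>
  by_cases h1 : ll α = id
  · rw [h.1.eq_of_ll hα h.1.one_mem h1]
    exact h'.one_mem
  · obtain ⟨a, ha⟩ : ∃ a, ll α a ≠ a := by
      by_contra hc
      push Not at hc
      exact h1 (funext hc)
    obtain ⟨a, b, hab, hfa⟩ : ∃ (a b : Fin n) (_ : a < b), ll α a = b := by
      rcases lt_or_gt_of_ne ha with hlt | hlt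
      · exact ⟨_, a, hlt, ll_involutive α a⟩
      · exact ⟨a, _, hlt, rfl⟩
    have hfb : ll α b = a := by rw [← hfa, ll_involutive α]
    obtain ⟨ε, hε, hε'⟩ := hc a b hab
    obtain ⟨g, hg, h2, h3⟩ := exists_involutive_of_extends (α := chip ε a b hab)
      (ll_involutive α) (by
        intro x hx
        rw [ll_chip] at hx ⊢
        rcases Equiv.eq_or_eq_of_swap_apply_ne_self hx with rfl | rfl
        · rw [Equiv.swap_apply_left, hfa]
        · rw [Equiv.swap_apply_right, hfb])
    obtain ⟨β, hβ, e⟩ := h.1.exists_ll hg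
    have hlt : (moved (ll β)).card < N := by
      rw [← hN, ← h3 β e]
      refine card_moved_lt (by rwa [e]) (a := a) ?_
      rw [ll_chip, Equiv.swap_apply_left]
      exact hab.ne'
    rw [h.1.eq_of_ll hα (h.1.mul_mem hε hβ) (h3 β e).symm]
    exact h'.mul_mem hε' (ih _ hlt β hβ rfl)

theorem normal_iff {Λ : Set (Brauer n)} :
    Normal Λ ↔ ∃ u v : Bool, (7 ≤ n → u = v) ∧ Λ = normalSection n u v := by
  constructor
  · intro h
    obtain ⟨u, v, huv, hc⟩ := h.exists_bit
    exact ⟨u, v, huv, (h 0).1.eq_of_chips (rCan_normalSection huv).1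
      fun a b hab => ⟨_, hc a b hab, cell_mem hab⟩⟩
  · rintro ⟨u, v, huv, rfl⟩
    exact normal_normalSection huv

/-! ### Permutations between normal cross-sections; stabilizers -/

/-- The permutation that exchanges the two elements of each block `{2t, 2t + 1}`. -/
def flipAll (n : ℕ) : Equiv.Perm (Fin n) := (blk_involutive n (n / 2)).toPerm

theorem flipAll_apply (x : Fin n) : flipAll n x = blk n (n / 2) x := rfl

theorem flipAll_mul_self : flipAll n * flipAll n = 1 := by
  ext x
  simp [flipAll_apply, blk_involutive n (n / 2) x]

theorem flipAll_val (x : Fin n) :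
    (flipAll n x).val = if partner x.val < n then partner x.val else x.val := by
  have := x.isLt
  rw [flipAll_apply, blk_val]
  congr 1
  unfold partner
  exact propext (by omega)

theorem flipAll_ne_one (hn : 2 ≤ n) : flipAll n ≠ 1 := by
  intro h
  have h1 := flipAll_val (n := n) ⟨0, by omega⟩
  rw [h] at h1
  simp [partner] at h1
  omega

theorem isBlockFlip_flipAll : IsBlockFlip (fun t => decide (2 * t + 1 < n)) (flipAll n) := by
  intro x
  have := x.isLt
  rw [flipAll_val]
  beta_reduce
  by_cases h : 2 * (x.val / 2) + 1 < n
  · rw [decide_eq_true h, if_pos (by unfold partner; omega)]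
    rfl
  · rw [decide_eq_false h, if_neg (by unfold partner; omega)]
    rfl

/-- The right-right blocks of an element of corank 2k are the same in both cross-sections, and
renumbering carries the one set of blocks to the other. -/
theorem RCan.perm_blk {Λ : Set (Brauer n)} {σ : Equiv.Perm (Fin n)} (h : RCan Λ)
    (h' : RCan (conj σ Λ)) {k : ℕ} (hk : 2 * k ≤ n) (x : Fin n) :
    σ (blk n k x) = blk n k (σ x) := by
  obtain ⟨E, hE, e1, e2, -⟩ := h.exists_proj hk
  have := h'.rr_eq_blk (relabel_mem_conj.2 hE) (j := k)
    (by rw [corank_relabel, corank_eq_ll, e1, card_moved_blk hk])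
  have h2 := rr_relabel (σ := σ) (α := E) x
  rw [this, e2] at h2
  exact h2.symm

theorem RCan.commute_flipAll {Λ : Set (Brauer n)} {σ : Equiv.Perm (Fin n)} (h : RCan Λ)
    (h' : RCan (conj σ Λ)) : σ * flipAll n = flipAll n * σ := by
  ext x
  simp only [Equiv.Perm.mul_apply, flipAll_apply, h.perm_blk h' (by omega : 2 * (n / 2) ≤ n)]

theorem RCan.exists_isBlockFlip {Λ : Set (Brauer n)} {σ : Equiv.Perm (Fin n)} (h : RCan Λ)
    (h' : RCan (conj σ Λ)) : ∃ f, IsBlockFlip f σ := by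
  have hlt : ∀ k, 2 * k ≤ n → ∀ x : Fin n, (σ x).val < 2 * k ↔ x.val < 2 * k := by
    intro k hk x
    rw [← blk_ne_iff hk, ← blk_ne_iff hk, ← h.perm_blk h' hk, σ.injective.ne_iff]
  have hdiv : ∀ x : Fin n, (σ x).val / 2 = x.val / 2 := by
    intro x
    have h1 := x.isLt
    have h2 := (σ x).isLt
    have h3 := hlt (x.val / 2) (by omega) x
    by_cases h4 : 2 * (x.val / 2 + 1) ≤ n
    · have h5 := hlt (x.val / 2 + 1) h4 x
      omega
    · omega
  refine ⟨fun t => decide (∃ x : Fin n, x.val = 2 * t ∧ (σ x).val ≠ 2 * t), fun x => ?_⟩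
  have hx := x.isLt
  let z : Fin n := ⟨2 * (x.val / 2), by omega⟩
  have hz := hdiv z
  have hz' : z.val / 2 = x.val / 2 := by simp [z]
  have hx' := hdiv x
  have hσx := (σ x).isLt
  have hσz := (σ z).isLt
  have hzx : x ≠ z → x = blk n (x.val / 2 + 1) z := by
    intro hne
    have hne' : x.val ≠ 2 * (x.val / 2) := fun e => hne (Fin.ext e)
    apply Fin.ext
    rw [blk_val_of_lt (by omega) (by omega)]
    simp only [z, partner]
    omega
  have hblk : x ≠ z → (σ x).val = partner (σ z).val := by
    intro hne
    have hne' : x.val ≠ 2 * (x.val / 2) := fun e => hne (Fin.ext e)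
    have e := hzx hne
    have h1 := h.perm_blk h' (k := x.val / 2 + 1) (by omega) z
    rw [← e] at h1
    rw [h1, blk_val_of_lt (by omega) (by omega)]
  beta_reduce
  by_cases hf : ∃ y : Fin n, y.val = 2 * (x.val / 2) ∧ (σ y).val ≠ 2 * (x.val / 2)
  · rw [decide_eq_true hf]
    obtain ⟨y, hy, hy'⟩ := hf
    obtain rfl : y = z := Fin.ext hy
    simp only [twist, partner]
    by_cases hxz : x = z
    · have hv : x.val = z.val := congrArg Fin.val hxz
      rw [hxz]
      omega
    · have hne' : x.val ≠ z.val := fun e => hxz (Fin.ext e)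
      rw [hblk hxz]
      unfold partner
      omega
  · rw [decide_eq_false hf]
    push Not at hf
    have h1 := hf z rfl
    simp only [twist]
    by_cases hxz : x = z
    · have hv : x.val = z.val := congrArg Fin.val hxz
      have hzv : z.val = 2 * (x.val / 2) := rfl
      rw [hxz, h1, ← hzv]
    · have hne' : x.val ≠ z.val := fun e => hxz (Fin.ext e)
      have hzv : z.val = 2 * (x.val / 2) := rfl
      rw [hblk hxz, h1]
      unfold partner
      omega

/-- The permutation flips blocks according to some f. Its coboundary must preserve the normalized
bits, so f is constant on the complete blocks. -/
theorem Normal.perm_eq {Λ : Set (Brauer n)} {σ : Equiv.Perm (Fin n)} (h : Normal Λ)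
    (h' : Normal (conj σ Λ)) : σ = 1 ∨ σ = flipAll n := by
  obtain ⟨f, hf⟩ := (h 0).1.exists_isBlockFlip (h' 0).1
  have hstep : ∀ t, 2 * t + 3 < n → f (t + 1) = f t := by
    intro t ht
    let a : Fin n := ⟨2 * t + 2, by omega⟩
    let b : Fin n := ⟨2 * t + 3, ht⟩
    have hab : a < b := by simp [a, b]
    obtain ⟨ε, hε⟩ := (h 0).1.exists_chip hab
    have h1 := (h (t + 1)).2 t (by omega) a b hab ε rfl rfl hε
    have ha : (σ a).val = twist (f (t + 1)) (2 * t + 2) := by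
      rw [hf a, show a.val / 2 = t + 1 by simp only [a]; omega]
    have hb : (σ b).val = twist (f (t + 1)) (2 * t + 3) := by
      rw [hf b, show b.val / 2 = t + 1 by simp only [b]; omega]
    have hs : (a = σ a ∧ b = σ b) ∨ (a = σ b ∧ b = σ a) := by
      simp only [Fin.ext_iff, ha, hb]
      cases f (t + 1)
      · exact .inl ⟨rfl, rfl⟩
      · simp only [twist, partner, a, b]
        omega
    have hmem := relabel_mem_conj (σ := σ).2 hε
    rw [relabel_chip hf (h' := hab) hs] at hmem
    have h2 := (h' (t + 1)).2 t (by omega) a b hab _ rfl rfl hmem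
    rw [h1] at h2
    revert h2
    cases f t <;> cases f (t + 1) <;> simp
  have hall : ∀ t, 2 * t + 1 < n → f t = f 0 := by
    intro t ht
    induction t with
    | zero => rfl
    | succ t ih => rw [hstep t (by omega), ih (by omega)]
  have hlast : ∀ x : Fin n, ¬ 2 * (x.val / 2) + 1 < n → (σ x).val = x.val := by
    intro x hx
    have h1 := hf.div_two x
    have h2 := (σ x).isLt
    have h3 := x.isLt
    omega
  cases h0 : f 0
  · left
    ext x
    by_cases hx : 2 * (x.val / 2) + 1 < n
    · rw [hf x, hall _ hx, h0]; rfl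
    · exact hlast x hx
  · right
    ext x
    rw [isBlockFlip_flipAll x]
    beta_reduce
    by_cases hx : 2 * (x.val / 2) + 1 < n
    · rw [hf x, hall _ hx, h0, decide_eq_true hx]
    · rw [hlast x hx, decide_eq_false hx]; rfl

theorem flipAll_sorted (a b : Fin n) (hab : a < b) : ∃ (c d : Fin n) (_ : c < d),
    (a = flipAll n c ∧ b = flipAll n d) ∨ (a = flipAll n d ∧ b = flipAll n c) := by
  have hinv : ∀ x, flipAll n (flipAll n x) = x := blk_involutive n (n / 2)
  rcases lt_or_gt_of_ne ((flipAll n).injective.ne hab.ne) with h | h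
  · exact ⟨_, _, h, .inl ⟨(hinv a).symm, (hinv b).symm⟩⟩
  · exact ⟨_, _, h, .inr ⟨(hinv a).symm, (hinv b).symm⟩⟩

/-- To check that `flipAll` carries `Λ` to `Θ` it is enough to compare the parameters. -/
theorem RCan.conj_flipAll_eq {Λ Θ : Set (Brauer n)} (h : RCan Λ) (h' : RCan Θ)
    (H : ∀ (a b c d : Fin n) (hab : a < b) (hcd : c < d) (ε ε' : ℕ → Bool),
      (a = flipAll n c ∧ b = flipAll n d) ∨ (a = flipAll n d ∧ b = flipAll n c) →
      chip ε c d hcd ∈ Λ → chip ε' a b hab ∈ Θ → ∀ t < a.val / 2, ε t = ε' t) :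
    conj (flipAll n) Λ = Θ := by
  symm
  refine h'.eq_of_chips (h.1.conj _) fun a b hab => ?_
  obtain ⟨c, d, hcd, hs⟩ := flipAll_sorted a b hab
  obtain ⟨ε', hε'⟩ := h'.exists_chip hab
  obtain ⟨ε, hε⟩ := h.exists_chip hcd
  refine ⟨ε', hε', ?_⟩
  have hmem := relabel_mem_conj (σ := flipAll n).2 hε
  rw [relabel_chip isBlockFlip_flipAll (h' := hab) hs, chip_congr (ε' := ε')] at hmem
  · exact hmem
  · intro t ht
    have hab' : a.val < b.val := hab
    have := b.isLt
    rw [← H a b c d hab hcd ε ε' hs hε hε' t ht]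
    -- From a < b < n the blocks t and t+1 are complete. Both are flipped, so the coboundary
    -- vanishes.
    simp [show 2 * t + 1 < n by omega, show 2 * (t + 1) + 1 < n by omega]

/-- Replacing a and b by their partners preserves the parity of a + b, unless b is an unpaired last
pin. For n ≤ 6, a ≥ 2 and a < b, that exception occurs only for n = 5. -/
theorem conj_flipAll_normalSection {u v : Bool} (hn : 7 ≤ n → u = v) (h5 : n ≠ 5) :
    conj (flipAll n) (normalSection n u v) = normalSection n u v := by
  have hcan := rCan_normalSection hn
  refine hcan.conj_flipAll_eq hcan fun a b c d hab hcd ε ε' hs hε hε' t ht => ?_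
  have hab' : a.val < b.val := hab
  have hcd' : c.val < d.val := hcd
  have hbn := b.isLt
  have hdn := d.isLt
  have hc := flipAll_val c
  have hd := flipAll_val d
  have hdiv := (isBlockFlip_flipAll (n := n)).div_two
  have hc2 := hdiv c
  have hd2 := hdiv d
  have hca : c.val / 2 = a.val / 2 := by
    rcases hs with ⟨rfl, rfl⟩ | ⟨rfl, rfl⟩ <;> omega
  have hdb : d.val / 2 = b.val / 2 := by
    rcases hs with ⟨rfl, rfl⟩ | ⟨rfl, rfl⟩ <;> omega
  rw [hcan.bit_unique hε (cell_mem hcd) (by omega), hcan.bit_unique hε' (cell_mem hab) ht]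
  refine bit_congr (by unfold partner; omega) ?_
  by_cases h7 : 7 ≤ n
  · exact .inl (hn h7)
  · right
    unfold partner at hc hd
    rcases hs with ⟨rfl, rfl⟩ | ⟨rfl, rfl⟩
    · by_cases h1 : d.val + 1 - 2 * (d.val % 2) < n
      · rw [if_pos h1] at hd
        rw [if_pos (by omega)] at hc
        omega
      · omega
    · omega

theorem Normal.conj_flipAll {Λ : Set (Brauer n)} (h : Normal Λ) (h5 : n ≠ 5) :
    conj (flipAll n) Λ = Λ := by
  obtain ⟨u, v, hn, rfl⟩ := normal_iff.1 h
  exact conj_flipAll_normalSection hn h5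

theorem Normal.conj_flipAll_normal {Λ : Set (Brauer n)} (h : Normal Λ) :
    Normal (conj (flipAll n) Λ) := by
  have hcan := (h 0).1.conj_of_flip isBlockFlip_flipAll
  refine fun k => ⟨hcan, fun t _ a b hab ε ha hb hε => ?_⟩
  have hbn := b.isLt
  obtain ⟨ε₁, hε₁⟩ := (h 0).1.exists_chip hab
  have hwa := flipAll_val a
  have hwb := flipAll_val b
  have hs : (a = flipAll n a ∧ b = flipAll n b) ∨ (a = flipAll n b ∧ b = flipAll n a) := by
    right
    rw [if_pos (by unfold partner; omega)] at hwa hwb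
    unfold partner at hwa hwb
    exact ⟨Fin.ext (by omega), Fin.ext (by omega)⟩
  have hmem := relabel_mem_conj (σ := flipAll n).2 hε₁
  rw [relabel_chip isBlockFlip_flipAll (h' := hab) hs] at hmem
  rw [hcan.bit_unique hε hmem (t := t) (by omega),
    (h (t + 1)).2 t (by omega) a b hab ε₁ ha hb hε₁]
  simp [show 2 * t + 1 < n by omega, show 2 * (t + 1) + 1 < n by omega]

section Stabilizers

variable {Λ : Set (Brauer n)}

/-- Conjugate to a normal cross-section. The conjugating permutation relates two canonical ones,
hence commutes with `flipAll`, and the normal case carries over. -/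
theorem RCan.stabilizer_subset (h : RCan Λ) : stabilizer Λ ⊆ {1, flipAll n} := by
  intro σ hσ
  obtain ⟨g, hg⟩ := h.exists_normal
  have hσ' : conj σ Λ = Λ := hσ
  have h1 : conj (g * σ * g⁻¹) (conj g Λ) = conj g Λ := by
    rw [conj_conj, inv_mul_cancel_right, ← conj_conj, hσ']
  rcases hg.perm_eq (σ := g * σ * g⁻¹) (by rw [h1]; exact hg) with e | e
  · left
    rw [mul_inv_eq_one] at e
    exact mul_eq_left.1 e
  · right
    rw [mul_inv_eq_iff_eq_mul, ← h.commute_flipAll (hg 0).1] at e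
    exact mul_left_cancel e

theorem RCan.stabilizer_eq (h : RCan Λ) (h5 : n ≠ 5) : stabilizer Λ = {1, flipAll n} := by
  refine h.stabilizer_subset.antisymm ?_
  rintro σ (rfl | rfl)
  · exact conj_one Λ
  · obtain ⟨g, hg⟩ := h.exists_normal
    have h1 := hg.conj_flipAll h5
    rw [conj_conj, ← h.commute_flipAll (hg 0).1, ← conj_conj] at h1
    have h2 := congrArg (conj g⁻¹) h1
    rwa [conj_inv_conj, conj_inv_conj] at h2

end Stabilizers

theorem normalSection_inj {u v u' v' : Bool} (hn : 5 ≤ n) (huv : 7 ≤ n → u = v)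
    (h : normalSection n u v = normalSection n u' v') :
    u = u' ∧ v = v' := by
  have hcan := rCan_normalSection huv
  have key : ∀ (a b : Fin n) (hab : a < b), 0 < a.val / 2 → bit u v a b = bit u' v' a b :=
    fun a b hab ha => hcan.bit_unique (ε := fun _ => bit u v a b) (ε' := fun _ => bit u' v' a b)
      (cell_mem hab) (h ▸ cell_mem (u := u') (v := v') hab) ha
  constructor
  · simpa [bit, partner] using key ⟨2, by omega⟩ ⟨4, by omega⟩ (by simp) (by simp)
  · simpa [bit, partner] using key ⟨3, by omega⟩ ⟨4, by omega⟩ (by simp) (by simp)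

theorem RCan.eq_normalSection_of_le_four {Λ : Set (Brauer n)} (hn : n ≤ 4) (h : Normal Λ) :
    Λ = normalSection n false false := by
  obtain ⟨u, v, huv, rfl⟩ := normal_iff.1 h
  refine (h 0).1.eq_of_chips (rCan_normalSection fun _ => rfl).1
    fun a b hab => ⟨_, cell_mem hab, ?_⟩
  rw [chip_congr (ε' := fun _ => bit false false a b)]
  · exact cell_mem hab
  · intro t ht
    have hab' : a.val < b.val := hab
    have := b.isLt
    have hp : b.val = partner a.val := by unfold partner; omega
    exact (if_pos hp).trans (if_pos hp).symm

/-! ### Counting orbits -/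

section Counting

instance : Finite (Brauer n) :=
  Finite.of_injective (fun α : Brauer n => α.mate) fun _ _ h => Brauer.ext h

/-- The union of the orbits of the elements of `S`. -/
def orbits (S : Set (Set (Brauer n))) : Set (Set (Brauer n)) :=
  {Θ | ∃ Λ ∈ S, ∃ σ : Equiv.Perm (Fin n), Θ = conj σ Λ}

/-- Count the pairs (σ, Λ) by their image `conj σ Λ`. Each fiber has two elements, (σ, Λ) and its
modification by `flipAll`. This needs only that `flipAll` permutes S, so it covers n = 5, where
members need not be fixed. -/
theorem two_mul_ncard_orbits (hn : 2 ≤ n) {S : Set (Set (Brauer n))} (hS : ∀ Λ ∈ S, Normal Λ)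
    (hw : ∀ Λ ∈ S, conj (flipAll n) Λ ∈ S) :
    2 * (orbits S).ncard = Nat.factorial n * S.ncard := by
  classical
  have hfin : S.Finite := Set.toFinite S
  let F : Finset (Equiv.Perm (Fin n) × Set (Brauer n)) := Finset.univ ×ˢ hfin.toFinset
  have hF : ∀ p, p ∈ F ↔ p.2 ∈ S := fun p => by simp [F]
  let Φ : Equiv.Perm (Fin n) × Set (Brauer n) → Set (Brauer n) := fun p => conj p.1 p.2
  have himg : (orbits S) = (F.image Φ : Finset (Set (Brauer n))) := by
    ext Θ
    simp only [orbits, Set.mem_ofPred_eq, Finset.coe_image, Set.mem_image, Finset.mem_coe, hF,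
      Prod.exists, Φ]
    constructor
    · rintro ⟨Λ, hΛ, σ, rfl⟩
      exact ⟨σ, Λ, hΛ, rfl⟩
    · rintro ⟨σ, Λ, hΛ, rfl⟩
      exact ⟨Λ, hΛ, σ, rfl⟩
  have hcard : F.card = Nat.factorial n * S.ncard := by
    rw [Finset.card_product, Finset.card_univ, Fintype.card_perm, Fintype.card_fin,
      Set.ncard_eq_toFinset_card S hfin]
  rw [himg, Set.ncard_coe_finset, ← hcard, Finset.card_eq_sum_card_image Φ F,
    Finset.sum_const_nat (m := 2), mul_comm]
  intro Θ hΘ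
  obtain ⟨⟨σ, Λ⟩, hp, rfl⟩ := Finset.mem_image.1 hΘ
  have hΛ : Λ ∈ S := (hF _).1 hp
  have hfib : (F.filter fun q => Φ q = Φ (σ, Λ)) =
      {(σ, Λ), (σ * flipAll n, conj (flipAll n) Λ)} := by
    ext ⟨τ, Γ⟩
    simp only [Finset.mem_filter, hF, Finset.mem_insert, Finset.mem_singleton, Prod.mk.injEq, Φ]
    constructor
    · rintro ⟨hΓ, e⟩
      have e' : Γ = conj (τ⁻¹ * σ) Λ := by
        rw [← conj_conj, ← e, conj_inv_conj]
      rcases (hS Λ hΛ).perm_eq (σ := τ⁻¹ * σ) (by rw [← e']; exact hS Γ hΓ) with h | h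
      · left
        rw [h, conj_one] at e'
        exact ⟨(inv_mul_eq_one.1 h), e'⟩
      · right
        rw [h] at e'
        refine ⟨?_, e'⟩
        rw [inv_mul_eq_iff_eq_mul] at h
        rw [h, mul_assoc, flipAll_mul_self, mul_one]
    · rintro (⟨rfl, rfl⟩ | ⟨rfl, rfl⟩)
      · exact ⟨hΛ, rfl⟩
      · refine ⟨hw Λ hΛ, ?_⟩
        rw [conj_conj, mul_assoc, flipAll_mul_self, mul_one]
  rw [hfib, Finset.card_pair]
  intro e
  have := (Prod.mk.inj e).1
  exact flipAll_ne_one hn (mul_eq_left.1 this.symm)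

theorem crossSections_eq_orbits : crossSections n = orbits {Λ | Normal Λ} := by
  ext Θ
  constructor
  · intro h
    obtain ⟨σ, hσ⟩ := IsRCrossSection.exists_rCan h
    obtain ⟨τ, hτ⟩ := hσ.exists_normal
    refine ⟨_, hτ, (τ * σ)⁻¹, ?_⟩
    rw [conj_conj (σ := τ) (τ := σ), conj_inv_conj]
  · rintro ⟨Λ, hΛ, σ, rfl⟩
    exact (hΛ 0).1.1.conj σ

theorem two_mul_ncard_crossSections (hn : 2 ≤ n) :
    2 * (crossSections n).ncard = Nat.factorial n * {Λ : Set (Brauer n) | Normal Λ}.ncard := by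
  rw [crossSections_eq_orbits]
  exact two_mul_ncard_orbits hn (fun _ h => h) fun _ h => h.conj_flipAll_normal

theorem ncard_normal_of_five_six (h5 : 5 ≤ n) (h6 : n ≤ 6) :
    {Λ : Set (Brauer n) | Normal Λ}.ncard = 4 := by
  have : {Λ : Set (Brauer n) | Normal Λ} =
      (fun p : Bool × Bool => normalSection n p.1 p.2) '' Set.univ := by
    ext Λ
    simp only [Set.mem_ofPred_eq, normal_iff, Set.image_univ, Set.mem_range, Prod.exists]
    constructor
    · rintro ⟨u, v, -, rfl⟩
      exact ⟨u, v, rfl⟩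
    · rintro ⟨u, v, rfl⟩
      exact ⟨u, v, fun h => absurd h (by omega), rfl⟩
  rw [this, Set.ncard_image_of_injective, Set.ncard_univ]
  · simp
  · rintro ⟨u, v⟩ ⟨u', v'⟩ h
    obtain ⟨rfl, rfl⟩ := normalSection_inj h5 (fun h => absurd h (by omega)) h
    rfl

theorem normal_setOf_of_le_four (hn : n ≤ 4) :
    {Λ : Set (Brauer n) | Normal Λ} = {normalSection n false false} := by
  ext Λ
  constructor
  · exact fun h => RCan.eq_normalSection_of_le_four hn h
  · rintro rfl
    exact normal_normalSection fun _ => rfl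

end Counting

/-! ### Translation to the numbering 1, …, n from left to right -/

section Reversal

variable {α : Brauer n} {i j : ℕ}

theorem leftLeft_iff : α.LeftLeft i j ↔ ∃ x y : Fin n, x.val + i = n ∧ y.val + j = n ∧
    (relabel Fin.revPerm α).mate (.inl x) = .inl y := by
  constructor
  · rintro ⟨a, b, ha, hb, h⟩
    refine ⟨a.rev, b.rev, by rw [Fin.val_rev]; omega, by rw [Fin.val_rev]; omega, ?_⟩
    exact (relabel_inl a).trans (by rw [h]; rfl)
  · rintro ⟨x, y, hx, hy, h⟩
    refine ⟨x.rev, y.rev, by rw [Fin.val_rev]; omega, by rw [Fin.val_rev]; omega, ?_⟩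
    have e := relabel_inl (σ := Fin.revPerm) (α := α) x.rev
    rw [Fin.revPerm_apply, Fin.rev_rev, h] at e
    cases h' : α.mate (.inl x.rev) with
    | inl z => rw [h'] at e; rw [Sum.inl.inj e]; simp
    | inr z => rw [h'] at e; cases e

theorem leftRight_iff : α.LeftRight i j ↔ ∃ x y : Fin n, x.val + i = n ∧ y.val + j = n ∧
    (relabel Fin.revPerm α).mate (.inl x) = .inr y := by
  constructor
  · rintro ⟨a, b, ha, hb, h⟩
    refine ⟨a.rev, b.rev, by rw [Fin.val_rev]; omega, by rw [Fin.val_rev]; omega, ?_⟩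
    exact (relabel_inl a).trans (by rw [h]; rfl)
  · rintro ⟨x, y, hx, hy, h⟩
    refine ⟨x.rev, y.rev, by rw [Fin.val_rev]; omega, by rw [Fin.val_rev]; omega, ?_⟩
    have e := relabel_inl (σ := Fin.revPerm) (α := α) x.rev
    rw [Fin.revPerm_apply, Fin.rev_rev, h] at e
    cases h' : α.mate (.inl x.rev) with
    | inl z => rw [h'] at e; cases e
    | inr z => rw [h'] at e; rw [Sum.inr.inj e]; simp

theorem rightRight_iff : α.RightRight i j ↔ ∃ x y : Fin n, x.val + i = n ∧ y.val + j = n ∧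
    (relabel Fin.revPerm α).mate (.inr x) = .inr y := by
  constructor
  · rintro ⟨a, b, ha, hb, h⟩
    refine ⟨a.rev, b.rev, by rw [Fin.val_rev]; omega, by rw [Fin.val_rev]; omega, ?_⟩
    exact (relabel_inr a).trans (by rw [h]; rfl)
  · rintro ⟨x, y, hx, hy, h⟩
    refine ⟨x.rev, y.rev, by rw [Fin.val_rev]; omega, by rw [Fin.val_rev]; omega, ?_⟩
    have e := relabel_inr (σ := Fin.revPerm) (α := α) x.rev
    rw [Fin.revPerm_apply, Fin.rev_rev, h] at e
    cases h' : α.mate (.inr x.rev) with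
    | inl z => rw [h'] at e; cases e
    | inr z => rw [h'] at e; rw [Sum.inr.inj e]; simp

theorem isRCrossSection_conj {σ : Equiv.Perm (Fin n)} {Λ : Set (Brauer n)} :
    IsRCrossSection (conj σ Λ) ↔ IsRCrossSection Λ := by
  refine ⟨fun h => ?_, fun h => h.conj σ⟩
  have := h.conj σ⁻¹
  rwa [conj_inv_conj] at this

theorem isCanonical_iff {Λ : Set (Brauer n)} : IsCanonical Λ ↔ RCan (conj Fin.revPerm Λ) := by
  refine and_congr isRCrossSection_conj.symm ⟨fun h k => forall_mem_conj.2 ?_, fun h α hα => ?_⟩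
  · intro α hα t _ hc x y hx hy
    obtain ⟨K, _, hK, hr⟩ := h α hα
    rw [corank_relabel] at hc
    have := y.isLt
    obtain ⟨x', y', hx', hy', e⟩ := rightRight_iff.1 (hr t (by omega))
    obtain rfl : x' = y := Fin.ext (by omega)
    obtain rfl : y' = x := Fin.ext (by omega)
    exact rr_of_inr (mate_eq_iff _ |>.1 e)
  · obtain ⟨K, hK⟩ := two_dvd_corank α
    have hn := corank_le α
    refine ⟨K, by omega, hK, fun t ht => ?_⟩
    have e := h K _ (relabel_mem_conj (σ := Fin.revPerm).2 hα) t ht (by rw [corank_relabel]; omega)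
      ⟨2 * t, by omega⟩ ⟨2 * t + 1, by omega⟩ rfl rfl
    refine rightRight_iff.2 ⟨⟨2 * t + 1, by omega⟩, ⟨2 * t, by omega⟩, ?_, ?_, ?_⟩
    · simp only; omega
    · simp only; omega
    · have h1 := mate_inr_of_rr_ne (α := relabel Fin.revPerm α) (a := ⟨2 * t, by omega⟩)
        (by rw [e]; simp)
      rw [e] at h1
      exact mate_eq_iff _ |>.1 h1

theorem RCan.isCanonical {Λ : Set (Brauer n)} (h : RCan Λ) :
    IsCanonical (conj Fin.revPerm⁻¹ Λ) :=
  isCanonical_iff.2 (by rwa [conj_conj_inv])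

theorem eq_conj_inv_iff {σ : Equiv.Perm (Fin n)} {Λ Θ : Set (Brauer n)} :
    Θ = conj σ⁻¹ Λ ↔ conj σ Θ = Λ := by
  constructor
  · rintro rfl; exact conj_conj_inv Λ
  · rintro rfl; exact (conj_inv_conj Θ).symm

section Param

variable {Λ : Set (Brauer n)} {ε : ℕ → Bool} {a b : Fin n} {hab : a < b}

theorem exists_line_iff (h : RCan (conj Fin.revPerm Λ))
    (hε : chip ε a b hab ∈ conj Fin.revPerm Λ) (ha : a.val + j = n) (hb : b.val + i = n)
    {p q : ℕ} : (∃ α ∈ Λ, α.corank = 2 ∧ α.LeftLeft i j ∧ α.LeftRight p q) ↔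
      ∃ x y : Fin n, x.val + p = n ∧ y.val + q = n ∧
        (chip ε a b hab).mate (.inl x) = .inr y := by
  constructor
  · rintro ⟨α, hα, hc, hl, hr⟩
    obtain ⟨x, y, hx, hy, e⟩ := leftLeft_iff.1 hl
    obtain rfl : x = b := Fin.ext (by omega)
    obtain rfl : y = a := Fin.ext (by omega)
    have hll : ll (relabel Fin.revPerm α) = ll (chip ε y x hab) := by
      have h1 : ll (relabel Fin.revPerm α) x = y := ll_of_inl e
      have h2 : ll (relabel Fin.revPerm α) y = x := ll_of_inl (mate_eq_iff _ |>.1 e)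
      have hcard : (moved (ll (relabel Fin.revPerm α))).card = 2 := by
        rw [← corank_eq_ll, corank_relabel, hc]
      have hm : {x, y} = moved (ll (relabel Fin.revPerm α)) := by
        refine Finset.eq_of_subset_of_card_le ?_ ?_
        · intro z hz
          rw [mem_moved]
          rcases Finset.mem_insert.1 hz with rfl | hz
          · rw [h1]; exact hab.ne
          · rw [Finset.mem_singleton.1 hz, h2]; exact hab.ne'
        · rw [hcard, Finset.card_pair hab.ne']
      rw [ll_chip]
      funext z
      by_cases hzy : z = y
      · rw [hzy, h2, Equiv.swap_apply_left]
      by_cases hzx : z = x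
      · rw [hzx, h1, Equiv.swap_apply_right]
      rw [Equiv.swap_apply_of_ne_of_ne hzy hzx]
      by_contra hz
      have := mem_moved.2 hz
      rw [← hm] at this
      simp [hzx, hzy] at this
    rw [← h.1.eq_of_ll (relabel_mem_conj.2 hα) hε hll]
    exact leftRight_iff.1 hr
  · intro hr
    rw [conj_eq_image] at hε
    obtain ⟨α, hα, e⟩ := hε
    refine ⟨α, hα, ?_, leftLeft_iff.2 ⟨b, a, hb, ha, ?_⟩, leftRight_iff.2 (by rwa [e])⟩
    · rw [← corank_relabel (σ := Fin.revPerm), e, corank_eq_ll, ll_chip, card_moved_swap hab.ne]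
    · rw [e]
      exact mate_eq_iff _ |>.1 (RCan.mate_pair ll_chip hab.ne)

theorem paramId_iff (h : RCan (conj Fin.revPerm Λ))
    (hε : chip ε a b hab ∈ conj Fin.revPerm Λ) (ha : a.val + j = n) (hb : b.val + i = n)
    {t : ℕ} (ht : t < a.val / 2) : ParamId Λ i j (t + 1) ↔ ε t = false := by
  have hab' : a.val < b.val := hab
  have hn := b.isLt
  refine (exists_line_iff h hε ha hb).trans ?_
  have h2 := twist_div_two (ε t) (2 * t + 2)
  have h3 := twist_cases (ε t) (2 * t + 2)
  -- With l = t + 1, the pin n - 2l + 2 becomes 2t after reversal, and (n - 2l)' and (n - 2l - 1)'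
  -- become (2t+2)' and (2t+3)'; so the parameter is the bit with index t.
  have hm : (chip ε a b hab).mate (.inl ⟨2 * t, by omega⟩) =
      .inr ⟨twist (ε t) (2 * t + 2), by omega⟩ :=
    chip_low (by simp only; omega) (by simp)
  constructor
  · rintro ⟨x, y, hx, hy, e⟩
    have hx' : x = ⟨2 * t, by omega⟩ := Fin.ext (by simp only; omega)
    rw [hx', hm] at e
    have := congrArg Fin.val (Sum.inr.inj e)
    simp only at this
    rcases h3 with h3 | h3
    · exact h3.1
    · omega
  · intro e
    rw [e] at h3
    refine ⟨_, _, by simp only; omega, ?_, hm⟩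
    simp only [e]
    simp at h3
    omega

theorem paramSwap_iff (h : RCan (conj Fin.revPerm Λ))
    (hε : chip ε a b hab ∈ conj Fin.revPerm Λ) (ha : a.val + j = n) (hb : b.val + i = n)
    {t : ℕ} (ht : t < a.val / 2) : ParamSwap Λ i j (t + 1) ↔ ε t = true := by
  have hab' : a.val < b.val := hab
  have hn := b.isLt
  refine (exists_line_iff h hε ha hb).trans ?_
  have h2 := twist_div_two (ε t) (2 * t + 2)
  have h3 := twist_cases (ε t) (2 * t + 2)
  have hm : (chip ε a b hab).mate (.inl ⟨2 * t, by omega⟩) =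
      .inr ⟨twist (ε t) (2 * t + 2), by omega⟩ :=
    chip_low (by simp only; omega) (by simp)
  constructor
  · rintro ⟨x, y, hx, hy, e⟩
    have hx' : x = ⟨2 * t, by omega⟩ := Fin.ext (by simp only; omega)
    rw [hx', hm] at e
    have := congrArg Fin.val (Sum.inr.inj e)
    simp only at this
    rcases h3 with h3 | h3
    · omega
    · exact h3.1
  · intro e
    rw [e] at h3
    refine ⟨_, _, by simp only; omega, ?_, hm⟩
    simp only [e]
    simp at h3
    omega

end Param

/-- A canonical cross-section is determined by its parameters. -/
theorem eq_conj_normalSection_iff {u : Bool} {Θ : Set (Brauer n)} :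
    Θ = conj Fin.revPerm⁻¹ (normalSection n u u) ↔ RCan (conj Fin.revPerm Θ) ∧
      ∀ (a b : Fin n) (hab : a < b) (ε : ℕ → Bool), chip ε a b hab ∈ conj Fin.revPerm Θ →
        ∀ t < a.val / 2, ε t = bit u u a b := by
  have hcan := rCan_normalSection (n := n) (u := u) fun _ => rfl
  rw [eq_conj_inv_iff]
  constructor
  · intro h
    rw [h]
    exact ⟨hcan, fun a b hab ε hε t ht => hcan.bit_unique hε (cell_mem hab) ht⟩
  · rintro ⟨h, hb⟩
    refine h.eq_of_chips hcan.1 fun a b hab => ?_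
    obtain ⟨ε, hε⟩ := h.exists_chip hab
    refine ⟨ε, hε, ?_⟩
    rw [chip_congr (hb a b hab ε hε)]
    exact cell_mem hab

theorem isRegular_iff {Θ : Set (Brauer n)} :
    IsRegular Θ ↔ Θ = conj Fin.revPerm⁻¹ (normalSection n false false) := by
  rw [eq_conj_normalSection_iff, IsRegular, isCanonical_iff]
  refine and_congr_right fun h => ⟨fun H a b hab ε hε t ht => ?_, fun H i j l hi hij hj hl hl' => ?_⟩
  · have hab' : a.val < b.val := hab
    have hn := b.isLt
    have := H (n - b) (n - a) (t + 1) (by omega) (by omega) (by omega) (by omega) (by omega)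
    rw [paramId_iff h hε (by omega) (by omega) ht] at this
    rw [this]
    simp [bit]
  · have hab : (⟨n - j, by omega⟩ : Fin n) < ⟨n - i, by omega⟩ := by
      rw [Fin.mk_lt_mk]; omega
    obtain ⟨ε, hε⟩ := h.exists_chip hab
    obtain ⟨t, rfl⟩ := Nat.exists_eq_add_of_le' hl
    rw [paramId_iff h hε (by simp only; omega) (by simp only; omega) (by simp only; omega),
      H _ _ hab ε hε t (by simp only; omega)]
    simp [bit]

theorem mem_pairs {a b i j : ℕ} (ha : a + j = n) (hb : b + i = n) (hab : a < b) (hi : 1 ≤ i)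
    (h2 : 2 ≤ a) : (i, j) ∈ pairs n ↔ b = partner a := by
  simp only [pairs, List.mem_map, List.mem_range, Prod.mk.injEq, partner]
  constructor
  · rintro ⟨t, ht, h1, h3⟩
    omega
  · intro h
    exact ⟨a / 2 - 1, by omega, by omega, by omega⟩

theorem isAlternating_iff {Θ : Set (Brauer n)} :
    IsAlternating Θ ↔ Θ = conj Fin.revPerm⁻¹ (normalSection n true true) := by
  rw [eq_conj_normalSection_iff, IsAlternating, isCanonical_iff]
  refine and_congr_right fun h => ⟨fun H a b hab ε hε t ht => ?_, fun H i j l hi hij hj hl hl' => ?_⟩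
  · have hab' : a.val < b.val := hab
    have hn := b.isLt
    have := H (n - b) (n - a) (t + 1) (by omega) (by omega) (by omega) (by omega) (by omega)
    rw [paramId_iff h hε (by omega) (by omega) ht, paramSwap_iff h hε (by omega) (by omega) ht,
      mem_pairs (a := a) (b := b) (by omega) (by omega) hab' (by omega) (by omega)] at this
    by_cases hp : b.val = partner a
    · rw [this.1 hp, bit, if_pos hp]
    · rw [this.2 hp, bit, if_neg hp, ite_self]
  · have hab : (⟨n - j, by omega⟩ : Fin n) < ⟨n - i, by omega⟩ := by
      rw [Fin.mk_lt_mk]; omega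
    obtain ⟨ε, hε⟩ := h.exists_chip hab
    obtain ⟨t, rfl⟩ := Nat.exists_eq_add_of_le' hl
    rw [paramId_iff h hε (by simp only; omega) (by simp only; omega) (by simp only; omega),
      paramSwap_iff h hε (by simp only; omega) (by simp only; omega) (by simp only; omega),
      mem_pairs (a := n - j) (b := n - i) (by omega) (by omega) (by omega) hi (by omega),
      H _ _ hab ε hε t (by simp only; omega)]
    exact ⟨fun hp => if_pos hp, fun hp => (if_neg hp).trans (ite_self _)⟩

end Reversal

/-! ### The permutation wₙ and stabilizers of canonical cross-sections -/

section PairFlip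

theorem transposition_val {i j : ℕ} (hi : 1 ≤ i) (hi' : i ≤ n) (hj : 1 ≤ j) (hj' : j ≤ n)
    (x : Fin n) : (transposition n i j x).val =
      if x.val + 1 = i then j - 1 else if x.val + 1 = j then i - 1 else x.val := by
  rw [transposition, dif_pos ⟨⟨hi, hi'⟩, hj, hj'⟩, Equiv.swap_apply_def]
  simp only [Fin.ext_iff]
  split_ifs <;> first | rfl | omega

theorem prod_transposition_val {m : ℕ} (hm : 2 * m + 2 ≤ n) (x : Fin n) :
    (((List.range m).map fun t => transposition n (n - 2 * t - 3) (n - 2 * t - 2)).prod x).val =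
      if 2 ≤ n - 1 - x.val ∧ n - 1 - x.val < 2 * m + 2 then n - 1 - partner (n - 1 - x.val)
      else x.val := by
  induction m generalizing x with
  | zero => rw [if_neg (by omega)]; rfl
  | succ m ih =>
    rw [List.range_succ, List.map_append, List.prod_append, Equiv.Perm.mul_apply, ih (by omega),
      List.map_singleton, List.prod_singleton,
      transposition_val (by omega) (by omega) (by omega) (by omega)]
    have := x.isLt
    unfold partner
    split_ifs <;> omega

theorem pairFlip_eq (hn : 2 ≤ n) : pairFlip n = Fin.revPerm⁻¹ * flipAll n * Fin.revPerm := by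
  ext x
  have := x.isLt
  have h1 : ((Fin.revPerm⁻¹ * flipAll n * Fin.revPerm : Equiv.Perm (Fin n)) x).val =
      n - 1 - (flipAll n x.rev).val := by
    rw [Equiv.Perm.mul_apply, Equiv.Perm.mul_apply]
    change (Fin.rev (flipAll n x.rev)).val = _
    rw [Fin.val_rev]
    omega
  rw [h1, flipAll_val, Fin.val_rev, pairFlip, pairs, List.map_map, Equiv.Perm.mul_apply,
    transposition_val (by omega) (by omega) (by omega) (by omega)]
  change (if ((((List.range (n / 2 - 1)).map fun t =>
    transposition n (n - 2 * t - 3) (n - 2 * t - 2)).prod x).val + 1 = n - 1) then _ else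
    if ((((List.range (n / 2 - 1)).map fun t =>
    transposition n (n - 2 * t - 3) (n - 2 * t - 2)).prod x).val + 1 = n) then _ else
    (((List.range (n / 2 - 1)).map fun t =>
    transposition n (n - 2 * t - 3) (n - 2 * t - 2)).prod x).val) = _
  rw [prod_transposition_val (by omega)]
  unfold partner
  split_ifs <;> omega

theorem pairFlip_ne_one (hn : 2 ≤ n) : pairFlip n ≠ 1 := by
  rw [pairFlip_eq hn]
  intro h
  have h1 : flipAll n * Fin.revPerm = Fin.revPerm := inv_mul_eq_one.1 (by rwa [← mul_assoc]) |>.symm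
  exact flipAll_ne_one hn (mul_eq_right.1 h1)

theorem mem_stabilizer_conj {σ τ : Equiv.Perm (Fin n)} {Λ : Set (Brauer n)} :
    τ * σ * τ⁻¹ ∈ stabilizer (conj τ Λ) ↔ σ ∈ stabilizer Λ := by
  change conj (τ * σ * τ⁻¹) (conj τ Λ) = conj τ Λ ↔ conj σ Λ = Λ
  rw [conj_conj, inv_mul_cancel_right, ← conj_conj]
  refine ⟨fun h => ?_, fun h => by rw [h]⟩
  have := congrArg (conj τ⁻¹) h
  rwa [conj_inv_conj, conj_inv_conj] at this

theorem IsCanonical.stabilizer_subset {Λ : Set (Brauer n)} (hn : 2 ≤ n) (h : IsCanonical Λ) :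
    stabilizer Λ ⊆ {1, pairFlip n} := by
  intro σ hσ
  rcases (isCanonical_iff.1 h).stabilizer_subset (mem_stabilizer_conj.2 hσ) with e | e
  · left
    rw [mul_inv_eq_one] at e
    exact mul_eq_left.1 e
  · right
    change Fin.revPerm * σ * Fin.revPerm⁻¹ = flipAll n at e
    rw [Set.mem_singleton_iff, pairFlip_eq hn, ← e]
    group

theorem one_mem_stabilizer {Λ : Set (Brauer n)} : 1 ∈ stabilizer Λ := conj_one Λ

theorem pairFlip_mem_stabilizer {Λ : Set (Brauer n)} (hn : 2 ≤ n) : pairFlip n ∈ stabilizer Λ ↔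
    conj (flipAll n) (conj Fin.revPerm Λ) = conj Fin.revPerm Λ := by
  rw [← mem_stabilizer_conj (τ := Fin.revPerm), pairFlip_eq hn]
  change _ ↔ flipAll n ∈ stabilizer _
  rw [show Fin.revPerm * (Fin.revPerm⁻¹ * flipAll n * Fin.revPerm) * Fin.revPerm⁻¹ = flipAll n by
    group]

theorem IsCanonical.stabilizer_eq {Λ : Set (Brauer n)} (hn : 2 ≤ n) (h5 : n ≠ 5)
    (h : IsCanonical Λ) : stabilizer Λ = {1, pairFlip n} := by
  refine (h.stabilizer_subset hn).antisymm (Set.insert_subset one_mem_stabilizer ?_)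
  rw [Set.singleton_subset_iff, pairFlip_mem_stabilizer hn]
  have : flipAll n ∈ stabilizer (conj Fin.revPerm Λ) := by
    rw [(isCanonical_iff.1 h).stabilizer_eq h5]
    exact .inr rfl
  exact this

/-- The total flip fixes pin 4 and exchanges 2 and 3, so among the pairs carrying a bit it exchanges
{2, 4} and {3, 4} and preserves {2, 3}. The bits themselves are transported unchanged. -/
theorem RCan.conj_flipAll_five {Λ : Set (Brauer 5)} (h : RCan Λ) {ε ε' : ℕ → Bool}
    (h1 : chip ε 3 4 (by decide) ∈ Λ) (h2 : chip ε' 2 4 (by decide) ∈ Λ) :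
    conj (flipAll 5) Λ = Λ ↔ ε 0 = ε' 0 := by
  constructor
  · intro e
    have hmem := relabel_mem_conj (σ := flipAll 5).2 h2
    rw [relabel_chip isBlockFlip_flipAll (c := 3) (d := 4) (h' := by decide)
      (.inl ⟨by decide, by decide⟩), e] at hmem
    rw [h.bit_unique h1 hmem (t := 0) (by decide)]
    simp
  · intro e
    refine h.conj_flipAll_eq h fun a b c d hab hcd ε₁ ε₂ hs hc hb t ht => ?_
    have hab' : a.val < b.val := hab
    have hbn := b.isLt
    obtain rfl : t = 0 := by omega
    have hcs : (a = 2 ∧ b = 3 ∧ c = 2 ∧ d = 3) ∨ (a = 2 ∧ b = 4 ∧ c = 3 ∧ d = 4) ∨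
        (a = 3 ∧ b = 4 ∧ c = 2 ∧ d = 4) := by
      have ha := flipAll_val c
      have hd := flipAll_val d
      have hcd' : c.val < d.val := hcd
      have := d.isLt
      simp only [Fin.ext_iff]
      change (a.val = 2 ∧ b.val = 3 ∧ c.val = 2 ∧ d.val = 3) ∨
        (a.val = 2 ∧ b.val = 4 ∧ c.val = 3 ∧ d.val = 4) ∨
        (a.val = 3 ∧ b.val = 4 ∧ c.val = 2 ∧ d.val = 4)
      unfold partner at ha hd
      rcases hs with ⟨rfl, rfl⟩ | ⟨rfl, rfl⟩ <;> split_ifs at ha hd <;> omega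
    rcases hcs with ⟨rfl, rfl, rfl, rfl⟩ | ⟨rfl, rfl, rfl, rfl⟩ | ⟨rfl, rfl, rfl, rfl⟩
    · exact h.bit_unique hc hb ht
    · rw [h.bit_unique hc h1 (by decide), h.bit_unique hb h2 (by decide), e]
    · rw [h.bit_unique hc h2 (by decide), h.bit_unique hb h1 (by decide), e]

theorem IsCanonical.pairFlip_mem_stabilizer_five {Λ : Set (Brauer 5)} (h : IsCanonical Λ) :
    pairFlip 5 ∈ stabilizer Λ ↔ (ParamId Λ 1 2 1 ↔ ParamId Λ 1 3 1) := by
  have hcan := isCanonical_iff.1 h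
  obtain ⟨ε, h1⟩ := hcan.exists_chip (a := 3) (b := 4) (by decide)
  obtain ⟨ε', h2⟩ := hcan.exists_chip (a := 2) (b := 4) (by decide)
  rw [pairFlip_mem_stabilizer (by omega), hcan.conj_flipAll_five h1 h2,
    paramId_iff (t := 0) hcan h1 rfl rfl (by decide),
    paramId_iff (t := 0) hcan h2 rfl rfl (by decide)]
  cases ε 0 <;> cases ε' 0 <;> simp

end PairFlip

/-! ### Orbits of the normal cross-sections -/

section Orbits

variable {Λ : Set (Brauer n)}

theorem orbits_singleton : orbits {Λ} = orbit Λ := by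
  ext Θ
  constructor
  · rintro ⟨_, rfl, σ, rfl⟩
    exact ⟨σ, rfl⟩
  · rintro ⟨σ, rfl⟩
    exact ⟨_, rfl, σ, rfl⟩

theorem orbit_conj (τ : Equiv.Perm (Fin n)) : orbit (conj τ Λ) = orbit Λ := by
  ext Θ
  constructor
  · rintro ⟨σ, rfl⟩
    exact ⟨σ * τ, conj_conj _⟩
  · rintro ⟨σ, rfl⟩
    exact ⟨σ * τ⁻¹, by rw [conj_conj, inv_mul_cancel_right]⟩

theorem crossSections_of_le_four (hn : n ≤ 4) :
    crossSections n = orbit (normalSection n false false) := by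
  rw [crossSections_eq_orbits, normal_setOf_of_le_four hn, orbits_singleton]

theorem two_mul_ncard_of_le_four (h2 : 2 ≤ n) (hn : n ≤ 4) :
    2 * (crossSections n).ncard = Nat.factorial n := by
  rw [two_mul_ncard_crossSections h2, normal_setOf_of_le_four hn, Set.ncard_singleton, mul_one]

theorem normal_setOf_of_seven_le (hn : 7 ≤ n) : {Λ : Set (Brauer n) | Normal Λ} =
    {normalSection n false false, normalSection n true true} := by
  ext Λ
  simp only [Set.mem_ofPred_eq, normal_iff, Set.mem_insert_iff, Set.mem_singleton_iff]
  constructor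
  · rintro ⟨u, v, huv, rfl⟩
    obtain rfl := huv hn
    cases u
    · exact .inl rfl
    · exact .inr rfl
  · rintro (rfl | rfl)
    · exact ⟨_, _, fun _ => rfl, rfl⟩
    · exact ⟨_, _, fun _ => rfl, rfl⟩

theorem two_mul_ncard_orbit (hn : 2 ≤ n) (h5 : n ≠ 5) (h : Normal Λ) :
    2 * (orbit Λ).ncard = Nat.factorial n := by
  rw [← orbits_singleton, two_mul_ncard_orbits hn, Set.ncard_singleton, mul_one]
  · rintro _ rfl; exact h
  · rintro _ rfl; exact h.conj_flipAll h5

theorem Normal.disjoint_orbit {Θ : Set (Brauer n)} (h5 : n ≠ 5) (h : Normal Λ) (h' : Normal Θ)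
    (hne : Λ ≠ Θ) : Disjoint (orbit Λ) (orbit Θ) := by
  rw [Set.disjoint_left]
  rintro _ ⟨σ, rfl⟩ ⟨τ, e⟩
  have e' : conj (τ⁻¹ * σ) Λ = Θ := by rw [← conj_conj, e, conj_inv_conj]
  rcases h.perm_eq (σ := τ⁻¹ * σ) (by rwa [e']) with h1 | h1
  · rw [h1, conj_one] at e'; exact hne e'
  · rw [h1, h.conj_flipAll h5] at e'; exact hne e'

end Orbits

/-! ### The individual values of n -/

section Small

theorem crossSections_one : crossSections 1 = {{1}} := by
  have key : ∀ Λ : Set (Brauer 1), IsRCrossSection Λ → Λ = {1} := by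
    intro Λ h
    refine Set.eq_singleton_iff_unique_mem.2 ⟨h.one_mem, fun α hα => ?_⟩
    exact h.eq_of_ll hα h.one_mem (Subsingleton.elim _ _)
  refine Set.eq_singleton_iff_unique_mem.2 ⟨?_, key⟩
  have h := (rCan_normalSection (n := 1) (u := false) (v := false) fun _ => rfl).1
  exact key _ h ▸ h

theorem normalSection_two :
    normalSection 2 false false = {cell false false 0 1 (by decide), 1} := by
  have hcan := rCan_normalSection (n := 2) (u := false) (v := false) fun _ => rfl
  have hinv : ∀ f : Fin 2 → Fin 2, (∀ x, f (f x) = x) → f = Equiv.swap 0 1 ∨ f = id := by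
    decide
  ext α
  simp only [Set.mem_insert_iff, Set.mem_singleton_iff]
  constructor
  · intro hα
    rcases hinv _ (ll_involutive α) with h | h
    · exact .inl (hcan.1.eq_of_ll hα (cell_mem _) (h.trans ll_cell.symm))
    · exact .inr (hcan.1.eq_of_ll hα hcan.1.one_mem (h.trans ll_one.symm))
  · rintro (rfl | rfl)
    · exact cell_mem _
    · exact hcan.1.one_mem

theorem conj_normalSection_two (σ : Equiv.Perm (Fin 2)) :
    conj σ (normalSection 2 false false) = normalSection 2 false false := by
  have : ∀ σ : Equiv.Perm (Fin 2), σ = 1 ∨ σ = flipAll 2 := by decide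
  rcases this σ with rfl | rfl
  · exact conj_one _
  · exact conj_flipAll_normalSection (fun _ => rfl) (by decide)

theorem crossSections_two : crossSections 2 = {normalSection 2 false false} := by
  rw [crossSections_of_le_four (by decide)]
  ext Θ
  constructor
  · rintro ⟨σ, rfl⟩
    exact conj_normalSection_two σ
  · rintro rfl
    exact ⟨1, (conj_one _).symm⟩

theorem normalSection_three : normalSection 3 false false =
    {cell false false 1 2 (by decide), cell false false 0 1 (by decide),
      cell false false 0 2 (by decide), 1} := by
  have hcan := rCan_normalSection (n := 3) (u := false) (v := false) fun _ => rfl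
  have hinv : ∀ f : Fin 3 → Fin 3, (∀ x, f (f x) = x) → f = Equiv.swap 1 2 ∨
      f = Equiv.swap 0 1 ∨ f = Equiv.swap 0 2 ∨ f = id := by
    decide
  ext α
  simp only [Set.mem_insert_iff, Set.mem_singleton_iff]
  constructor
  · intro hα
    rcases hinv _ (ll_involutive α) with h | h | h | h
    · exact .inl (hcan.1.eq_of_ll hα (cell_mem _) (h.trans ll_cell.symm))
    · exact .inr (.inl (hcan.1.eq_of_ll hα (cell_mem _) (h.trans ll_cell.symm)))
    · exact .inr (.inr (.inl (hcan.1.eq_of_ll hα (cell_mem _) (h.trans ll_cell.symm))))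
    · exact .inr (.inr (.inr (hcan.1.eq_of_ll hα hcan.1.one_mem (h.trans ll_one.symm))))
  · rintro (rfl | rfl | rfl | rfl)
    · exact cell_mem _
    · exact cell_mem _
    · exact cell_mem _
    · exact hcan.1.one_mem

theorem relabel_one {σ : Equiv.Perm (Fin n)} : relabel σ (1 : Brauer n) = 1 := by
  refine Brauer.ext (funext fun x => ?_)
  rcases x with x | x
  · exact congrArg Sum.inr (σ.apply_symm_apply x)
  · exact congrArg Sum.inl (σ.apply_symm_apply x)

theorem rCan_three_iff {Λ : Set (Brauer 3)} : RCan Λ ↔ Λ = normalSection 3 false false := by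
  constructor
  · intro h
    refine RCan.eq_normalSection_of_le_four (by decide) fun k => ⟨h, fun t _ a b _ _ _ hb => ?_⟩
    have := b.isLt
    omega
  · rintro rfl
    exact rCan_normalSection fun _ => rfl

theorem leftLeft_cell {u v : Bool} {a b : Fin n} {hab : a < b} {i j : ℕ} (ha : a.val + j = n)
    (hb : b.val + i = n) : (relabel Fin.revPerm⁻¹ (cell u v a b hab)).LeftLeft i j := by
  refine leftLeft_iff.2 ⟨b, a, hb, ha, ?_⟩
  rw [relabel_relabel, mul_inv_cancel, relabel_one_perm]
  exact mate_eq_iff _ |>.1 mate_cell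

theorem isIdempotent_cell {u v : Bool} {σ : Equiv.Perm (Fin n)} {a b : Fin n} {hab : a < b}
    (ha : a.val < 2) :
    relabel σ (cell u v a b hab) * relabel σ (cell u v a b hab) = relabel σ (cell u v a b hab) := by
  rw [← relabel_mul, cell, chip_mul_chip_of_low ha]

theorem isCanonical_three_iff {Λ : Set (Brauer 3)} :
    IsCanonical Λ ↔ Λ = conj Fin.revPerm⁻¹ (normalSection 3 false false) := by
  rw [isCanonical_iff, rCan_three_iff, eq_conj_inv_iff]

theorem crossSections_three {Λ : Set (Brauer 3)} (h : IsCanonical Λ) :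
    crossSections 3 = {Λ, conj (transposition 3 1 2) Λ, conj (transposition 3 1 3) Λ} := by
  have hw : conj (pairFlip 3) Λ = Λ := by
    have : pairFlip 3 ∈ stabilizer Λ := by
      rw [h.stabilizer_eq (by decide) (by decide)]
      exact .inr rfl
    exact this
  -- The three cosets of the stabilizer in S₃.
  have hcosets : ∀ σ : Equiv.Perm (Fin 3), (σ = 1 ∨ σ = pairFlip 3) ∨
      (σ = transposition 3 1 2 ∨ σ = transposition 3 1 2 * pairFlip 3) ∨
      (σ = transposition 3 1 3 ∨ σ = transposition 3 1 3 * pairFlip 3) := by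
    decide
  rw [crossSections_of_le_four (by decide), ← orbit_conj Fin.revPerm⁻¹,
    ← isCanonical_three_iff.1 h]
  ext Θ
  simp only [Set.mem_insert_iff, Set.mem_singleton_iff]
  constructor
  · rintro ⟨σ, rfl⟩
    rcases hcosets σ with (rfl | rfl) | (rfl | rfl) | (rfl | rfl)
    · exact .inl (conj_one _)
    · exact .inl hw
    · exact .inr (.inl rfl)
    · exact .inr (.inl (by rw [← conj_conj, hw]))
    · exact .inr (.inr rfl)
    · exact .inr (.inr (by rw [← conj_conj, hw]))
  · rintro (rfl | rfl | rfl)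
    · exact ⟨1, (conj_one _).symm⟩
    · exact ⟨_, rfl⟩
    · exact ⟨_, rfl⟩

theorem ncard_crossSections_of_five_six (h5 : 5 ≤ n) (h6 : n ≤ 6) :
    (crossSections n).ncard = 2 * Nat.factorial n := by
  have := two_mul_ncard_crossSections (n := n) (by omega)
  rw [ncard_normal_of_five_six h5 h6] at this
  omega

theorem exists_normal_of_mem_crossSections {Θ : Set (Brauer n)} (h : Θ ∈ crossSections n) :
    ∃ Λ, Normal Λ ∧ Θ ∈ orbit Λ := by
  rw [crossSections_eq_orbits] at h
  exact h

theorem exists_paramId_five {Θ : Set (Brauer 5)} (h : Θ ∈ crossSections 5) :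
    ∃ Λ : Set (Brauer 5), IsCanonical Λ ∧ ParamId Λ 1 2 1 ∧ Θ ∈ orbit Λ := by
  obtain ⟨Λ, hΛ, hΘ⟩ := exists_normal_of_mem_crossSections h
  suffices ∃ τ : Equiv.Perm (Fin 5), RCan (conj τ Λ) ∧ ∃ ε : ℕ → Bool, ε 0 = false ∧
      chip ε 3 4 (by decide) ∈ conj τ Λ by
    obtain ⟨τ, hτ, ε, hε, hmem⟩ := this
    refine ⟨_, hτ.isCanonical, ?_, by rwa [orbit_conj, orbit_conj]⟩
    rw [paramId_iff (t := 0) (a := 3) (b := 4) (ε := ε) (hab := by decide)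
      (by rwa [conj_conj_inv]) (by rwa [conj_conj_inv]) rfl rfl (by decide)]
    exact hε
  obtain ⟨ε, hε⟩ := (hΛ 0).1.exists_chip (a := 3) (b := 4) (by decide)
  cases h0 : ε 0
  · exact ⟨1, by rw [conj_one]; exact (hΛ 0).1, ε, h0, by rwa [conj_one]⟩
  -- Flipping block 0 inverts the bit with index 0. The result is canonical though no longer normal,
  -- which suffices here.
  · obtain ⟨σ, hflip, h3, h4⟩ : ∃ σ : Equiv.Perm (Fin 5),
        IsBlockFlip (fun t => decide (t = 0)) σ ∧ 3 = σ 3 ∧ 4 = σ 4 :=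
      ⟨_, isBlockFlip_swap (s := 0) (by decide), by decide, by decide⟩
    have hmem := relabel_mem_conj (σ := σ).2 hε
    rw [relabel_chip hflip (h' := by decide) (.inl ⟨h3, h4⟩)] at hmem
    exact ⟨_, (hΛ 0).1.conj_of_flip hflip, _, by simp [h0], hmem⟩

theorem exists_paramId_six {Θ : Set (Brauer 6)} (h : Θ ∈ crossSections 6) :
    ∃ Λ : Set (Brauer 6), IsCanonical Λ ∧ ParamId Λ 1 2 1 ∧ ParamId Λ 1 2 2 ∧ Θ ∈ orbit Λ := by
  obtain ⟨Λ, hΛ, hΘ⟩ := exists_normal_of_mem_crossSections h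
  refine ⟨_, (hΛ 0).1.isCanonical, ?_⟩
  obtain ⟨u, v, huv, rfl⟩ := normal_iff.1 hΛ
  have hmem : cell u v 4 5 (by decide) ∈ normalSection 6 u v := cell_mem _
  -- After reversal the pair (1, 2) is the block {4, 5}, whose bits vanish for all u and v.
  have hpar : ∀ t < 2, ParamId (conj Fin.revPerm⁻¹ (normalSection 6 u v)) 1 2 (t + 1) := by
    intro t ht
    rw [paramId_iff (a := 4) (b := 5) (ε := fun _ => bit u v 4 5) (hab := by decide)
      (by rw [conj_conj_inv]; exact (hΛ 0).1) (by rwa [conj_conj_inv]) rfl rfl ht]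
    rfl
  exact ⟨hpar 0 (by decide), hpar 1 (by decide), by rwa [orbit_conj]⟩

theorem crossSections_of_seven_le (hn : 7 ≤ n) : crossSections n =
    orbit (normalSection n false false) ∪ orbit (normalSection n true true) := by
  rw [crossSections_eq_orbits, normal_setOf_of_seven_le hn, ← orbits_singleton,
    ← orbits_singleton]
  ext Θ
  simp [orbits]

theorem ncard_crossSections_of_seven_le (hn : 7 ≤ n) :
    (crossSections n).ncard = Nat.factorial n := by
  have h := two_mul_ncard_crossSections (n := n) (by omega)
  rw [normal_setOf_of_seven_le hn, Set.ncard_pair] at h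
  · omega
  · intro e
    exact absurd (normalSection_inj (by omega) (fun _ => rfl) e).1 (by decide)

end Small

end Brauer

theorem theorem4 :
    -- stabilizers of canonical cross-sections
    (∀ n : ℕ, 2 ≤ n → Brauer.pairFlip n ≠ 1) ∧
    (∀ n : ℕ, 2 ≤ n → n ≠ 5 → ∀ Λ : Set (Brauer n), Brauer.IsCanonical Λ →
      Brauer.stabilizer Λ = {1, Brauer.pairFlip n}) ∧
    (∀ Λ : Set (Brauer 5), Brauer.IsCanonical Λ →
      ((Brauer.ParamId Λ 1 2 1 ↔ Brauer.ParamId Λ 1 3 1) →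
        Brauer.stabilizer Λ = {1, Brauer.pairFlip 5}) ∧
      (¬ (Brauer.ParamId Λ 1 2 1 ↔ Brauer.ParamId Λ 1 3 1) →
        Brauer.stabilizer Λ = {1})) ∧
    -- `n = 1`
    (Brauer.crossSections 1 = {{1}}) ∧
    -- `n = 2`
    (∃ α : Brauer 2, α.LeftLeft 1 2 ∧ Brauer.IsCanonical {α, 1} ∧
      Brauer.crossSections 2 = {{α, 1}}) ∧
    -- `n = 3`
    (∃ a b c : Brauer 3, a.LeftLeft 1 2 ∧ b.LeftLeft 2 3 ∧ c.LeftLeft 1 3 ∧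
      a * a = a ∧ b * b = b ∧ c * c = c ∧
      (∀ Λ : Set (Brauer 3), Brauer.IsCanonical Λ ↔ Λ = {a, b, c, 1}) ∧
      Brauer.crossSections 3 = {{a, b, c, 1},
        Brauer.conj (Brauer.transposition 3 1 2) {a, b, c, 1},
        Brauer.conj (Brauer.transposition 3 1 3) {a, b, c, 1}} ∧
      (Brauer.crossSections 3).ncard = 3) ∧
    -- `n = 4`
    ((Brauer.crossSections 4).ncard = 12 ∧
      ∃ Λ : Set (Brauer 4), (∀ Θ : Set (Brauer 4), Brauer.IsRegular Θ ↔ Θ = Λ) ∧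
        Brauer.crossSections 4 = Brauer.orbit Λ) ∧
    -- `n = 5`
    ((Brauer.crossSections 5).ncard = 2 * Nat.factorial 5 ∧
      ∀ Θ ∈ Brauer.crossSections 5, ∃ Λ : Set (Brauer 5), Brauer.IsCanonical Λ ∧
        Brauer.ParamId Λ 1 2 1 ∧ Θ ∈ Brauer.orbit Λ) ∧
    -- `n = 6`
    ((Brauer.crossSections 6).ncard = 2 * Nat.factorial 6 ∧
      ∀ Θ ∈ Brauer.crossSections 6, ∃ Λ : Set (Brauer 6), Brauer.IsCanonical Λ ∧
        Brauer.ParamId Λ 1 2 1 ∧ Brauer.ParamId Λ 1 2 2 ∧ Θ ∈ Brauer.orbit Λ) ∧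
    -- `n ≥ 7`
    (∀ n : ℕ, 7 ≤ n →
      (Brauer.crossSections n).ncard = Nat.factorial n ∧
      ∃ Λ Γ : Set (Brauer n),
        (∀ Θ : Set (Brauer n), Brauer.IsRegular Θ ↔ Θ = Λ) ∧
        (∀ Θ : Set (Brauer n), Brauer.IsAlternating Θ ↔ Θ = Γ) ∧
        Brauer.crossSections n = Brauer.orbit Λ ∪ Brauer.orbit Γ ∧
        Disjoint (Brauer.orbit Λ) (Brauer.orbit Γ) ∧
        2 * (Brauer.orbit Λ).ncard = Nat.factorial n ∧
        2 * (Brauer.orbit Γ).ncard = Nat.factorial n) := by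
  refine ⟨fun n hn => Brauer.pairFlip_ne_one hn, fun n hn h5 Λ h => h.stabilizer_eq hn h5,
    fun Λ h => ⟨fun hp => ?_, fun hp => ?_⟩, Brauer.crossSections_one, ?_, ?_, ⟨?_, ?_⟩,
    ⟨Brauer.ncard_crossSections_of_five_six le_rfl (by decide),
      fun Θ h => Brauer.exists_paramId_five h⟩,
    ⟨Brauer.ncard_crossSections_of_five_six (by decide) le_rfl,
      fun Θ h => Brauer.exists_paramId_six h⟩, fun n hn => ?_⟩
  · exact (h.stabilizer_subset (by decide)).antisymm (Set.insert_subset Brauer.one_mem_stabilizer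
      (Set.singleton_subset_iff.2 (h.pairFlip_mem_stabilizer_five.2 hp)))
  · refine Set.eq_singleton_iff_unique_mem.2 ⟨Brauer.one_mem_stabilizer, fun σ hσ => ?_⟩
    rcases h.stabilizer_subset (by decide) hσ with e | e
    · exact e
    · obtain rfl : σ = Brauer.pairFlip 5 := e
      exact absurd (h.pairFlip_mem_stabilizer_five.1 hσ) hp
  · have hcan := (Brauer.rCan_normalSection (n := 2) (u := false) (v := false) fun _ => rfl)
    refine ⟨Brauer.cell false false 0 1 (by decide), ⟨0, 1, rfl, rfl, Brauer.mate_cell⟩, ?_, ?_⟩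
    · rw [← Brauer.normalSection_two, Brauer.isCanonical_iff, Brauer.conj_normalSection_two]
      exact hcan
    · rw [← Brauer.normalSection_two, Brauer.crossSections_two]
  · have hset := congrArg (Brauer.conj Fin.revPerm⁻¹) Brauer.normalSection_three
    rw [Brauer.conj_eq_image (Λ := {_, _, _, _}), Set.image_insert_eq, Set.image_insert_eq,
      Set.image_insert_eq, Set.image_singleton, Brauer.relabel_one] at hset
    refine ⟨Brauer.relabel Fin.revPerm⁻¹ (Brauer.cell false false 1 2 (by decide)),
      Brauer.relabel Fin.revPerm⁻¹ (Brauer.cell false false 0 1 (by decide)),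
      Brauer.relabel Fin.revPerm⁻¹ (Brauer.cell false false 0 2 (by decide)),
      Brauer.leftLeft_cell rfl rfl, Brauer.leftLeft_cell rfl rfl, Brauer.leftLeft_cell rfl rfl,
      Brauer.isIdempotent_cell (by decide), Brauer.isIdempotent_cell (by decide),
      Brauer.isIdempotent_cell (by decide), fun Λ => ?_, ?_, ?_⟩
    · rw [← hset]
      exact Brauer.isCanonical_three_iff
    · rw [← hset]
      exact Brauer.crossSections_three (Brauer.isCanonical_three_iff.2 rfl)
    · have := Brauer.two_mul_ncard_of_le_four (n := 3) (by decide) (by decide)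
      rw [show Nat.factorial 3 = 6 from rfl] at this
      omega
  · have := Brauer.two_mul_ncard_of_le_four (n := 4) (by decide) le_rfl
    rw [show Nat.factorial 4 = 24 from rfl] at this
    omega
  · exact ⟨_, fun _ => Brauer.isRegular_iff, by
      rw [Brauer.orbit_conj, Brauer.crossSections_of_le_four le_rfl]⟩
  · have hr := Brauer.normal_normalSection (n := n) (u := false) (v := false) fun _ => rfl
    have ha := Brauer.normal_normalSection (n := n) (u := true) (v := true) fun _ => rfl
    refine ⟨Brauer.ncard_crossSections_of_seven_le hn, _, _, fun _ => Brauer.isRegular_iff,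
      fun _ => Brauer.isAlternating_iff, ?_, ?_, ?_, ?_⟩
    · rw [Brauer.orbit_conj, Brauer.orbit_conj, Brauer.crossSections_of_seven_le hn]
    · rw [Brauer.orbit_conj, Brauer.orbit_conj]
      refine hr.disjoint_orbit (by omega) ha fun e => ?_
      exact absurd (Brauer.normalSection_inj (by omega) (fun _ => rfl) e).1 (by decide)
    · rw [Brauer.orbit_conj]
      exact Brauer.two_mul_ncard_orbit (by omega) (by omega) hr
    · rw [Brauer.orbit_conj]
      exact Brauer.two_mul_ncard_orbit (by omega) (by omega) ha
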